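/- \textbf{Conventions.} A tableau of (possibly skew) shape $D$ is a filling of the boxes of $D$ by positive integers; it is \emph{increasing} (resp. \emph{decreasing}) if its entries strictly increase (resp. strictly decrease) along rows from left to right and down columns from top to bottom. An increasing or decreasing tableau is viewed as a sequence of successive \emph{rook strips} $D_1,\dots,D_n$ (skew shapes with at most one box in each row and in each column), from the inside to the outside, each consisting of all boxes with a given entry. If $D,E$ are successive rook strips ($D$ inside, $E$ outside), their \emph{switch} is the unique pair $(E',D')$ of successive rook strips with $E'\sqcup D'=D\sqcup E$ such that every isolated box of $D\sqcup E$ (a box sharing no edge with another box of $D\sqcup E$) stays in its own kind, i.e. isolated boxes of $D$ lie in $D'$ and isolated boxes of $E$ lie in $E'$. For a tableau $T=(D_1,\dots,D_n)$ and a rook strip $E$ extending it, one switches $E$ past $D_n$, then past $D_{n-1}$, and so on down to $D_1$; the result $(D_1',\dots,D_n')$, with the labels kept, is $J^{\searrow}_E(T)$. For a sequence $U=(E_1,\dots,E_m)$ of successive rook strips extending $T$, $J^{\searrow}_U(T)$ is obtained by applying $J^{\searrow}_{E_1}$, then $J^{\searrow}_{E_2}$, and so on. Let $T$ be an increasing or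 decreasing tableau of partition shape $\lambda$, and let $R$ be the $\ell(\lambda)\times\lambda_1$ rectangle. The \emph{$K$-anti-rectification} is $J^{\searrow}(T)=J^{\searrow}_U(T)$, where $U$ is the following sequence of the single boxes of $R/\lambda$. If $T$ is increasing, $U$ runs through the columns of $R/\lambda$ from left to right, each from top to bottom. If $T$ is decreasing, $U$ is made of rounds: each round takes, from the top row to the bottom row, the leftmost box not yet taken of every row of $R/\lambda$ that still has one. For a decreasing tableau $T$ of partition shape, $T^\sharp$ is the rotation of $J^{\searrow}(T)$ by $180^\circ$ in $R$. Let $T_{\le j}$ be the first $j$ columns of $T$, and let $T_{\ge j}$ be $T$ without its first $j-1$ columns. Keys have as many columns as $T$, and columns are regarded as sets of entries. The \emph{left key} $K_-(T)$ of an increasing tableau $T$ of partition shape has as $j$-th column the first column of $J^{\searrow}(T_{\le j})$. The \emph{right key} $K_+(T)$ of a decreasing tableau $T$ of partition shape has as $j$-th column the last column of $J^{\searrow}(T_{\ge j})$. The right key is also defined by taking as $j$-th column the set $\emptyset\star\mathrm{word}(T_{\ge j})$. Here $\mathrm{word}$ reads the columns from left to right, each from bottom to top. For a finite set $S$ of positive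 integers and a positive integer $m$, the set $S\star m$ is obtained from $S$ by replacing its smallest element that is at least $m$ by $m$, or by adding $m$ if there is no such element; a word acts letter by letter from left to right. \textbf{Proposition.} Let $T$ be a decreasing tableau of partition shape $\lambda$. Then $T^\sharp$ is an increasing tableau of shape $\lambda$, and $$K_+(T)=K_-(T^\sharp),$$ for both definitions of $K_+(T)$; that is, for every $j$ the $j$-th columns of the two keys have the same set of entries. -/

import Mathlib

namespace KTableau

/-- A box `(i, j)`: row `i` (counted downwards) and column `j` (counted rightwards), from `0`. -/
abbrev Box := ℕ × ℕ

/-- A filling of a finite set of boxes by natural numbers. The values of `entry` outside `boxes`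
carry no information. -/
structure Filling where
  /-- the set of boxes -/
  boxes : Finset Box
  /-- the entry of each box -/
  entry : Box → ℕ

namespace Filling

/-- Entries are positive, strictly increasing along rows (left to right) and down columns. -/
def IsIncreasing (T : Filling) : Prop :=
  (∀ b ∈ T.boxes, 0 < T.entry b) ∧
  (∀ i j j', (i, j) ∈ T.boxes → (i, j') ∈ T.boxes → j < j' → T.entry (i, j) < T.entry (i, j')) ∧
  (∀ i i' j, (i, j) ∈ T.boxes → (i', j) ∈ T.boxes → i < i' → T.entry (i, j) < T.entry (i', j))

/-- Entries are positive, strictly decreasing along rows (left to right) and down columns. -/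
def IsDecreasing (T : Filling) : Prop :=
  (∀ b ∈ T.boxes, 0 < T.entry b) ∧
  (∀ i j j', (i, j) ∈ T.boxes → (i, j') ∈ T.boxes → j < j' → T.entry (i, j') < T.entry (i, j)) ∧
  (∀ i i' j, (i, j) ∈ T.boxes → (i', j) ∈ T.boxes → i < i' → T.entry (i', j) < T.entry (i, j))

/-- Number of rows of the tight rectangle (touching the axes) around `T`. -/
def numRows (T : Filling) : ℕ := T.boxes.sup fun b => b.1 + 1

/-- Number of columns of the tight rectangle (touching the axes) around `T`. -/
def numCols (T : Filling) : ℕ := T.boxes.sup fun b => b.2 + 1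

/-- Number of boxes in row `i`. -/
def rowLen (T : Filling) (i : ℕ) : ℕ := (T.boxes.filter fun b => b.1 = i).card

/-- The set of entries of column `j`. -/
def column (T : Filling) (j : ℕ) : Finset ℕ := (T.boxes.filter fun b => b.2 = j).image T.entry

/-- The first `n` columns. -/
def takeCols (T : Filling) (n : ℕ) : Filling where
  boxes := T.boxes.filter fun b => b.2 < n
  entry := T.entry

/-- Remove the first `n` columns and move the rest to the left by `n`. -/
def dropCols (T : Filling) (n : ℕ) : Filling where
  boxes := (T.boxes.filter fun b => n ≤ b.2).image fun b => (b.1, b.2 - n)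
  entry := fun b => T.entry (b.1, b.2 + n)

/-- Rotation by 180 degrees inside the rectangle with `r` rows and `c` columns. -/
def rotate (T : Filling) (r c : ℕ) : Filling where
  boxes := T.boxes.image fun b => (r - 1 - b.1, c - 1 - b.2)
  entry := fun b => T.entry (r - 1 - b.1, c - 1 - b.2)

/-- The column reading word: columns from left to right, each read from bottom to top. -/
def word (T : Filling) : List ℕ :=
  (List.range T.numCols).flatMap fun j =>
    ((List.range T.numRows).reverse.filter fun i => (i, j) ∈ T.boxes).map fun i => T.entry (i, j)

end Filling

/-! ### K-theoretic jeu de taquin -/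

/-- Two boxes share an edge. -/
def Adjacent (b c : Box) : Prop :=
  (b.1 = c.1 ∧ (b.2 = c.2 + 1 ∨ c.2 = b.2 + 1)) ∨ (b.2 = c.2 ∧ (b.1 = c.1 + 1 ∨ c.1 = b.1 + 1))

instance (b c : Box) : Decidable (Adjacent b c) := by unfold Adjacent; infer_instance

/-- `b` has no neighbour in `S`. -/
def Isolated (S : Finset Box) (b : Box) : Prop := ∀ c ∈ S, ¬ Adjacent b c

instance (S : Finset Box) (b : Box) : Decidable (Isolated S b) := by
  unfold Isolated; infer_instance

/-- The switch of successive rook strips `D` (inner), `E` (outer): the pair `(E', D')` of rook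
strips, `E'` inner and `D'` outer, with the same union. Isolated boxes of the union keep their
kind; all other boxes change it, since a non-isolated box of the inner (outer) strip is forced to
lie in the inner (outer) strip of any such decomposition of the union. -/
def switch (D E : Finset Box) : Finset Box × Finset Box :=
  ((E.filter fun b => Isolated (D ∪ E) b) ∪ (D.filter fun b => ¬ Isolated (D ∪ E) b),
   (D.filter fun b => Isolated (D ∪ E) b) ∪ (E.filter fun b => ¬ Isolated (D ∪ E) b))

namespace Filling

/-- Switch the strip of boxes of `T` with entry `k` with the strip `E` (which is disjoint
from `T`). Returns the new filling and the new position of `E`. -/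
def switchLabel (T : Filling) (E : Finset Box) (k : ℕ) : Filling × Finset Box :=
  let p := switch (T.boxes.filter fun b => T.entry b = k) E
  ({ boxes := (T.boxes \ p.1) ∪ p.2
     entry := fun b => if b ∈ p.2 then k else T.entry b }, p.1)

/-- Switch `E` past all strips of `T`, beginning with the outermost one. The list `labels` names
the strips of `T` from the innermost to the outermost one. -/
def slideStrip (labels : List ℕ) (T : Filling) (E : Finset Box) : Filling × Finset Box :=
  labels.foldr (fun k p => p.1.switchLabel p.2 k) (T, E)

/-- Forward Kjdt of an increasing tableau `T` along the successive rook strips `U`. -/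
def kjdtInc (T : Filling) (U : List (Finset Box)) : Filling :=
  U.foldl (fun T E => (slideStrip ((T.boxes.image T.entry).sort (· ≤ ·)) T E).1) T

/-- Forward Kjdt of a decreasing tableau `T` along the successive rook strips `U`; the strip
with the largest entry is the innermost one. -/
def kjdtDec (T : Filling) (U : List (Finset Box)) : Filling :=
  U.foldl (fun T E => (slideStrip ((T.boxes.image T.entry).sort (· ≥ ·)) T E).1) T

/-- For `T` of partition shape `λ` with tight rectangle `R`: the column superstandard filling of
`R / λ`, as a sequence of single boxes. Columns from left to right, each from top to bottom. -/
def cssOrder (T : Filling) : List (Finset Box) :=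
  (List.range T.numCols).flatMap fun j =>
    ((List.range T.numRows).filter fun i => (i, j) ∉ T.boxes).map fun i => {(i, j)}

/-- For `T` of partition shape `λ` with tight rectangle `R`: the column reading filling of
`R / λ`, as a sequence of single boxes. Each round occupies the leftmost unoccupied box of every
row that still has one, from the top row to the bottom row. -/
def crOrder (T : Filling) : List (Finset Box) :=
  (List.range T.numCols).flatMap fun t =>
    ((List.range T.numRows).filter fun i => T.rowLen i + t < T.numCols).map fun i =>
      {(i, T.rowLen i + t)}

/-- K-anti-rectification of an increasing tableau of partition shape. -/
def antiRectInc (T : Filling) : Filling := T.kjdtInc T.cssOrder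

/-- K-anti-rectification of a decreasing tableau of partition shape. -/
def antiRectDec (T : Filling) : Filling := T.kjdtDec T.crOrder

/-- `T^♯` for a decreasing tableau `T` of partition shape. -/
def sharp (T : Filling) : Filling := T.antiRectDec.rotate T.numRows T.numCols

/-! ### Keys, given by the list of their columns, each column being the set of its entries -/

/-- Left key of an increasing tableau of partition shape: the column with index `j` is the first
column of the K-anti-rectification of the first `j + 1` columns. -/
def leftKey (T : Filling) : List (Finset ℕ) :=
  (List.range T.numCols).map fun j => (T.takeCols (j + 1)).antiRectInc.column 0

/-- Right key of a decreasing tableau of partition shape: the column with index `j` is the last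
column of the K-anti-rectification of the tableau without its first `j` columns. -/
def rightKey (T : Filling) : List (Finset ℕ) :=
  (List.range T.numCols).map fun j =>
    (T.dropCols j).antiRectDec.column ((T.dropCols j).numCols - 1)

end Filling

/-- The right action of a letter on sets: `m` replaces the smallest element that is at least `m`,
and is added if there is none. -/
def starLetter (S : Finset ℕ) (m : ℕ) : Finset ℕ :=
  if h : (S.filter fun x => m ≤ x).Nonempty then
    insert m (S.erase ((S.filter fun x => m ≤ x).min' h))
  else insert m S

/-- The right action of words on sets. -/
def star (S : Finset ℕ) (w : List ℕ) : Finset ℕ := w.foldl starLetter S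

/-- Right key through the action of words: the column with index `j` is the result of acting on
`∅` by the column reading word of the tableau without its first `j` columns. -/
def Filling.rightKeyStar (T : Filling) : List (Finset ℕ) :=
  (List.range T.numCols).map fun j => star ∅ (T.dropCols j).word

end KTableau

/-! All switches are carried out in one object: a strictly increasing labelling of the whole
quadrant whose level sets are the successive strips. Switching two consecutive strips is the toggle
`tog k`, an involution which commutes with toggles at distance at least two. Hence the boxes `U`
moving inwards one by one past the strips of `T` amount to the strips of `T` moving outwards one by
one past all of `U` (`seqE_eq_seqD`), and every slide can be undone (`up_dn`).

Shape. The boxes of `U` are indexed by round and row. Within a round they run from the top right to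
the bottom left, and boxes of the same row in consecutive rounds follow each other to the right.
This lattice condition survives every outward pass (`Lattice.apply_up`) and forces the final
position of each box (`Lattice.final_position`): `U` ends as the rotated complement of the shape, so
`T^♯` has shape `λ`.

Right key. The number of elements at most `v` in `∅ ⋆ w` is the greatest length of a strictly
increasing subword of `w` with letters at most `v` (`le_card_star_iff`). For the reading word of the
columns from `j` on, such subwords are chains of boxes. One round of slides turns chains in the
columns from `j` on into chains of the same size in the columns from `j + 1` on, and conversely
(`exists_pureChain_seqE_iff`, through the box exchanges of `MixedChain.push` and `MixedChain.pull`).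
After `n - 1 - j` rounds, with `n` the number of columns, only the last column is left, where every
set of boxes is a chain. Hence the last column at that stage is `∅ ⋆ word(T_{≥j})`
(`star_word_dropCols`). Applied with `j = 0` to each truncation of `T`, this identifies the two
right keys.

Left key. Rotating the quadrant picture and complementing its labels turns the reversed process into
slides on `T^♯`. The boxes of the rounds from `n - 1 - j` on end in the last `j + 1` columns, and
undoing their slides never uses the columns further left (`mirror_stage`). So anti-rectifying the
first `j + 1` columns of `T^♯` goes back to the stage after `n - 1 - j` rounds, and its first column
is the last column of that stage, the same set as above. -/

namespace KTableau

/-! ### Toggles of consecutive level sets. -/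

open Classical in
/-- Exchange of the isolated boxes of the strips `k` and `k + 1` of a filling of the quadrant. -/
noncomputable def tog (k : ℕ) (g : Box → ℕ) : Box → ℕ := fun b =>
  if g b = k ∧ ∀ c, Adjacent b c → g c ≠ k + 1 then k + 1
  else if g b = k + 1 ∧ ∀ c, Adjacent b c → g c ≠ k then k
  else g b

/-- Fillings of the quadrant that strictly increase along rows and down columns. -/
def Incr (g : Box → ℕ) : Prop := ∀ i j, g (i, j) < g (i, j + 1) ∧ g (i, j) < g (i + 1, j)

/-- All values below `N` occur. -/
def Attained (N : ℕ) (g : Box → ℕ) : Prop := ∀ k < N, ∃ b, g b = k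

theorem Adjacent.symm {b c : Box} (h : Adjacent b c) : Adjacent c b := by
  unfold Adjacent at *; omega

theorem adjacent_right (i j : ℕ) : Adjacent (i, j) (i, j + 1) := by simp [Adjacent]

theorem adjacent_below (i j : ℕ) : Adjacent (i, j) (i + 1, j) := by simp [Adjacent]

theorem adjacent_cases {b c : Box} (h : Adjacent b c) :
    c = (b.1, b.2 + 1) ∨ c = (b.1 + 1, b.2) ∨ b = (c.1, c.2 + 1) ∨ b = (c.1 + 1, c.2) := by
  obtain ⟨b1, b2⟩ := b
  obtain ⟨c1, c2⟩ := c
  simp only [Adjacent, Prod.mk.injEq] at *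
  omega

namespace Incr

variable {g : Box → ℕ}

theorem row_lt (hg : Incr g) (i : ℕ) {j j' : ℕ} (h : j < j') : g (i, j) < g (i, j') :=
  strictMono_nat_of_lt_succ (f := fun j => g (i, j)) (fun j => (hg i j).1) h

theorem col_lt (hg : Incr g) (j : ℕ) {i i' : ℕ} (h : i < i') : g (i, j) < g (i', j) :=
  strictMono_nat_of_lt_succ (f := fun i => g (i, j)) (fun i => (hg i j).2) h

theorem le (hg : Incr g) {i i' j j' : ℕ} (hi : i ≤ i') (hj : j ≤ j') : g (i, j) ≤ g (i', j') := by
  have h1 : g (i, j) ≤ g (i', j) :=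
    (strictMono_nat_of_lt_succ (f := fun i => g (i, j)) (fun i => (hg i j).2)).monotone hi
  have h2 : g (i', j) ≤ g (i', j') :=
    (strictMono_nat_of_lt_succ (f := fun j => g (i', j)) (fun j => (hg i' j).1)).monotone hj
  exact h1.trans h2

theorem ne_of_adjacent (hg : Incr g) {b c : Box} (h : Adjacent b c) : g b ≠ g c := by
  rcases adjacent_cases h with rfl | rfl | rfl | rfl
  · exact ((hg b.1 b.2).1).ne
  · exact ((hg b.1 b.2).2).ne
  · exact ((hg c.1 c.2).1).ne'
  · exact ((hg c.1 c.2).2).ne'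

end Incr

section Toggle

variable {g : Box → ℕ} {k : ℕ}

theorem tog_of_ne {b : Box} (h1 : g b ≠ k) (h2 : g b ≠ k + 1) : tog k g b = g b := by
  simp [tog, h1, h2]

theorem tog_inner_keep {b c : Box} (hb : g b = k) (hbc : Adjacent b c) (hc : g c = k + 1) :
    tog k g b = k := by
  have : ¬ ∀ c, Adjacent b c → g c ≠ k + 1 := fun h => h c hbc hc
  simp only [tog, hb, this, and_false, if_false]
  simp

theorem tog_inner_move {b : Box} (hb : g b = k) (h : ∀ c, Adjacent b c → g c ≠ k + 1) :
    tog k g b = k + 1 := by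
  unfold tog; rw [if_pos ⟨hb, h⟩]

theorem tog_outer_keep {b c : Box} (hb : g b = k + 1) (hbc : Adjacent b c) (hc : g c = k) :
    tog k g b = k + 1 := by
  have : ¬ ∀ c, Adjacent b c → g c ≠ k := fun h => h c hbc hc
  simp only [tog, hb, this, and_false, if_false]
  simp

theorem tog_outer_move {b : Box} (hb : g b = k + 1) (h : ∀ c, Adjacent b c → g c ≠ k) :
    tog k g b = k := by
  unfold tog; rw [if_neg (by simp [hb]), if_pos ⟨hb, h⟩]

theorem tog_lt {b : Box} (h : g b < k) : tog k g b = g b := tog_of_ne (by omega) (by omega)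

theorem tog_gt {b : Box} (h : k + 1 < g b) : tog k g b = g b := tog_of_ne (by omega) (by omega)

theorem tog_mem_iff {b : Box} : (tog k g b = k ∨ tog k g b = k + 1) ↔ (g b = k ∨ g b = k + 1) := by
  by_cases h1 : g b = k
  · unfold tog; split_ifs <;> simp_all
  by_cases h2 : g b = k + 1
  · unfold tog; split_ifs <;> simp_all
  simp [tog_of_ne h1 h2]

theorem tog_le_iff {b : Box} {x : ℕ} (hx : x ≠ k) : tog k g b ≤ x ↔ g b ≤ x := by
  rcases em (g b = k ∨ g b = k + 1) with h | h
  · rcases tog_mem_iff.2 h with h' | h' <;> omega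
  · push Not at h
    rw [tog_of_ne h.1 h.2]

theorem tog_eq_iff {b : Box} {x : ℕ} (hx : x ≠ k) (hx' : x ≠ k + 1) : tog k g b = x ↔ g b = x := by
  rcases em (g b = k ∨ g b = k + 1) with h | h
  · rcases tog_mem_iff.2 h with h' | h' <;> omega
  · push Not at h
    rw [tog_of_ne h.1 h.2]

/-- The new inner boxes. -/
theorem tog_eq_inner_iff {b : Box} : tog k g b = k ↔
    (g b = k ∧ ∃ c, Adjacent b c ∧ g c = k + 1) ∨
      (g b = k + 1 ∧ ∀ c, Adjacent b c → g c ≠ k) := by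
  constructor
  · intro h
    rcases tog_mem_iff.1 (Or.inl h) with h1 | h1
    · left
      refine ⟨h1, ?_⟩
      by_contra hc
      push Not at hc
      rw [tog_inner_move h1 hc] at h
      omega
    · right
      refine ⟨h1, ?_⟩
      intro c hbc hc
      rw [tog_outer_keep h1 hbc hc] at h
      omega
  · rintro (⟨h1, c, hbc, hc⟩ | ⟨h1, h2⟩)
    · exact tog_inner_keep h1 hbc hc
    · exact tog_outer_move h1 h2

/-- The new outer boxes. -/
theorem tog_eq_outer_iff {b : Box} : tog k g b = k + 1 ↔
    (g b = k + 1 ∧ ∃ c, Adjacent b c ∧ g c = k) ∨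
      (g b = k ∧ ∀ c, Adjacent b c → g c ≠ k + 1) := by
  constructor
  · intro h
    rcases tog_mem_iff.1 (Or.inr h) with h1 | h1
    · right
      refine ⟨h1, ?_⟩
      intro c hbc hc
      rw [tog_inner_keep h1 hbc hc] at h
      omega
    · left
      refine ⟨h1, ?_⟩
      by_contra hc
      push Not at hc
      rw [tog_outer_move h1 hc] at h
      omega
  · rintro (⟨h1, c, hbc, hc⟩ | ⟨h1, h2⟩)
    · exact tog_outer_keep h1 hbc hc
    · exact tog_inner_move h1 h2

/-- Labels change only between `k` and `k + 1`, so only an adjacent pair labelled `k`, `k + 1` is in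
danger. Neither of its boxes is isolated, hence both stay. -/
theorem tog_lt_of_adjacent {b c : Box} (hbc : Adjacent b c) (h : g b < g c) :
    tog k g b < tog k g c := by
  by_cases hb : g b = k
  · by_cases hc : g c = k + 1
    · rw [tog_inner_keep hb hbc hc, tog_outer_keep hc hbc.symm hb]; omega
    · rw [tog_gt (b := c) (by omega)]
      rcases tog_mem_iff.2 (Or.inl hb) with h' | h' <;> omega
  by_cases hb' : g b = k + 1
  · rw [tog_gt (b := c) (by omega)]
    rcases tog_mem_iff.2 (Or.inr hb') with h' | h' <;> omega
  rw [tog_of_ne hb hb']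
  rcases em (g c = k ∨ g c = k + 1) with h' | h'
  · rcases tog_mem_iff.2 h' with h'' | h'' <;> omega
  · push Not at h'
    rw [tog_of_ne h'.1 h'.2]; exact h

theorem Incr.apply_tog (hg : Incr g) (k : ℕ) : Incr (tog k g) := fun i j =>
  ⟨tog_lt_of_adjacent (adjacent_right i j) (hg i j).1,
    tog_lt_of_adjacent (adjacent_below i j) (hg i j).2⟩

/-- Boxes that block each other stay and go on blocking each other. A box that moved remains
isolated: a neighbour in its former strip would either have been there before, against strict
increase, or have come from the other strip, against isolation. -/
theorem tog_tog (hg : Incr g) (k : ℕ) : tog k (tog k g) = g := by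
  funext b
  by_cases hb : g b = k
  · by_cases h : ∃ c, Adjacent b c ∧ g c = k + 1
    · obtain ⟨c, hbc, hc⟩ := h
      rw [tog_inner_keep (tog_inner_keep hb hbc hc) hbc (tog_outer_keep hc hbc.symm hb), hb]
    · push Not at h
      rw [hb]
      refine tog_outer_move (tog_inner_move hb h) fun c hbc hc => ?_
      rcases tog_mem_iff.1 (Or.inl hc) with h' | h'
      · exact hg.ne_of_adjacent hbc (hb.trans h'.symm)
      · exact h c hbc h'
  by_cases hb' : g b = k + 1
  · by_cases h : ∃ c, Adjacent b c ∧ g c = k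
    · obtain ⟨c, hbc, hc⟩ := h
      rw [tog_outer_keep (tog_outer_keep hb' hbc hc) hbc (tog_inner_keep hc hbc.symm hb'), hb']
    · push Not at h
      rw [hb']
      refine tog_inner_move (tog_outer_move hb' h) fun c hbc hc => ?_
      rcases tog_mem_iff.1 (Or.inr hc) with h' | h'
      · exact h c hbc h'
      · exact hg.ne_of_adjacent hbc (hb'.trans h'.symm)
  rw [tog_of_ne (by rwa [tog_of_ne hb hb']) (by rwa [tog_of_ne hb hb']), tog_of_ne hb hb']

theorem tog_congr {g g' : Box → ℕ} {k : ℕ} {b : Box} (hb : g b = g' b)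
    (h : ∀ c, g c = k ↔ g' c = k) (h' : ∀ c, g c = k + 1 ↔ g' c = k + 1) :
    tog k g b = tog k g' b := by
  have h1 : (∀ c, Adjacent b c → g c ≠ k + 1) ↔ ∀ c, Adjacent b c → g' c ≠ k + 1 :=
    forall₂_congr fun c _ => not_congr (h' c)
  have h2 : (∀ c, Adjacent b c → g c ≠ k) ↔ ∀ c, Adjacent b c → g' c ≠ k :=
    forall₂_congr fun c _ => not_congr (h c)
  unfold tog
  rw [hb]
  split_ifs <;> first | rfl | (exfalso; tauto)

theorem tog_comm_apply {i j : ℕ} (hij : i + 2 ≤ j) (b : Box) :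
    tog j (tog i g) b = tog i (tog j g) b := by
  rcases em (g b = i ∨ g b = i + 1) with h | h
  · have h1 : tog i g b = i ∨ tog i g b = i + 1 := tog_mem_iff.2 h
    rw [tog_lt (k := j) (by omega)]
    exact tog_congr (tog_lt (by omega)).symm (fun c => (tog_eq_iff (by omega) (by omega)).symm)
      (fun c => (tog_eq_iff (by omega) (by omega)).symm)
  · push Not at h
    rw [tog_of_ne (g := tog j g) (k := i)
      (by rw [Ne, tog_eq_iff (by omega) (by omega)]; exact h.1)
      (by rw [Ne, tog_eq_iff (by omega) (by omega)]; exact h.2)]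
    exact tog_congr (tog_of_ne h.1 h.2) (fun c => tog_eq_iff (by omega) (by omega))
      (fun c => tog_eq_iff (by omega) (by omega))

theorem tog_comm {i j : ℕ} (hij : i + 2 ≤ j) (g : Box → ℕ) : tog j (tog i g) = tog i (tog j g) :=
  funext (tog_comm_apply hij)

/-- A box of either strip moves into the other one or has a neighbour there that stays. Nonempty
strips are what makes `Below` transitive and the final positions determined. -/
theorem Attained.apply_tog {N : ℕ} (h : Attained N g) (hk : k + 1 < N) : Attained N (tog k g) := by
  intro x hx
  by_cases h1 : x = k
  · subst h1
    obtain ⟨b, hb⟩ := h _ hk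
    by_cases hc : ∃ c, Adjacent b c ∧ g c = x
    · obtain ⟨c, hbc, hc⟩ := hc
      exact ⟨c, tog_inner_keep hc hbc.symm hb⟩
    · push Not at hc
      exact ⟨b, tog_outer_move hb hc⟩
  by_cases h2 : x = k + 1
  · subst h2
    obtain ⟨b, hb⟩ := h k (by omega)
    by_cases hc : ∃ c, Adjacent b c ∧ g c = k + 1
    · obtain ⟨c, hbc, hc⟩ := hc
      exact ⟨c, tog_outer_keep hc hbc.symm hb⟩
    · push Not at hc
      exact ⟨b, tog_inner_move hb hc⟩
  obtain ⟨b, hb⟩ := h x hx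
  exact ⟨b, (tog_eq_iff h1 h2).2 hb⟩

end Toggle

/-! ### Passes of one strip through many, and the two orders of all switches. -/

/-- The strip `a` moves outwards past the next `m` strips. -/
noncomputable def up (a : ℕ) : ℕ → (Box → ℕ) → Box → ℕ
  | 0, g => g
  | m + 1, g => tog (a + m) (up a m g)

/-- The strip `a + n` moves inwards past the previous `n` strips. -/
noncomputable def dn (a : ℕ) : ℕ → (Box → ℕ) → Box → ℕ
  | 0, g => g
  | n + 1, g => dn a n (tog (a + n) g)

/-- The `m` strips that follow the `n` strips from `a` on move inwards past them, one by one. -/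
noncomputable def seqE (a n : ℕ) : ℕ → (Box → ℕ) → Box → ℕ
  | 0, g => g
  | m + 1, g => dn (a + m) n (seqE a n m g)

/-- The `n` strips from `a` on move outwards past the following `m` strips, one by one. -/
noncomputable def seqD (a : ℕ) : ℕ → ℕ → (Box → ℕ) → Box → ℕ
  | 0, _, g => g
  | n + 1, m, g => seqD a n m (up (a + n) m g)

theorem tog_up {a m K : ℕ} (h : a + m ≤ K) (g : Box → ℕ) :
    tog (K + 1) (up a m g) = up a m (tog (K + 1) g) := by
  induction m with
  | zero => rfl
  | succ m ih => rw [up, up, tog_comm (by omega), ih (by omega)]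

theorem tog_seqD {a n m K : ℕ} (h : a + n + m ≤ K + 1) (g : Box → ℕ) :
    tog (K + 1) (seqD a n m g) = seqD a n m (tog (K + 1) g) := by
  induction n generalizing g with
  | zero => rfl
  | succ n ih => rw [seqD, seqD, ih (by omega), tog_up (by omega)]

/-- The `n × (m + 1)` switches form a grid. The switch of the newcomer with the outermost strip
involves labels above those used by `seqD a n m`, so it commutes to the front and completes the
first outward pass. -/
theorem dn_seqD (a n m : ℕ) (g : Box → ℕ) :
    dn (a + m) n (seqD a n m g) = seqD a n (m + 1) g := by
  induction n generalizing g with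
  | zero => rfl
  | succ n ih =>
    rw [seqD, seqD, dn, ← ih, up]
    rcases Nat.eq_zero_or_pos (a + m + n) with h0 | h0
    · have : n = 0 := by omega
      subst this
      have : m = 0 := by omega
      subst this
      simp [seqD, dn, up]
    · obtain ⟨K, hK⟩ : ∃ K, a + m + n = K + 1 := ⟨a + m + n - 1, by omega⟩
      rw [hK, tog_seqD (by omega), show a + n + m = K + 1 by omega]

theorem seqD_zero (a n : ℕ) (g : Box → ℕ) : seqD a n 0 g = g := by
  induction n generalizing g with
  | zero => rfl
  | succ n ih => rw [seqD, up, ih]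

/-- The slides are defined by inward moves, while the lattice condition and the chains are tracked
along outward moves. -/
theorem seqE_eq_seqD (a n m : ℕ) (g : Box → ℕ) : seqE a n m g = seqD a n m g := by
  induction m with
  | zero => rw [seqE, seqD_zero]
  | succ m ih => rw [seqE, ih, dn_seqD]

theorem seqE_add (a n m m' : ℕ) (g : Box → ℕ) :
    seqE a n (m + m') g = seqE (a + m) n m' (seqE a n m g) := by
  induction m' with
  | zero => rfl
  | succ m' ih => rw [← Nat.add_assoc, seqE, ih, seqE, Nat.add_assoc]

section Passes

variable {g : Box → ℕ}

theorem Incr.apply_up (hg : Incr g) (a m : ℕ) : Incr (up a m g) := by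
  induction m with
  | zero => exact hg
  | succ m ih => exact ih.apply_tog _

theorem Incr.apply_dn (hg : Incr g) (a n : ℕ) : Incr (dn a n g) := by
  induction n generalizing g with
  | zero => exact hg
  | succ n ih => exact ih (hg.apply_tog _)

theorem Incr.apply_seqE (hg : Incr g) (a n m : ℕ) : Incr (seqE a n m g) := by
  induction m with
  | zero => exact hg
  | succ m ih => exact ih.apply_dn _ _

theorem Attained.apply_up {N a m : ℕ} (h : Attained N g) (ha : a + m < N) : Attained N (up a m g) := by
  induction m with
  | zero => exact h
  | succ m ih => exact (ih (by omega)).apply_tog (by omega)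

theorem Attained.apply_dn {N a n : ℕ} (h : Attained N g) (ha : a + n < N) : Attained N (dn a n g) := by
  induction n generalizing g with
  | zero => exact h
  | succ n ih => exact ih (h.apply_tog (by omega)) (by omega)

theorem Attained.apply_seqE {N a n m : ℕ} (h : Attained N g) (ha : a + n + m ≤ N) :
    Attained N (seqE a n m g) := by
  induction m with
  | zero => exact h
  | succ m ih => exact (ih (by omega)).apply_dn (by omega)

theorem up_dn (hg : Incr g) (a n : ℕ) : up a n (dn a n g) = g := by
  induction n generalizing g with
  | zero => rfl
  | succ n ih => rw [up, dn, ih (hg.apply_tog _), tog_tog hg]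

theorem up_of_lt {a m : ℕ} {b : Box} (h : g b < a) : up a m g b = g b := by
  induction m with
  | zero => rfl
  | succ m ih => rw [up, tog_lt (by omega), ih]

theorem up_of_gt {a m : ℕ} {b : Box} (h : a + m < g b) : up a m g b = g b := by
  induction m with
  | zero => rfl
  | succ m ih => rw [up, tog_gt (by rw [ih (by omega)]; omega), ih (by omega)]

theorem up_lt_iff {a m x : ℕ} {b : Box} (h : x ≤ a) : up a m g b < x ↔ g b < x := by
  induction m with
  | zero => rfl
  | succ m ih =>
    rw [up]
    cases x with
    | zero => simp
    | succ x => rw [Nat.lt_succ_iff, tog_le_iff (by omega), ← Nat.lt_succ_iff, ih]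

theorem up_le_iff {a m x : ℕ} {b : Box} (h : a + m ≤ x) : up a m g b ≤ x ↔ g b ≤ x := by
  induction m with
  | zero => rfl
  | succ m ih => rw [up, tog_le_iff (by omega), ih (by omega)]

/-- The strips that have been passed keep their position during the rest of the pass. -/
theorem up_add_of_lt {a i m : ℕ} {b : Box} (h : up a i g b < a + i) :
    up a (i + m) g b = up a i g b := by
  induction m with
  | zero => rfl
  | succ m ih => rw [← Nat.add_assoc, up, tog_lt (by omega), ih]

theorem up_add_lt_iff {a i m : ℕ} {b : Box} : up a (i + m) g b < a + i ↔ up a i g b < a + i := by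
  induction m with
  | zero => rfl
  | succ m ih =>
    rw [← Nat.add_assoc, up, ← ih]
    rcases em (up a (i + m) g b = a + (i + m) ∨ up a (i + m) g b = a + (i + m) + 1) with h | h
    · rcases tog_mem_iff.2 h with h' | h' <;> omega
    · push Not at h
      rw [tog_of_ne h.1 h.2]

end Passes

/-! ### Relative position of strips during a pass. -/

/-- The strip `x'` lies strictly below and weakly to the left of the strip `x`. -/
def Below (g : Box → ℕ) (x x' : ℕ) : Prop :=
  ∀ i j i' j', g (i, j) = x → g (i', j') = x' → i < i' ∧ j' ≤ j

/-- The strip `x'` lies strictly to the right of and weakly above the strip `x`. -/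
def RightOf (g : Box → ℕ) (x x' : ℕ) : Prop :=
  ∀ i j i' j', g (i, j) = x → g (i', j') = x' → i' ≤ i ∧ j < j'

section Pass

variable {g : Box → ℕ}

theorem Incr.row_strictMono (hg : Incr g) (i : ℕ) : StrictMono fun j => g (i, j) :=
  fun _ _ h => hg.row_lt i h

theorem Incr.col_strictMono (hg : Incr g) (j : ℕ) : StrictMono fun i => g (i, j) :=
  fun _ _ h => hg.col_lt j h

theorem Incr.row_lt_iff (hg : Incr g) {i j j' : ℕ} : g (i, j) < g (i, j') ↔ j < j' :=
  (hg.row_strictMono i).lt_iff_lt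

theorem Incr.col_lt_iff (hg : Incr g) {j i i' : ℕ} : g (i, j) < g (i', j) ↔ i < i' :=
  (hg.col_strictMono j).lt_iff_lt

theorem Incr.row_inj (hg : Incr g) {i j j' : ℕ} (h : g (i, j) = g (i, j')) : j = j' :=
  (hg.row_strictMono i).injective h

theorem Incr.col_inj (hg : Incr g) {j i i' : ℕ} (h : g (i, j) = g (i', j)) : i = i' :=
  (hg.col_strictMono j).injective h

theorem Incr.adjacent_outer (hg : Incr g) {i j : ℕ} {c : Box} (h : Adjacent (i, j) c)
    (hlt : g (i, j) < g c) : c = (i, j + 1) ∨ c = (i + 1, j) := by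
  rcases adjacent_cases h with rfl | rfl | h' | h'
  · exact Or.inl rfl
  · exact Or.inr rfl
  · have : g c < g (c.1, c.2 + 1) := (hg c.1 c.2).1
    rw [h'] at hlt; omega
  · have : g c < g (c.1 + 1, c.2) := (hg c.1 c.2).2
    rw [h'] at hlt; omega

theorem Incr.tog_inner_cases (hg : Incr g) {k i j : ℕ} (h : tog k g (i, j) = k) :
    (g (i, j) = k ∧ (g (i, j + 1) = k + 1 ∨ g (i + 1, j) = k + 1)) ∨
      (g (i, j) = k + 1 ∧ ∀ c, Adjacent (i, j) c → g c ≠ k) := by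
  rcases tog_eq_inner_iff.1 h with ⟨h1, c, hc, hck⟩ | h1
  · left
    refine ⟨h1, ?_⟩
    rcases hg.adjacent_outer hc (by omega) with rfl | rfl
    · exact Or.inl hck
    · exact Or.inr hck
  · exact Or.inr h1

theorem Incr.tog_outer_cases (hg : Incr g) {k i j : ℕ} (h : tog k g (i, j) = k + 1) :
    (g (i, j) = k + 1 ∧ ((∃ j', j = j' + 1 ∧ g (i, j') = k) ∨ ∃ i', i = i' + 1 ∧ g (i', j) = k)) ∨
      (g (i, j) = k ∧ ∀ c, Adjacent (i, j) c → g c ≠ k + 1) := by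
  rcases tog_eq_outer_iff.1 h with ⟨h1, c, hc, hck⟩ | h1
  · left
    refine ⟨h1, ?_⟩
    obtain ⟨c1, c2⟩ := c
    rcases hg.adjacent_outer hc.symm (by omega) with h' | h' <;>
      simp only [Prod.mk.injEq] at h'
    · exact Or.inl ⟨c2, h'.2, by rw [h'.1]; exact hck⟩
    · exact Or.inr ⟨c1, h'.1, by rw [h'.2]; exact hck⟩
  · exact Or.inr h1

/-- The strip `k` moves out past two strips. A new box of a passed strip is an old box of it, or was
held by the moving strip and has an old box directly to the right or below. The cases below compare
these origins; a box to the left of one of strip `k + 2` cannot belong to strip `k + 1`, by the row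
condition. -/
theorem Below.apply_tog_tog (hg : Incr g) {k : ℕ} (h : Below g (k + 1) (k + 2)) :
    Below (tog (k + 1) (tog k g)) k (k + 1) := by
  have hg1 := hg.apply_tog k
  intro r1 c1 r2 c2 hb hf
  rw [tog_eq_iff (by omega) (by omega)] at hb
  rcases hg1.tog_inner_cases hf with ⟨hf1, hf2⟩ | ⟨hf1, -⟩
  · have hf2 : g (r2, c2 + 1) = k + 2 ∨ g (r2 + 1, c2) = k + 2 := by
      rwa [tog_eq_iff (by omega) (by omega), tog_eq_iff (by omega) (by omega)] at hf2
    rcases tog_eq_outer_iff.1 hf1 with ⟨hf3, d, hd, hdk⟩ | ⟨hf3, hiso⟩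
    · rcases hf2 with hf2 | hf2
      · have := h _ _ _ _ hf3 hf2; omega
      rcases hg.tog_inner_cases hb with ⟨hb1, he | he⟩ | ⟨hb1, hiso⟩
      · have h1 := h _ _ _ _ he hf2
        rcases Nat.lt_or_ge r1 r2 with hr | hr
        · refine ⟨hr, ?_⟩
          by_contra hc
          obtain rfl : c2 = c1 + 1 := by omega
          have := hg.col_inj (he.trans hf3.symm)
          omega
        · obtain rfl : r1 = r2 := by omega
          obtain rfl := hg.row_inj (he.trans hf3.symm)
          have h2 := (hg r1 c1).2
          have h3 := (hg (r1 + 1) c1).1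
          have := h (r1 + 1) c1 _ _ (by omega) hf2
          omega
      · have := h _ _ _ _ he hf2; omega
      · have h1 := h _ _ _ _ hb1 hf2
        refine ⟨?_, h1.2⟩
        by_contra hr
        obtain rfl : r1 = r2 := by omega
        obtain rfl := hg.row_inj (hb1.trans hf3.symm)
        exact hiso d hd hdk
    · rcases hf2 with hf2 | hf2
      · rcases hg.tog_inner_cases hb with ⟨hb1, he | he⟩ | ⟨hb1, -⟩
        · have := h _ _ _ _ he hf2; omega
        · have := h _ _ _ _ he hf2; omega
        · have := h _ _ _ _ hb1 hf2; omega
      · rcases hg.tog_inner_cases hb with ⟨hb1, he | he⟩ | ⟨hb1, -⟩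
        · have h1 := h _ _ _ _ he hf2
          refine ⟨?_, ?_⟩
          · by_contra hr
            obtain rfl : r1 = r2 := by omega
            obtain rfl := hg.row_inj (hb1.trans hf3.symm)
            exact hiso _ (adjacent_right _ _) he
          · by_contra hc
            obtain rfl : c2 = c1 + 1 := by omega
            have := (hg.col_lt_iff (j := c1 + 1) (i := r2) (i' := r1)).1 (by omega)
            have : r1 = r2 := by omega
            subst this
            omega
        · have := h _ _ _ _ he hf2; omega
        · have h1 := h _ _ _ _ hb1 hf2
          refine ⟨?_, h1.2⟩
          by_contra hr
          obtain rfl : r1 = r2 := by omega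
          have h2 : c2 < c1 := hg.row_lt_iff.1 (by omega : g (r1, c2) < g (r1, c1))
          have h3 := (hg r1 c2).1
          have h4 := hiso _ (adjacent_right _ _)
          have h5 := hg.le (le_refl r1) (show c2 + 1 ≤ c1 by omega)
          omega
  · rw [tog_eq_iff (by omega) (by omega)] at hf1
    rcases hg.tog_inner_cases hb with ⟨hb1, he | he⟩ | ⟨hb1, -⟩
    · have h1 := h _ _ _ _ he hf1
      refine ⟨h1.1, ?_⟩
      by_contra hc
      obtain rfl : c2 = c1 + 1 := by omega
      -- Again the box `(r2, c1)` is squeezed between labels `k` and `k + 2`.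
      have h2 := hg.col_lt c1 h1.1
      have h3 := (hg r2 c1).1
      have := h r2 c1 _ _ (by omega) hf1
      omega
    · have := h _ _ _ _ he hf1; omega
    · exact h _ _ _ _ hb1 hf1

theorem up_eq_of_gt {a m x : ℕ} {b : Box} (hx : a + m < x) : up a m g b = x ↔ g b = x := by
  constructor
  · intro h
    by_contra hb
    rcases Nat.lt_or_ge (a + m) (g b) with h1 | h1
    · rw [up_of_gt h1] at h; exact hb h
    · have := (up_le_iff (g := g) (le_refl (a + m))).2 h1; omega
  · intro h
    rw [up_of_gt (by omega), h]

theorem up_add_eq_iff {a i m x : ℕ} {b : Box} (hx : x < a + i) :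
    up a (i + m) g b = x ↔ up a i g b = x := by
  constructor
  · intro h
    have h1 := (up_add_lt_iff (g := g) (a := a) (i := i) (m := m) (b := b)).1 (by omega)
    rwa [up_add_of_lt h1] at h
  · intro h
    rw [up_add_of_lt (by omega), h]

/-- Value of a box of a strip that is about to be passed. -/
theorem up_eq_iff_of_lt {a i m x : ℕ} {b : Box} (hx : x < a + i) (him : i ≤ m) :
    up a m g b = x ↔ up a i g b = x := by
  obtain ⟨m, rfl⟩ := Nat.exists_eq_add_of_le him
  exact up_add_eq_iff hx

theorem Below.apply_up (hg : Incr g) {a m i : ℕ} (hi : i + 2 ≤ m) (h : Below g (a + i + 1) (a + i + 2)) :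
    Below (up a m g) (a + i) (a + i + 1) := by
  have h1 : Below (up a i g) (a + i + 1) (a + i + 2) := by
    intro r c r' c' hb hb'
    rw [up_eq_of_gt (by omega)] at hb hb'
    exact h _ _ _ _ hb hb'
  have h2 := h1.apply_tog_tog (hg.apply_up a i)
  intro r c r' c' hb hb'
  rw [up_eq_iff_of_lt (i := i + 2) (by omega) hi] at hb hb'
  exact h2 _ _ _ _ hb hb'

/-- Through an empty middle strip both hypotheses would be vacuous. -/
theorem Below.trans {x y z : ℕ} (h1 : Below g x y) (h2 : Below g y z) (hy : ∃ b, g b = y) :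
    Below g x z := by
  obtain ⟨⟨p, q⟩, hb⟩ := hy
  intro i j i' j' hx hz
  have := h1 _ _ _ _ hx hb
  have := h2 _ _ _ _ hb hz
  omega

end Pass

/-! ### The lattice condition and the final positions it forces. -/

/-- The strips `x`, for `x < M`, are named by pairs `(t x, r x)` in lexicographic order, which form
the shape of a bottom justified diagram with `ℓ` rows whose rows begin with `t = 0`. -/
structure LatticeOrder (M ℓ : ℕ) (t r : ℕ → ℕ) : Prop where
  lex : ∀ x y, x < y → y < M → t x < t y ∨ t x = t y ∧ r x < r y
  row_lt : ∀ x < M, r x < ℓ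
  left : ∀ y < M, ∀ s, t y = s + 1 → ∃ x < M, t x = s ∧ r x = r y
  down : ∀ x < M, ∀ i, r x ≤ i → i < ℓ → ∃ y < M, t y = t x ∧ r y = i

/-- The lattice condition on the strips from `a` on. -/
structure Lattice (M : ℕ) (t r : ℕ → ℕ) (a : ℕ) (g : Box → ℕ) : Prop where
  below : ∀ x y, x < y → y < M → t x = t y → Below g (a + x) (a + y)
  right : ∀ x y, x < M → y < M → t y = t x + 1 → r x = r y → RightOf g (a + x) (a + y)

namespace LatticeOrder

variable {M ℓ : ℕ} {t r : ℕ → ℕ}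

theorem lt_of_t_lt (h : LatticeOrder M ℓ t r) {x y : ℕ} (hx : x < M) (ht : t x < t y) : x < y := by
  rcases Nat.lt_trichotomy x y with h1 | rfl | h1
  · exact h1
  · omega
  · have := h.lex _ _ h1 hx; omega

theorem lt_of_r_lt (h : LatticeOrder M ℓ t r) {x y : ℕ} (hx : x < M) (ht : t x = t y)
    (hr : r x < r y) : x < y := by
  rcases Nat.lt_trichotomy x y with h1 | rfl | h1
  · exact h1
  · omega
  · have := h.lex _ _ h1 hx; omega

end LatticeOrder

section LatticePass

variable {M ℓ : ℕ} {t r : ℕ → ℕ} {g : Box → ℕ} {a : ℕ}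

/-- Strips of one round have consecutive labels, so the two-strip statement and transitivity
suffice. The moving strip had label `a`, so each passed strip drops by one label. -/
theorem Lattice.below_up (ho : LatticeOrder M ℓ t r) (hg : Incr g)
    (hatt : Attained (a + M + 1) g) (h : Lattice M t r (a + 1) g) (x y : ℕ) (hxy : x < y)
    (hy : y < M) (ht : t x = t y) : Below (up a M g) (a + x) (a + y) := by
  obtain ⟨n, rfl⟩ := Nat.exists_eq_add_of_lt hxy
  clear hxy
  induction n with
  | zero =>
    refine Below.apply_up hg (i := x) (by omega) ?_
    have := h.below x (x + 1) (by omega) (by omega) (by simpa using ht)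
    rwa [show a + 1 + x = a + x + 1 by omega, show a + 1 + (x + 1) = a + x + 2 by omega] at this
  | succ n ih =>
    have h1 := ho.lex x (x + n + 1) (by omega) (by omega)
    have h2 := ho.lex (x + n + 1) (x + (n + 1) + 1) (by omega) hy
    have h3 := ih (by omega) (by omega)
    have h4 : Below (up a M g) (a + (x + n + 1)) (a + (x + n + 1) + 1) := by
      refine Below.apply_up hg (i := x + n + 1) (by omega) ?_
      have := h.below (x + n + 1) (x + (n + 1) + 1) (by omega) (by omega) (by omega)
      rwa [show a + 1 + (x + n + 1) = a + (x + n + 1) + 1 by omega,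
        show a + 1 + (x + (n + 1) + 1) = a + (x + n + 1) + 2 by omega] at this
    exact h3.trans h4 (hatt.apply_up (by omega) _ (by omega))

/-- No box of the moving strip lies above a box of the strip `x` in the row above its partner. -/
theorem Lattice.no_ladder (ho : LatticeOrder M ℓ t r) (hg : Incr g)
    (hatt : Attained (a + M + 1) g) (h : Lattice M t r (a + 1) g) (x : ℕ) :
    ∀ y p c z, x < M → y < M → t y = t x + 1 → r x = r y → up a x g (p, c) = a + x →
      g (p + 1, c) = a + 1 + x → g (p + 1, z) ≠ a + 1 + y := by
  induction x using Nat.strong_induction_on with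
  | _ x ih =>
  intro y p c z hx hy ht hr hD hE hG
  have hxy : x < y := ho.lt_of_t_lt hx (by omega)
  have hcz : c < z := (h.right x y hx hy ht hr _ _ _ _ hE hG).2
  have hgx := hg.apply_up a x
  have h1 := hgx.row_lt p hcz
  have h2 := hgx.col_lt z (Nat.lt_succ_self p)
  rw [up_of_gt (b := (p + 1, z)) (by omega), hG] at h2
  have h3 : g (p, z) = up a x g (p, z) := (up_eq_of_gt (by omega)).1 rfl
  -- The box above that of `y` belongs to a strip `w` between `x` and `y`. It turns out to be the
  -- strip directly before `y` in the round of `y`.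
  obtain ⟨w, hw⟩ : ∃ w, g (p, z) = a + 1 + w := ⟨g (p, z) - (a + 1), by omega⟩
  have hxw : x ≤ w := by omega
  have hwy : w < y := by omega
  have hw1 : x < w := by
    rcases Nat.eq_or_lt_of_le hxw with rfl | h'
    · have := h.right x y hx hy ht hr _ _ _ _ hw hG; omega
    · exact h'
  have htw : t w = t y := by
    rcases ho.lex x w hw1 (by omega) with h4 | ⟨h4, -⟩
    · rcases ho.lex w y hwy hy with h5 | ⟨h5, -⟩ <;> omega
    · have := h.below x w hw1 (by omega) h4 _ _ _ _ hE hw; omega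
  have hrw : r w < r y := by rcases ho.lex w y hwy hy with h5 | h5 <;> omega
  -- A strip of the round strictly between `w` and `y` would need a row strictly between `p` and `p
  -- + 1`.
  have hrw' : r w + 1 = r y := by
    by_contra hne
    obtain ⟨w', hw', ht', hr'⟩ := ho.down w (by omega) (r y - 1) (by omega)
      (by have := ho.row_lt y hy; omega)
    have l1 : w < w' := ho.lt_of_r_lt (by omega) ht'.symm (by omega)
    have l2 : w' < y := ho.lt_of_r_lt hw' (by omega) (by omega)
    obtain ⟨⟨r2, c2⟩, hb⟩ := hatt (a + 1 + w') (by omega)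
    have := h.below w w' l1 hw' (by omega) _ _ _ _ hw hb
    have := h.below w' y l2 hy (by omega) _ _ _ _ hb hG
    omega
  obtain ⟨x', hx', htx, hrx⟩ := ho.left w (by omega) (t x) (by omega)
  have l1 : x' < x := ho.lt_of_r_lt hx' htx (by omega)
  have l2 : x = x' + 1 := by
    by_contra hne
    have h4 := ho.lex x' (x' + 1) (by omega) (by omega)
    have h5 := ho.lex (x' + 1) x (by omega) (by omega)
    omega
  subst l2
  -- The partner `x'` of `w` in the round of `x` directly precedes `x`. Its boxes are squeezed into
  -- row `p`, and monotonicity places this one in column `c`, so the moving strip has just taken it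
  -- over.
  obtain ⟨⟨r1, c1⟩, hb⟩ := hatt (a + 1 + x') (by omega)
  have h4 := h.right x' w hx' (by omega) (by omega) hrx _ _ _ _ hb hw
  have h5 := h.below x' (x' + 1) l1 hx htx _ _ _ _ hb hE
  obtain rfl : r1 = p := by omega
  have hb' : up a x' g (r1, c1) = a + x' + 1 := (up_eq_of_gt (by omega)).2 (by omega)
  have h6 : up a (x' + 1) g (r1, c1) = a + x' ∨ up a (x' + 1) g (r1, c1) = a + x' + 1 :=
    tog_mem_iff.2 (Or.inr hb')
  have h7 : up a (x' + 1) g (r1, c) ≤ up a (x' + 1) g (r1, c1) := hgx.le le_rfl h5.2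
  obtain rfl : c = c1 := hgx.row_inj (i := r1) (by omega)
  have hD' : tog (a + x') (up a x' g) (r1, c) = a + x' + 1 := by
    rw [up] at hD; omega
  rcases (hg.apply_up a x').tog_outer_cases hD' with ⟨-, ⟨c', rfl, hc'⟩ | ⟨p', rfl, hp'⟩⟩ | ⟨h8, -⟩
  · have h8 := (hg.apply_up a x' r1 c').2
    have h9 := (hg.apply_up a x' (r1 + 1) c').1
    rw [up_of_gt (b := (r1 + 1, c' + 1)) (by omega), hE] at h9
    have h10 : g (r1 + 1, c') = a + 1 + x' := by
      rw [← up_eq_of_gt (g := g) (a := a) (m := x') (by omega)]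
      omega
    have := h.below x' (x' + 1) l1 hx htx _ _ _ _ h10 hE
    omega
  -- A takeover from above is the same configuration one row higher, for `x'` and `w`; a takeover
  -- from the left was excluded by the order within the round.
  · exact ih x' (by omega) w p' c z hx' (by omega) (by omega) hrx hp' hb hw
  · omega

/-- New boxes lie at, directly left of, or directly above old boxes of the same strip. The row
inequality could fail only if the moving strip sits above a box of `x` in a row that also contains a
box of `y`, which `Lattice.no_ladder` rules out. -/
theorem Lattice.apply_up (ho : LatticeOrder M ℓ t r) (hg : Incr g)
    (hatt : Attained (a + M + 1) g) (h : Lattice M t r (a + 1) g) : Lattice M t r a (up a M g) := by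
  refine ⟨h.below_up ho hg hatt, ?_⟩
  intro x y hx hy ht hr i j i' j' he hf
  have hxy : x < y := ho.lt_of_t_lt hx (by omega)
  have hL := h.no_ladder ho hg hatt x y
  have hR := h.right x y hx hy ht hr
  have key : ∀ v < M, ∀ p q, up a M g (p, q) = a + v →
      (up a v g (p, q) = a + v ∧ (g (p, q + 1) = a + 1 + v ∨ g (p + 1, q) = a + 1 + v)) ∨
        g (p, q) = a + 1 + v := by
    intro v hv p q hpq
    rw [up_eq_iff_of_lt (i := v + 1) (by omega) hv] at hpq
    rcases (hg.apply_up a v).tog_inner_cases hpq with ⟨h1, h2⟩ | ⟨h1, -⟩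
    · rw [up_eq_of_gt (by omega), up_eq_of_gt (by omega)] at h2
      exact Or.inl ⟨h1, by rwa [show a + 1 + v = a + v + 1 by omega]⟩
    · rw [up_eq_of_gt (by omega)] at h1
      exact Or.inr (by omega)
  have hstay : up a y g (i, j) = a + x := (up_eq_iff_of_lt (m := M) (by omega) hy.le).1 he
  -- This gives strictness of the column inequality: when the moving strip reaches `y`, the settled
  -- box of `x` lies above all its boxes in that column.
  have hcol : ∀ i'', up a y g (i'', j) = a + y → i < i'' := by
    intro i'' h'
    exact (hg.apply_up a y).col_lt_iff.1 (by omega : up a y g (i, j) < up a y g (i'', j))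
  rcases key x hx _ _ he with ⟨hd, he1 | he1⟩ | he1
  · rcases key y hy _ _ hf with ⟨-, hf1 | hf1⟩ | hf1
    · have := hR _ _ _ _ he1 hf1; omega
    · have := hR _ _ _ _ he1 hf1; omega
    · have := hR _ _ _ _ he1 hf1; omega
  · rcases key y hy _ _ hf with ⟨hd', hf1 | hf1⟩ | hf1
    · have h1 := hR _ _ _ _ he1 hf1
      have h2 : i' ≠ i + 1 := fun h' => hL i j _ hx hy ht hr hd he1 (h' ▸ hf1)
      refine ⟨by omega, ?_⟩
      by_contra hc
      obtain rfl : j' = j := by omega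
      have := hcol _ hd'
      omega
    · have := hR _ _ _ _ he1 hf1; omega
    · have h1 := hR _ _ _ _ he1 hf1
      have h2 : i' ≠ i + 1 := fun h' => hL i j _ hx hy ht hr hd he1 (h' ▸ hf1)
      omega
  · rcases key y hy _ _ hf with ⟨hd', hf1 | hf1⟩ | hf1
    · have h1 := hR _ _ _ _ he1 hf1
      refine ⟨by omega, ?_⟩
      by_contra hc
      obtain rfl : j' = j := by omega
      have := hcol _ hd'
      omega
    · have := hR _ _ _ _ he1 hf1; omega
    · exact hR _ _ _ _ he1 hf1

theorem Lattice.apply_seqD (ho : LatticeOrder M ℓ t r) {n : ℕ} (hg : Incr g)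
    (hatt : Attained (a + n + M) g) (h : Lattice M t r (a + n) g) :
    Lattice M t r a (seqD a n M g) := by
  induction n generalizing g with
  | zero => exact h
  | succ n ih =>
    rw [seqD]
    exact ih (hg.apply_up _ _) (fun k hk => hatt.apply_up (by omega) k (by omega))
      (h.apply_up ho hg fun k hk => hatt k (by omega))

/-- In a filling of the quadrant whose first strips satisfy the lattice condition these strips are
single boxes. -/
theorem Lattice.final_position (ho : LatticeOrder M ℓ t r) (hg : Incr g) (h : Lattice M t r 0 g)
    (hatt : Attained M g) (s : ℕ → ℕ) (hs : ∀ x < M, s (t x) ≤ r x)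
    (hs' : ∀ x < M, ∀ i, s (t x) ≤ i → i ≤ r x → ∃ y < M, t y = t x ∧ r y = i) (x : ℕ) :
    x < M → ∀ i j, g (i, j) = x ↔ j = t x ∧ i + s (t x) = r x := by
  induction x using Nat.strong_induction_on with
  | _ x ih =>
  intro hx
  have hlow : ∀ i j, g (i, j) < x → ∃ y < x, y < M ∧ j = t y ∧ i + s (t y) = r y := fun i j hij =>
    ⟨_, hij, by omega, (ih _ hij (by omega) i j).1 rfl⟩
  have main : ∀ i j, g (i, j) = x → j = t x ∧ i + s (t x) = r x := by
    intro i j hij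
    -- The partner in the previous round is already placed in column `t x - 1`.
    have h1 : t x ≤ j := by
      rcases Nat.eq_zero_or_pos (t x) with h0 | h0
      · omega
      · obtain ⟨y, hy, hty, hry⟩ := ho.left x hx (t x - 1) (by omega)
        have hyx : y < x := ho.lt_of_t_lt hy (by omega)
        obtain ⟨⟨p, q⟩, hpq⟩ := hatt y hy
        have h2 := (ih y hyx hy p q).1 hpq
        have h3 := h.right y x hy hx (by omega) hry p q i j (by omega) (by omega)
        omega
    -- For the top strip of a round, a box too far right or too low would leave a smaller label at
    -- column `t x`, contrary to the known positions of smaller strips. Any other strip is bounded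
    -- by the one just above it in its round.
    rcases Nat.eq_or_lt_of_le (hs x hx) with h0 | h0
    · have hj : j = t x := by
        by_contra hne
        have h2 := hg.row_lt i (show t x < j by omega)
        obtain ⟨y, hyx, hyM, hy1, hy2⟩ := hlow i (t x) (by omega)
        have h3 := ho.lex y x hyx hx
        rw [← hy1] at hy2
        omega
      refine ⟨hj, ?_⟩
      by_contra hne
      have h2 := hg.col_lt j (show 0 < i by omega)
      obtain ⟨y, hyx, hyM, hy1, hy2⟩ := hlow 0 j (by omega)
      have h3 := ho.lex y x hyx hx
      rw [← hy1, hj] at hy2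
      omega
    · obtain ⟨y, hy, hty, hry⟩ := hs' x hx (r x - 1) (by omega) (by omega)
      have hyx : y < x := ho.lt_of_r_lt hy hty (by omega)
      obtain ⟨⟨p, q⟩, hpq⟩ := hatt y hy
      have h2 := (ih y hyx hy p q).1 hpq
      have h3 := h.below y x hyx hx hty p q i j (by omega) (by omega)
      have hj : j = t x := by omega
      refine ⟨hj, ?_⟩
      rw [hty] at h2
      by_contra hne
      have h4 := hg.col_lt j (show r x - s (t x) < i by omega)
      obtain ⟨z, hzx, hzM, hz1, hz2⟩ := hlow (r x - s (t x)) j (by omega)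
      have h3 := ho.lex z x hzx hx
      rw [← hz1, hj] at hz2
      omega
  intro i j
  refine ⟨main i j, ?_⟩
  rintro ⟨rfl, hi⟩
  obtain ⟨⟨p, q⟩, hpq⟩ := hatt x hx
  obtain ⟨rfl, h2⟩ := main p q hpq
  obtain rfl : p = i := by omega
  exact hpq

end LatticePass

/-! ### Motion of single boxes past one round. -/

/-- The `m` strips from `b` on run from the top right to the bottom left. -/
def Descending (g : Box → ℕ) (b m : ℕ) : Prop :=
  ∀ x y, x < y → y < m → Below g (b + x) (b + y)

section DescendingPass

variable {g : Box → ℕ} {a m : ℕ}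

theorem Descending.apply_up (hg : Incr g) (h : Descending g (a + 1) m)
    (hatt : Attained (a + m + 1) g) : Descending (up a m g) a m := by
  intro x y hxy hy
  obtain ⟨n, rfl⟩ := Nat.exists_eq_add_of_lt hxy
  clear hxy
  have step : ∀ v, v + 1 < m → Below (up a m g) (a + v) (a + v + 1) := by
    intro v hv
    refine Below.apply_up hg (i := v) (by omega) ?_
    have := h v (v + 1) (by omega) hv
    rwa [show a + 1 + v = a + v + 1 by omega, show a + 1 + (v + 1) = a + v + 2 by omega] at this
  induction n with
  | zero => exact step x hy
  | succ n ih =>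
    exact (ih (by omega)).trans (step (x + n + 1) hy) (hatt.apply_up (by omega) _ (by omega))

/-- A box of a passed strip that has been taken over stays in its column. -/
theorem Descending.stay (hg : Incr g) (h : Descending g (a + 1) m) {i n ρ γ x : ℕ}
    (hi : i + n ≤ m) (hx : x < i) (h1 : g (ρ, γ) = a + 1 + x) (h2 : up a i g (ρ, γ) = a + i) :
    ∃ ρ' ≥ ρ, up a (i + n) g (ρ', γ) = a + (i + n) ∧ ∃ x < i + n, g (ρ', γ) = a + 1 + x := by
  induction n with
  | zero => exact ⟨ρ, le_rfl, h2, x, hx, h1⟩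
  | succ n ih =>
    obtain ⟨ρ', hρ, h3, x', hx', h4⟩ := ih (by omega)
    rw [← Nat.add_assoc, up]
    by_cases hc : ∃ c, Adjacent (ρ', γ) c ∧ up a (i + n) g c = a + (i + n) + 1
    · obtain ⟨c, hadj, hc⟩ := hc
      have hgc : g c = a + 1 + (i + n) := by rw [up_eq_of_gt (by omega)] at hc; omega
      rcases (hg.apply_up a (i + n)).adjacent_outer hadj (by omega) with rfl | rfl
      · have := h x' (i + n) hx' (by omega) _ _ _ _ h4 hgc
        omega
      · refine ⟨ρ' + 1, by omega, ?_, i + n, by omega, hgc⟩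
        exact tog_outer_keep hc hadj.symm h3
    · push Not at hc
      exact ⟨ρ', hρ, tog_inner_move h3 hc, x', by omega, h4⟩

/-- A box of the moving strip with a passed strip on its right moves to the next column. -/
theorem Descending.exists_right (hg : Incr g) (h : Descending g (a + 1) m) {ρ γ : ℕ}
    (h1 : g (ρ, γ) = a) (h2 : a < g (ρ, γ + 1)) (h3 : g (ρ, γ + 1) ≤ a + m) :
    ∃ ρ' ≥ ρ, up a m g (ρ', γ + 1) = a + m := by
  obtain ⟨x, hx⟩ : ∃ x, g (ρ, γ + 1) = a + 1 + x := ⟨g (ρ, γ + 1) - (a + 1), by omega⟩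
  -- Before strip `x` is reached nothing interferes: an earlier strip just below would have a box in
  -- a lower row than a box of the later strip `x`.
  have hD : ∀ i ≤ x, up a i g (ρ, γ) = a + i := by
    intro i
    induction i with
    | zero => intro; exact h1
    | succ i ih =>
      intro hi
      rw [up]
      refine tog_inner_move (ih (by omega)) fun c hadj hc => ?_
      have hgc : g c = a + 1 + i := by rw [up_eq_of_gt (by omega)] at hc; omega
      rcases (hg.apply_up a i).adjacent_outer hadj (by have := ih (by omega); omega) with rfl | rfl
      · omega
      · have := h i x (by omega) (by omega) _ _ _ _ hgc hx
        omega
  have hE : up a (x + 1) g (ρ, γ + 1) = a + (x + 1) := by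
    rw [up]
    refine tog_outer_keep ?_ (adjacent_right ρ γ).symm (hD x le_rfl)
    rw [up_of_gt (by omega)]; omega
  obtain ⟨n, hn⟩ := Nat.exists_eq_add_of_le (show x + 1 ≤ m by omega)
  obtain ⟨ρ', hρ, h4, -⟩ := h.stay hg (n := n) (by omega) (Nat.lt_succ_self x) hx hE
  exact ⟨ρ', hρ, by rwa [← hn] at h4⟩

/-- A box of the moving strip without a passed strip on its right stays in its column. -/
theorem Descending.exists_same (hg : Incr g) (h : Descending g (a + 1) m) {ρ γ : ℕ}
    (h1 : g (ρ, γ) = a) (h2 : a + m < g (ρ, γ + 1)) :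
    ∃ ρ' ≥ ρ, up a m g (ρ', γ) = a + m := by
  have key : ∀ i ≤ m, up a i g (ρ, γ) = a + i ∨ ∃ ρ' ≥ ρ, up a m g (ρ', γ) = a + m := by
    intro i
    induction i with
    | zero => intro; exact Or.inl h1
    | succ i ih =>
      intro hi
      rcases ih (by omega) with h3 | h3
      swap
      · exact Or.inr h3
      by_cases hc : ∃ c, Adjacent (ρ, γ) c ∧ up a i g c = a + i + 1
      · obtain ⟨c, hadj, hc⟩ := hc
        have hgc : g c = a + 1 + i := by rw [up_eq_of_gt (by omega)] at hc; omega
        rcases (hg.apply_up a i).adjacent_outer hadj (by omega) with rfl | rfl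
        · omega
        · have hE : up a (i + 1) g (ρ + 1, γ) = a + (i + 1) := by
            rw [up]; exact tog_outer_keep hc hadj.symm h3
          obtain ⟨n, hn⟩ := Nat.exists_eq_add_of_le hi
          obtain ⟨ρ', hρ, h4, -⟩ := h.stay hg (n := n) (by omega) (Nat.lt_succ_self i) hgc hE
          exact Or.inr ⟨ρ', by omega, by rwa [← hn] at h4⟩
      · push Not at hc
        rw [up]
        exact Or.inl (tog_inner_move h3 hc)
  rcases key m le_rfl with h3 | h3
  · exact ⟨ρ, le_rfl, h3⟩
  · exact h3

theorem eq_or_exists_of_up_eq {i : ℕ} {b : Box} (h : up a i g b = a + i) :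
    g b = a ∨ ∃ x < i, g b = a + 1 + x := by
  have h1 := (up_lt_iff (g := g) (a := a) (m := i) (b := b) le_rfl).not
  have h2 := up_le_iff (g := g) (a := a) (m := i) (b := b) le_rfl
  rcases Nat.eq_or_lt_of_le (show a ≤ g b by omega) with h3 | h3
  · exact Or.inl h3.symm
  · exact Or.inr ⟨g b - (a + 1), by omega, by omega⟩

/-- Where a box of the moving strip comes from. -/
theorem Descending.exists_origin (hg : Incr g) (h : Descending g (a + 1) m) {ρ γ : ℕ}
    (h1 : up a m g (ρ, γ) = a + m) : (∃ ρ', g (ρ', γ) = a) ∨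
      ∃ ρ' γ', γ = γ' + 1 ∧ g (ρ', γ') = a ∧ g (ρ', γ) ≤ a + m := by
  have key : ∀ i ≤ m, ∀ ρ, up a i g (ρ, γ) = a + i → (∃ ρ', g (ρ', γ) = a) ∨
      ∃ ρ' γ', γ = γ' + 1 ∧ g (ρ', γ') = a ∧ g (ρ', γ) ≤ a + m := by
    intro i
    induction i with
    | zero => intro _ ρ h2; exact Or.inl ⟨ρ, h2⟩
    | succ i ih =>
      intro hi ρ h2
      rcases (hg.apply_up a i).tog_outer_cases h2 with ⟨h3, ⟨γ', rfl, h4⟩ | ⟨ρ', rfl, h4⟩⟩ | ⟨h3, -⟩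
      · have h3 : g (ρ, γ' + 1) = a + 1 + i := by rw [up_eq_of_gt (by omega)] at h3; omega
        rcases eq_or_exists_of_up_eq h4 with h5 | ⟨x, hx, h5⟩
        · exact Or.inr ⟨ρ, γ', rfl, h5, by omega⟩
        · have := h x i hx (by omega) _ _ _ _ h5 h3
          omega
      · exact ih (by omega) ρ' h4
      · exact ih (by omega) ρ h3
  exact key m le_rfl ρ h1

/-- The left neighbour of a box of the strip that has moved is inner. -/
theorem Descending.left_le (hg : Incr g) (h : Descending g (a + 1) m) {ρ γ : ℕ}
    (h1 : up a m g (ρ, γ + 1) = a + m) : g (ρ, γ) ≤ a ∧ g (ρ, γ + 1) ≤ a + m := by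
  have h0 := (hg ρ γ).1
  rcases eq_or_exists_of_up_eq h1 with h2 | ⟨x, hx, h2⟩
  · omega
  · refine ⟨?_, by omega⟩
    by_contra h3
    have := h (g (ρ, γ) - (a + 1)) x (by omega) hx ρ γ ρ (γ + 1) (by omega) h2
    omega

end DescendingPass

/-! ### Chains and their exchange during one pass. -/

/-- The box `y` may follow the box `x` in a chain, when the strips before `A` have not yet been
moved past the `m` strips that follow. -/
def Follows (g : Box → ℕ) (A m : ℕ) (x y : Box) : Prop :=
  g x < g y ∧
    (y.2 ≤ x.2 ∨ g x < A ∧ A + m ≤ g y ∧ y.2 = x.2 + 1 ∧ g (x.1, x.2 + 1) < A + m)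

/-- Chains of boxes in the strips from `lo` to `hi`, where those before `A` have not yet been
moved past the `m` strips that follow. -/
structure MixedChain (g : Box → ℕ) (lo A m hi j : ℕ) (C : Finset Box) : Prop where
  mem : ∀ x ∈ C, (lo ≤ g x ∧ g x < A ∧ j ≤ x.2) ∨ (A + m ≤ g x ∧ g x < hi ∧ j + 1 ≤ x.2)
  chain : ∀ x ∈ C, ∀ y ∈ C, x ≠ y → Follows g A m x y ∨ Follows g A m y x

/-- Sets of boxes in the strips from `lo` to `hi` and in the columns from `j` on with the property
that the column weakly decreases as the strip increases. -/
structure PureChain (g : Box → ℕ) (lo hi j : ℕ) (C : Finset Box) : Prop where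
  mem : ∀ x ∈ C, lo ≤ g x ∧ g x < hi ∧ j ≤ x.2
  chain : ∀ x ∈ C, ∀ y ∈ C, x ≠ y → (g x < g y ∧ y.2 ≤ x.2) ∨ (g y < g x ∧ x.2 ≤ y.2)

section Chains

variable {g : Box → ℕ} {lo a m hi j : ℕ} {C : Finset Box}

theorem MixedChain.map {g' : Box → ℕ} {A A' : ℕ} (hC : MixedChain g lo A m hi j C) (φ : Box → Box)
    (h1 : ∀ x ∈ C, (lo ≤ g' (φ x) ∧ g' (φ x) < A' ∧ j ≤ (φ x).2) ∨
      (A' + m ≤ g' (φ x) ∧ g' (φ x) < hi ∧ j + 1 ≤ (φ x).2))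
    (h2 : ∀ x ∈ C, ∀ y ∈ C, Follows g A m x y → Follows g' A' m (φ x) (φ y)) :
    ∃ C' : Finset Box, C'.card = C.card ∧ MixedChain g' lo A' m hi j C' := by
  refine ⟨C.image φ, Finset.card_image_of_injOn ?_, ?_, ?_⟩
  · intro x hx y hy hxy
    by_contra hne
    rcases hC.chain x hx y hy hne with h | h
    · have h' := (h2 x hx y hy h).1
      simp only [hxy] at h'
      omega
    · have h' := (h2 y hy x hx h).1
      simp only [hxy] at h'
      omega
  · intro x hx
    obtain ⟨u, hu, rfl⟩ := Finset.mem_image.1 hx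
    exact h1 u hu
  · intro x hx y hy hxy
    obtain ⟨u, hu, rfl⟩ := Finset.mem_image.1 hx
    obtain ⟨v, hv, rfl⟩ := Finset.mem_image.1 hy
    have hne : u ≠ v := fun h => hxy (by rw [h])
    exact (hC.chain u hu v hv hne).imp (h2 u hu v hv) (h2 v hv u hu)

theorem MixedChain.ne_of_ne {A : ℕ} (hC : MixedChain g lo A m hi j C) {x y : Box} (hx : x ∈ C)
    (hy : y ∈ C) (h : x ≠ y) : g x ≠ g y := by
  rcases hC.chain x hx y hy h with h | h
  · exact h.1.ne
  · exact h.1.ne'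

theorem MixedChain.follows {A : ℕ} (hC : MixedChain g lo A m hi j C) {x y : Box} (hx : x ∈ C)
    (hy : y ∈ C) (h : g x < g y) : Follows g A m x y := by
  rcases hC.chain x hx y hy (fun h' => by rw [h'] at h; omega) with h' | h'
  · exact h'
  · have := h'.1; omega

theorem up_lt_self_iff {b : Box} : up a m g b < a ↔ g b < a := up_lt_iff le_rfl

theorem up_eq_of_lt {b : Box} (h : up a m g b < a) : up a m g b = g b :=
  up_of_lt (up_lt_self_iff.1 h)

theorem up_gt_iff {b : Box} {x : ℕ} (hx : a + m ≤ x) : x < up a m g b ↔ x < g b := by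
  have := up_le_iff (g := g) (b := b) hx; omega

theorem up_eq_of_gt' {b : Box} (h : a + m < up a m g b) : up a m g b = g b :=
  up_of_gt ((up_gt_iff le_rfl).1 h)

/-- A chain box in the moving strip is normally exchanged for a box of the moved strip, in its own
column or the next. The second clause of `Follows` permits the resulting step to the right between
unmoved and moved boxes. The hypothesis `hreg` is needed only when column `j` has to be left without
a passed strip on the right. -/
theorem MixedChain.push (hg : Incr g) (hd : Descending g (a + 1) m) (hlo : lo ≤ a)
    (hhi : a + m < hi) (hreg : ∀ r, g (r, j) ≤ a → g (r, j + 1) < hi)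
    (hC : MixedChain g lo (a + 1) m hi j C) :
    ∃ C' : Finset Box, C'.card = C.card ∧ MixedChain (up a m g) lo a m hi j C' := by
  have hg' := hg.apply_up a m
  have hin : ∀ {b : Box}, g b < a → up a m g b = g b := fun h => up_of_lt h
  have hout : ∀ {b : Box}, a + m < g b → up a m g b = g b := fun h => up_of_gt h
  have hle : ∀ {b : Box}, up a m g b ≤ a + m ↔ g b ≤ a + m := up_le_iff le_rfl
  have hmem := hC.mem
  by_cases hex : ∃ d ∈ C, g d = a
  · obtain ⟨⟨r, c⟩, hdC, hda⟩ := hex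
    have hne : ∀ x ∈ C, x ≠ (r, c) → g x ≠ a := fun x hx h => hda ▸ hC.ne_of_ne hx hdC h
    have hcj : j ≤ c := by have := hmem _ hdC; simp only at this; omega
    rcases Nat.lt_or_ge (a + m) (g (r, c + 1)) with h1 | h1
    · obtain ⟨ρ, hρ, hρ'⟩ := hd.exists_same hg hda h1
      rcases Nat.eq_or_lt_of_le hcj with rfl | hcj'
      -- No chain box comes after the one in the moving strip: it would need a column greater than
      -- `j`, and the step to column `j + 1` is barred by `h1`.
      · have hall : ∀ x ∈ C, g x ≤ a ∧ j ≤ x.2 := by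
          intro x hx
          rcases hmem x hx with h2 | h2
          · omega
          · have := (hC.follows hdC hx (by omega)).2
            simp only at this
            omega
        have hF : ∀ x ∈ C, ∀ y ∈ C, Follows g (a + 1) m x y → g x < g y ∧ y.2 ≤ x.2 := by
          intro x hx y hy h
          have := (hall y hy).1
          have h2 := h.1
          rcases h.2 with h3 | h3 <;> omega
        -- Moved boxes must avoid column `j`. So the box of the moving strip steps to its right
        -- neighbour, and with it every chain box of column `j` whose right neighbour now counts as
        -- moved. The others keep a legal link because their right neighbours do not.
        refine hC.map (fun x => if x.2 = j ∧ a + m ≤ up a m g (x.1, j + 1) then (x.1, j + 1) else x)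
          ?_ ?_
        · intro x hx
          split_ifs with hrep
          · right
            refine ⟨hrep.2, ?_, le_rfl⟩
            rcases Nat.lt_or_ge (a + m) (g (x.1, j + 1)) with h2 | h2
            · rw [hout h2]
              refine hreg _ ?_
              rw [← hrep.1]
              exact (hall x hx).1
            · have := hle.2 h2; omega
          · left
            have hxd : x ≠ (r, j) := by
              rintro rfl
              refine hrep ⟨rfl, ?_⟩
              simp only
              rw [hout h1]; omega
            have := hne x hx hxd
            have := hall x hx
            rw [hin (by omega)]
            have := hmem x hx
            omega
        · rintro ⟨x1, x2⟩ hx ⟨y1, y2⟩ hy hxy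
          obtain ⟨h2, h3⟩ := hF _ hx _ hy hxy
          have hxa := hall _ hx
          have hya := hall _ hy
          simp only at h3 hxa hya
          split_ifs with hrx hry hry
          · obtain ⟨rfl, hrx⟩ := hrx
            obtain ⟨rfl, hry⟩ := hry
            exact ⟨hg'.col_lt _ (hg.col_lt_iff.1 h2), Or.inl le_rfl⟩
          · obtain ⟨hj, hrx⟩ := hrx
            simp only at hj hrx hry
            obtain rfl : y2 = x2 := by omega
            have := hg'.col_lt (j + 1) (hg.col_lt_iff.1 h2)
            exact absurd ⟨hj, by omega⟩ hry
          · obtain ⟨rfl, hry⟩ := hry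
            have hx' : up a m g (x1, x2) = g (x1, x2) := hin (by omega)
            refine ⟨by omega, ?_⟩
            rcases Nat.eq_or_lt_of_le hxa.2 with rfl | h4
            · right
              refine ⟨by omega, hry, rfl, ?_⟩
              simp only [true_and] at hrx
              simp only
              omega
            · exact Or.inl h4
          · have hy' : g (y1, y2) < a := by
              by_contra h4
              have h5 : (y1, y2) = (r, j) := by
                by_contra h5
                have := hne _ hy h5; omega
              obtain ⟨rfl, rfl⟩ := Prod.mk.inj h5
              exact hry ⟨rfl, by rw [hout h1]; omega⟩
            refine ⟨?_, Or.inl h3⟩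
            rw [hin hy', hin (by omega)]
            exact h2
      · refine hC.map (Function.update id (r, c) (ρ, c)) ?_ ?_
        · intro x hx
          by_cases hxd : x = (r, c)
          · subst hxd
            rw [Function.update_self, hρ']
            exact Or.inr ⟨le_rfl, hhi, hcj'⟩
          · rw [Function.update_of_ne hxd, id]
            have := hne x hx hxd
            rcases hmem x hx with h2 | h2
            · rw [hin (by omega)]; omega
            · rw [hout (by omega)]; omega
        · intro x hx y hy hxy
          by_cases hxd : x = (r, c)
          · subst hxd
            by_cases hyd : y = (r, c)
            · subst hyd; exact absurd hxy.1 (lt_irrefl _)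
            · rw [Function.update_of_ne hyd, Function.update_self, id]
              have h2 := hxy.1
              have h3 := hmem y hy
              rw [Follows, hρ', hout (by omega)]
              refine ⟨by omega, ?_⟩
              rcases hxy.2 with h4 | h4
              · exact Or.inl h4
              · simp only at h4; omega
          · have hxa := hne x hx hxd
            by_cases hyd : y = (r, c)
            · subst hyd
              rw [Function.update_of_ne hxd, Function.update_self, id]
              have h2 := hxy.1
              rw [Follows, hρ', hin (by omega)]
              refine ⟨by omega, ?_⟩
              rcases hxy.2 with h4 | h4
              · exact Or.inl h4
              · omega
            · have hya := hne y hy hyd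
              rw [Function.update_of_ne hxd, Function.update_of_ne hyd, id, id]
              have h2 := hxy.1
              have hgx : up a m g x = g x := by
                rcases hmem x hx with h3 | h3
                · exact hin (by omega)
                · exact hout (by omega)
              have hgy : up a m g y = g y := by
                rcases hmem y hy with h3 | h3
                · exact hin (by omega)
                · exact hout (by omega)
              rw [Follows, hgx, hgy]
              refine ⟨h2, Or.inl ?_⟩
              rcases hxy.2 with h4 | h4
              · exact h4
              · have h5 := (hC.follows hx hdC (by omega)).2
                have h6 := (hC.follows hdC hy (by omega)).2
                simp only at h5 h6
                omega
    · obtain ⟨ρ, hρ, hρ'⟩ := hd.exists_right hg hda (by have := (hg r c).1; omega) h1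
      -- An earlier chain box in column `c` lies above row `r ≤ ρ`, so its right neighbour is above
      -- the moved box in column `c + 1`. This is the condition for a link across the columns.
      have hcross : ∀ x ∈ C, g x < a → x.2 = c → up a m g (x.1, x.2 + 1) < a + m := by
        rintro ⟨s, c'⟩ hx hxa hc
        simp only at hc
        subst hc
        have h2 : s < r := hg.col_lt_iff.1 (by omega : g (s, c') < g (r, c'))
        have := hg'.col_lt (c' + 1) (show s < ρ by omega)
        simp only
        omega
      refine hC.map (Function.update id (r, c) (ρ, c + 1)) ?_ ?_
      · intro x hx
        by_cases hxd : x = (r, c)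
        · subst hxd
          rw [Function.update_self, hρ']
          exact Or.inr ⟨le_rfl, hhi, by simpa using hcj⟩
        · rw [Function.update_of_ne hxd, id]
          have := hne x hx hxd
          rcases hmem x hx with h2 | h2
          · rw [hin (by omega)]; omega
          · rw [hout (by omega)]; omega
      · intro x hx y hy hxy
        by_cases hxd : x = (r, c)
        · subst hxd
          by_cases hyd : y = (r, c)
          · subst hyd; exact absurd hxy.1 (lt_irrefl _)
          · rw [Function.update_of_ne hyd, Function.update_self, id]
            have h2 := hxy.1
            have h3 := hmem y hy
            rw [Follows, hρ', hout (by omega)]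
            refine ⟨by omega, Or.inl ?_⟩
            rcases hxy.2 with h4 | h4
            · simp only at h4 ⊢; omega
            · simp only at h4 ⊢; omega
        · have hxa := hne x hx hxd
          by_cases hyd : y = (r, c)
          · subst hyd
            rw [Function.update_of_ne hxd, Function.update_self, id]
            have h2 := hxy.1
            rw [Follows, hρ', hin (by omega)]
            refine ⟨by omega, ?_⟩
            rcases hxy.2 with h4 | h4
            · simp only at h4
              rcases Nat.eq_or_lt_of_le h4 with h5 | h5
              · right
                refine ⟨by omega, le_rfl, by simp only; omega, hcross x hx (by omega) h5.symm⟩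
              · exact Or.inl h5
            · omega
          · have hya := hne y hy hyd
            rw [Function.update_of_ne hxd, Function.update_of_ne hyd, id, id]
            have h2 := hxy.1
            have hgx : up a m g x = g x := by
              rcases hmem x hx with h3 | h3
              · exact hin (by omega)
              · exact hout (by omega)
            have hgy : up a m g y = g y := by
              rcases hmem y hy with h3 | h3
              · exact hin (by omega)
              · exact hout (by omega)
            rw [Follows, hgx, hgy]
            refine ⟨h2, ?_⟩
            rcases hxy.2 with h4 | h4
            · exact Or.inl h4
            · right
              have h5 := (hC.follows hx hdC (by omega)).2
              have h6 := (hC.follows hdC hy (by omega)).2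
              simp only at h5 h6
              exact ⟨by omega, by omega, by omega, hcross x hx (by omega) (by omega)⟩
  · push Not at hex
    have hgC : ∀ x ∈ C, up a m g x = g x := by
      intro x hx
      have := hex x hx
      rcases hmem x hx with h3 | h3
      · exact hin (by omega)
      · exact hout (by omega)
    -- A chain avoiding the moving strip is damaged only if the right neighbour of `x` in a link to
    -- the next column has just become a box of the moved strip. That neighbour then replaces `x`.
    by_cases hbad : ∃ x ∈ C, ∃ y ∈ C, g x < a ∧ a + 1 + m ≤ g y ∧ y.2 = x.2 + 1 ∧
        up a m g (x.1, x.2 + 1) = a + m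
    · obtain ⟨⟨s, c⟩, hx, y, hy, hxa, hya, hyx, hxd⟩ := hbad
      simp only at hyx hxd
      refine hC.map (Function.update id (s, c) (s, c + 1)) ?_ ?_
      · intro u hu
        by_cases hux : u = (s, c)
        · subst hux
          rw [Function.update_self, hxd]
          refine Or.inr ⟨le_rfl, hhi, ?_⟩
          have := hmem _ hu
          simp only at this ⊢; omega
        · rw [Function.update_of_ne hux, id, hgC u hu]
          have := hex u hu
          have := hmem u hu
          omega
      · intro u hu v hv huv
        have h2 := huv.1
        by_cases hux : u = (s, c)
        · subst hux
          by_cases hvx : v = (s, c)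
          · subst hvx; exact absurd huv.1 (lt_irrefl _)
          · rw [Function.update_of_ne hvx, Function.update_self, id, Follows, hxd, hgC v hv]
            have hva := hex v hv
            have h3 := hmem v hv
            have h4 := huv.2
            simp only at h4
            rcases Nat.lt_or_ge (g v) a with h5 | h5
            · have h6 := (hC.follows hv hy (by omega)).2
              obtain ⟨v1, v2⟩ := v
              simp only at h4 h6
              obtain rfl : v2 = c := by omega
              have h7 := hg'.col_lt (v2 + 1) (hg.col_lt_iff.1 h2)
              have h8 : ¬ (up a m g (v1, v2 + 1) ≤ a + m) := by omega
              rw [hle] at h8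
              omega
            · refine ⟨by omega, Or.inl ?_⟩
              simp only
              omega
        · have hua := hex u hu
          by_cases hvx : v = (s, c)
          · subst hvx
            rw [Function.update_of_ne hux, Function.update_self, id, Follows, hxd, hgC u hu]
            refine ⟨by omega, ?_⟩
            rcases huv.2 with h4 | h4
            · obtain ⟨u1, u2⟩ := u
              simp only at h4
              rcases Nat.eq_or_lt_of_le h4 with rfl | h5
              · right
                refine ⟨by omega, le_rfl, rfl, ?_⟩
                have := hg'.col_lt (c + 1) (hg.col_lt_iff.1 h2)
                simp only
                omega
              · exact Or.inl h5
            · omega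
          · rw [Function.update_of_ne hux, Function.update_of_ne hvx, id, id, Follows, hgC u hu,
              hgC v hv]
            refine ⟨h2, ?_⟩
            rcases huv.2 with h4 | ⟨h4, h5, h6, h7⟩
            · exact Or.inl h4
            · right
              refine ⟨by omega, by omega, h6, ?_⟩
              have h8 : up a m g (u.1, u.2 + 1) ≤ a + m := hle.2 (by omega)
              have h9 : up a m g (u.1, u.2 + 1) ≠ a + m := by
                intro h9
                have h10 := (hC.follows hu hy (by omega)).2
                have h11 := (hC.follows hx hv (by omega)).2
                simp only at h11
                obtain ⟨u1, u2⟩ := u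
                simp only at *
                obtain rfl : u2 = c := by omega
                exact hux (by rw [hg'.col_inj (h9.trans hxd.symm)])
              omega
    · push Not at hbad
      refine hC.map id ?_ ?_
      · intro x hx
        rw [id, hgC x hx]
        have := hex x hx
        have := hmem x hx
        omega
      · intro x hx y hy hxy
        have hxa := hex x hx
        rw [id, id, Follows, hgC x hx, hgC y hy]
        refine ⟨hxy.1, ?_⟩
        rcases hxy.2 with h4 | ⟨h4, h5, h6, h7⟩
        · exact Or.inl h4
        · right
          have h8 := hbad x hx y hy (by omega) h5 h6
          have h9 : up a m g (x.1, x.2 + 1) ≤ a + m := hle.2 (by omega)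
          omega

/-- The inverse exchange: a chain box of the moved strip goes back to an unmoved box in its own or
the preceding column. The replacement may lie in a strip inside of `a`, so this is not an inverse
box by box; only the size of the chain matters. -/
theorem MixedChain.pull (hg : Incr g) (hd : Descending g (a + 1) m) (hlo : lo ≤ a)
    (hC : MixedChain (up a m g) lo a m hi j C) :
    ∃ C' : Finset Box, C'.card = C.card ∧ MixedChain g lo (a + 1) m hi j C' := by
  have hg' := hg.apply_up a m
  have hle : ∀ {b : Box}, up a m g b ≤ a + m ↔ g b ≤ a + m := up_le_iff le_rfl
  have hmem := hC.mem
  have hgC : ∀ x ∈ C, up a m g x ≠ a + m → g x = up a m g x := by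
    intro x hx hxa
    rcases hmem x hx with h3 | h3
    · exact (up_eq_of_lt (by omega)).symm
    · exact (up_eq_of_gt' (by omega)).symm
  by_cases hex : ∃ d ∈ C, up a m g d = a + m
  · obtain ⟨⟨ρ, γ⟩, hdC, hda⟩ := hex
    have hne : ∀ x ∈ C, x ≠ (ρ, γ) → up a m g x ≠ a + m :=
      fun x hx h => hda ▸ hC.ne_of_ne hx hdC h
    obtain ⟨γ, rfl⟩ : ∃ γ', γ = γ' + 1 := ⟨γ - 1, by
      have := hmem _ hdC; simp only at this; omega⟩
    have hγ : j ≤ γ := by have := hmem _ hdC; simp only at this; omega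
    obtain ⟨hz, hz'⟩ := hd.left_le hg hda
    have main : ∀ z : Box, lo ≤ g z → g z ≤ a → j ≤ z.2 →
        (∀ u ∈ C, up a m g u < a → Follows (up a m g) a m u (ρ, γ + 1) → g u < g z ∧ z.2 ≤ u.2) →
        (z.2 = γ + 1 ∨ z.2 = γ ∧ g (z.1, z.2 + 1) ≤ a + m) →
        ∃ C' : Finset Box, C'.card = C.card ∧ MixedChain g lo (a + 1) m hi j C' := by
      intro z hlz hza hjz hin hcol
      refine hC.map (Function.update id (ρ, γ + 1) z) ?_ ?_
      · intro x hx
        by_cases hxd : x = (ρ, γ + 1)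
        · subst hxd
          rw [Function.update_self]
          exact Or.inl ⟨hlz, by omega, hjz⟩
        · rw [Function.update_of_ne hxd, id, hgC x hx (hne x hx hxd)]
          have := hne x hx hxd
          have := hmem x hx
          omega
      · intro x hx y hy hxy
        have h2 := hxy.1
        by_cases hxd : x = (ρ, γ + 1)
        · subst hxd
          by_cases hyd : y = (ρ, γ + 1)
          · subst hyd; exact absurd hxy.1 (lt_irrefl _)
          · rw [Function.update_of_ne hyd, Function.update_self, id, Follows,
              hgC y hy (hne y hy hyd)]
            refine ⟨by omega, ?_⟩
            rcases hxy.2 with h4 | h4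
            · simp only at h4
              rcases hcol with h5 | h5
              · exact Or.inl (by omega)
              · rcases Nat.lt_or_ge γ y.2 with h6 | h6
                · exact Or.inr ⟨by omega, by omega, by omega, by omega⟩
                · exact Or.inl (by omega)
            · omega
        · have hxa := hne x hx hxd
          by_cases hyd : y = (ρ, γ + 1)
          · subst hyd
            rw [Function.update_of_ne hxd, Function.update_self, id, Follows]
            have h3 := hin x hx (by have := hmem x hx; omega) hxy
            exact ⟨h3.1, Or.inl h3.2⟩
          · rw [Function.update_of_ne hxd, Function.update_of_ne hyd, id, id, Follows,
              hgC x hx (hne x hx hxd), hgC y hy (hne y hy hyd)]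
            refine ⟨h2, ?_⟩
            have hya := hne y hy hyd
            rcases hxy.2 with h4 | ⟨h4, h5, h6, h7⟩
            · exact Or.inl h4
            · have h8 := hle (b := (x.1, x.2 + 1))
              exact Or.inr ⟨by omega, by omega, h6, by omega⟩
    -- An earlier chain box in column `γ` forces the replacement into that column, and the left
    -- neighbour `(ρ, γ)` works. Otherwise earlier boxes are in columns from `γ + 1` on, and a box
    -- from which the moved box stems can be used.
    by_cases hx : ∃ x ∈ C, up a m g x < a ∧ x.2 = γ
    · obtain ⟨⟨s, γ'⟩, hxC, hxa, rfl⟩ := hx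
      simp only at *
      have hlow : ∀ i, up a m g (i, γ') < a → Follows (up a m g) a m (i, γ') (ρ, γ' + 1) →
          g (i, γ') < g (ρ, γ') := by
        intro i hi h
        refine hg.col_lt _ ?_
        have h2 := h.2
        simp only at h2
        exact hg'.col_lt_iff (j := γ' + 1).1 (by omega)
      have hxz := hlow s hxa (hC.follows hxC hdC (by omega))
      have hxm := hmem _ hxC
      have hxg := hgC _ hxC (by omega)
      refine main (ρ, γ') (by omega) hz hγ ?_ (Or.inr ⟨rfl, hz'⟩)
      rintro ⟨u1, u2⟩ hu hua hud
      simp only at *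
      rcases Nat.eq_or_lt_of_le (show γ' ≤ u2 by have := hud.2; simp only at this; omega) with
        rfl | h3
      · exact ⟨hlow _ hua hud, le_rfl⟩
      · refine ⟨?_, h3.le⟩
        have hne' : (s, γ') ≠ (u1, u2) := by
          intro h; rw [Prod.mk.injEq] at h; omega
        have hug := hgC _ hu (by omega)
        rcases hC.chain _ hxC _ hu hne' with h4 | h4
        · have := h4.2
          simp only at this
          omega
        · have := h4.1; omega
    · push Not at hx
      have hcolu : ∀ u ∈ C, up a m g u < a → Follows (up a m g) a m u (ρ, γ + 1) →
          γ + 1 ≤ u.2 := by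
        intro u hu hua hud
        have h2 := hud.2
        have h3 := hx u hu hua
        simp only at h2
        omega
      rcases hd.exists_origin hg hda with ⟨r, hr⟩ | ⟨r, γ', h1, hr, hr'⟩
      · refine main (r, γ + 1) (by omega) (by omega) (by simp only; omega) ?_ (Or.inl rfl)
        intro u hu hua hud
        have := hgC u hu (by omega)
        exact ⟨by omega, hcolu u hu hua hud⟩
      · obtain rfl : γ = γ' := by omega
        refine main (r, γ) (by omega) (by omega) hγ ?_ (Or.inr ⟨rfl, hr'⟩)
        intro u hu hua hud
        have := hgC u hu (by omega)
        exact ⟨by omega, by have := hcolu u hu hua hud; simp only; omega⟩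
  · push Not at hex
    refine hC.map id ?_ ?_
    · intro x hx
      rw [id, hgC x hx (hex x hx)]
      have := hex x hx
      have := hmem x hx
      omega
    · intro x hx y hy hxy
      have hxa := hex x hx
      have hya := hex y hy
      rw [id, id, Follows, hgC x hx hxa, hgC y hy hya]
      refine ⟨hxy.1, ?_⟩
      rcases hxy.2 with h4 | ⟨h4, h5, h6, h7⟩
      · exact Or.inl h4
      · have h8 := hle (b := (x.1, x.2 + 1))
        exact Or.inr ⟨by omega, by omega, h6, by omega⟩

end Chains

/-! ### Chains under a whole round of slides. -/

section Rounds

variable {g : Box → ℕ} {lo a n m hi j k : ℕ}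

/-- Each outward pass, the outermost strip first, lowers the frontier between unmoved and moved
strips by one. -/
theorem exists_mixedChain_seqD_iff (hg : Incr g) (hd : Descending g (a + n) m)
    (hatt : Attained (a + n + m) g) (hlo : lo ≤ a) (hhi : a + n + m ≤ hi)
    (hreg : ∀ r, g (r, j) < a + n → g (r, j + 1) < hi) :
    (∃ C : Finset Box, C.card = k ∧ MixedChain g lo (a + n) m hi j C) ↔
      ∃ C : Finset Box, C.card = k ∧ MixedChain (seqD a n m g) lo a m hi j C := by
  induction n generalizing g with
  | zero => rfl
  | succ n ih =>
    rw [seqD, ← ih (hg.apply_up _ _) (hd.apply_up hg (fun k hk => hatt k (by omega)))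
      (fun k hk => hatt.apply_up (by omega) k (by omega)) (by omega)]
    · constructor
      · rintro ⟨C, rfl, hC⟩
        exact hC.push (a := a + n) hg hd (by omega) (by omega) fun r hr => hreg r (by omega)
      · rintro ⟨C, rfl, hC⟩
        exact hC.pull (a := a + n) hg hd (by omega)
    · intro r hr
      rw [up_lt_self_iff] at hr
      have h1 := hreg r (by omega)
      have h2 := up_le_iff (g := g) (a := a + n) (m := m) (b := (r, j + 1)) (x := hi - 1) (by omega)
      omega

theorem seqD_add (a p q m : ℕ) (g : Box → ℕ) :
    seqD a (p + q) m g = seqD a p m (seqD (a + p) q m g) := by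
  induction q generalizing g with
  | zero => rfl
  | succ q ih => rw [← Nat.add_assoc, seqD, ih, seqD, Nat.add_assoc]

theorem seqD_le_iff {x : ℕ} {b : Box} (hx : a + n + m ≤ x + 1) :
    seqD a n m g b ≤ x ↔ g b ≤ x := by
  induction n generalizing g with
  | zero => rfl
  | succ n ih => rw [seqD, ih (by omega), up_le_iff (by omega)]

theorem seqD_of_ge {b : Box} (h : a + n + m ≤ g b) : seqD a n m g b = g b := by
  induction n generalizing g with
  | zero => rfl
  | succ n ih => rw [seqD, ih (by rw [up_of_gt (by omega)]; omega), up_of_gt (by omega)]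

theorem seqD_ge_iff {b : Box} : a + n + m ≤ seqD a n m g b ↔ a + n + m ≤ g b := by
  rcases Nat.eq_zero_or_pos (a + n + m) with h | h
  · omega
  · have := seqD_le_iff (g := g) (a := a) (n := n) (m := m) (b := b) (x := a + n + m - 1) (by omega)
    omega

/-- With the frontier at either end only one kind of box is left, and links across the columns
cannot occur. -/
theorem mixedChain_iff_pureChain_inner {C : Finset Box} (h : hi ≤ a + m) :
    MixedChain g lo a m hi j C ↔ PureChain g lo a j C := by
  constructor
  · intro hC
    have hmem : ∀ x ∈ C, lo ≤ g x ∧ g x < a ∧ j ≤ x.2 := fun x hx => by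
      have := hC.mem x hx; omega
    refine ⟨hmem, fun x hx y hy hxy => ?_⟩
    have h1 := hmem x hx
    have h2 := hmem y hy
    rcases hC.chain x hx y hy hxy with ⟨h3, h4⟩ | ⟨h3, h4⟩ <;> omega
  · intro hC
    refine ⟨fun x hx => Or.inl (hC.mem x hx), fun x hx y hy hxy => ?_⟩
    rcases hC.chain x hx y hy hxy with ⟨h3, h4⟩ | ⟨h3, h4⟩
    · exact Or.inl ⟨h3, Or.inl h4⟩
    · exact Or.inr ⟨h3, Or.inl h4⟩

theorem mixedChain_iff_pureChain_outer {C : Finset Box} :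
    MixedChain g a a m hi j C ↔ PureChain g (a + m) hi (j + 1) C := by
  constructor
  · intro hC
    have hmem : ∀ x ∈ C, a + m ≤ g x ∧ g x < hi ∧ j + 1 ≤ x.2 := fun x hx => by
      have := hC.mem x hx; omega
    refine ⟨hmem, fun x hx y hy hxy => ?_⟩
    have h1 := hmem x hx
    have h2 := hmem y hy
    rcases hC.chain x hx y hy hxy with ⟨h3, h4⟩ | ⟨h3, h4⟩ <;> omega
  · intro hC
    refine ⟨fun x hx => Or.inr (hC.mem x hx), fun x hx y hy hxy => ?_⟩
    rcases hC.chain x hx y hy hxy with ⟨h3, h4⟩ | ⟨h3, h4⟩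
    · exact Or.inl ⟨h3, Or.inl h4⟩
    · exact Or.inr ⟨h3, Or.inl h4⟩

theorem pureChain_congr {g' : Box → ℕ} {C : Finset Box} (h : ∀ x, lo ≤ g x → g' x = g x)
    (h' : ∀ x, lo ≤ g' x → lo ≤ g x) : PureChain g' lo hi j C ↔ PureChain g lo hi j C := by
  constructor
  · intro hC
    have hmem : ∀ x ∈ C, g' x = g x := fun x hx => h x (h' x (hC.mem x hx).1)
    exact ⟨fun x hx => hmem x hx ▸ hC.mem x hx,
      fun x hx y hy hxy => by rw [← hmem x hx, ← hmem y hy]; exact hC.chain x hx y hy hxy⟩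
  · intro hC
    have hmem : ∀ x ∈ C, g' x = g x := fun x hx => h x (hC.mem x hx).1
    exact ⟨fun x hx => (hmem x hx).symm ▸ hC.mem x hx,
      fun x hx y hy hxy => by rw [hmem x hx, hmem y hy]; exact hC.chain x hx y hy hxy⟩

/-- If `m` descending strips move inwards past `n` strips, then the lengths of the longest chains
in the columns from `j` on equal those in the columns from `j + 1` on afterwards. -/
theorem exists_pureChain_seqE_iff (hg : Incr g) (hd : Descending g (a + n) m)
    (hatt : Attained (a + n + m) g) (hlo : a ≤ lo) (hlo' : lo ≤ a + n)
    (hreg : ∀ r, g (r, j) < a + n → g (r, j + 1) < a + n + m) :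
    (∃ C : Finset Box, C.card = k ∧ PureChain g lo (a + n) j C) ↔
      ∃ C : Finset Box, C.card = k ∧
        PureChain (seqE a n m g) (lo + m) (a + n + m) (j + 1) C := by
  obtain ⟨p, rfl⟩ := Nat.exists_eq_add_of_le hlo
  obtain ⟨q, hq⟩ := Nat.exists_eq_add_of_le hlo'
  obtain rfl : n = p + q := by omega
  simp_rw [← mixedChain_iff_pureChain_inner (lo := a + p) (g := g) (j := j)
    (le_refl (a + (p + q) + m))]
  rw [← Nat.add_assoc] at *
  rw [exists_mixedChain_seqD_iff hg hd hatt (le_refl (a + p)) le_rfl hreg]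
  simp_rw [mixedChain_iff_pureChain_outer]
  -- Only the outer `q` strips concern the chains; the later passes of the inner `p` strips leave
  -- labels from `a + p + m` on untouched.
  rw [seqE_eq_seqD, seqD_add]
  refine exists_congr fun C => and_congr_right fun _ => ?_
  refine (pureChain_congr (fun x hx => seqD_of_ge hx) fun x hx => ?_).symm
  exact seqD_ge_iff.1 hx

end Rounds

/-! ### The action of words on sets and increasing subwords. -/

/-- The number of elements that are at most `v`. -/
theorem card_starLetter_filter (S : Finset ℕ) (m v : ℕ) :
    ((starLetter S m).filter (· ≤ v)).card = if v < m then (S.filter (· ≤ v)).card else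
      max (S.filter (· ≤ v)).card ((S.filter (· < m)).card + 1) := by
  have hsub : ∀ v, m ≤ v → (S.filter (· ≤ v)).card =
      (S.filter (· < m)).card + (S.filter fun x => m ≤ x ∧ x ≤ v).card := by
    intro v hv
    rw [← Finset.card_union_of_disjoint]
    · congr 1
      ext x
      simp only [Finset.mem_filter, Finset.mem_union]
      by_cases h : x < m
      · have : x ≤ v := by omega
        simp [h, this]
      · simp [h, not_lt.1 h]
    · rw [Finset.disjoint_left]
      intro x hx hx'
      simp only [Finset.mem_filter] at hx hx'
      omega
  unfold starLetter
  split_ifs with h hv hv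
  · congr 1
    ext x
    have := Finset.min'_mem _ h
    simp only [Finset.mem_filter, Finset.mem_insert, Finset.mem_erase] at this ⊢
    constructor
    · rintro ⟨rfl | ⟨-, h2⟩, h3⟩
      · omega
      · exact ⟨h2, h3⟩
    · rintro ⟨h2, h3⟩
      exact ⟨Or.inr ⟨by omega, h2⟩, h3⟩
  · set y := (S.filter fun x => m ≤ x).min' h with hy
    have hy1 := Finset.min'_mem _ h
    rw [← hy, Finset.mem_filter] at hy1
    have hy2 : ∀ z ∈ S, m ≤ z → y ≤ z := fun z hz hmz =>
      Finset.min'_le _ _ (Finset.mem_filter.2 ⟨hz, hmz⟩)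
    have hm : m ∉ S.erase y := by
      intro hm
      rw [Finset.mem_erase] at hm
      have := hy2 m hm.2 le_rfl
      omega
    rw [Finset.filter_insert, if_pos (by omega), Finset.card_insert_of_notMem (by
      rw [Finset.mem_filter]; exact fun h' => hm h'.1)]
    rw [Finset.filter_erase]
    rcases Nat.lt_or_ge v y with hvy | hvy
    · rw [Finset.erase_eq_of_notMem (by simp; omega)]
      have : S.filter (fun x => m ≤ x ∧ x ≤ v) = ∅ := by
        ext z
        simp only [Finset.mem_filter, Finset.notMem_empty, iff_false]
        rintro ⟨hz, h1, h2⟩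
        have := hy2 z hz h1
        omega
      rw [hsub v (by omega), this]
      simp
    · have hmem : y ∈ S.filter (· ≤ v) := by simp [hy1.1, hvy]
      rw [Finset.card_erase_of_mem hmem]
      have h1 : 0 < (S.filter fun x => m ≤ x ∧ x ≤ v).card :=
        Finset.card_pos.2 ⟨y, by simp [hy1.1, hy1.2, hvy]⟩
      have h2 := hsub v (by omega)
      omega
  · rw [Finset.filter_insert, if_neg (by omega)]
  · rw [Finset.not_nonempty_iff_eq_empty, Finset.filter_eq_empty_iff] at h
    rw [Finset.filter_insert, if_pos (by omega), Finset.card_insert_of_notMem (by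
      rw [Finset.mem_filter]; exact fun h' => h h'.1 le_rfl)]
    have : S.filter (fun x => m ≤ x ∧ x ≤ v) = ∅ := by
      rw [Finset.filter_eq_empty_iff]
      exact fun z hz hz' => h hz hz'.1
    rw [hsub v (by omega), this]
    simp

theorem star_append_singleton (S : Finset ℕ) (w : List ℕ) (m : ℕ) :
    star S (w ++ [m]) = starLetter (star S w) m := by
  simp [star]

/-- Strictly increasing subwords measure the set obtained from the empty set. -/
theorem le_card_star_iff (w : List ℕ) (v k : ℕ) :
    k ≤ ((star ∅ w).filter (· ≤ v)).card ↔
      ∃ l, List.Sublist l w ∧ l.Pairwise (· < ·) ∧ (∀ x ∈ l, x ≤ v) ∧ l.length = k := by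
  induction w using List.reverseRecOn generalizing v k with
  | nil =>
    simp only [star, List.foldl_nil, Finset.filter_empty, Finset.card_empty, List.sublist_nil]
    constructor
    · intro h
      exact ⟨[], rfl, List.Pairwise.nil, by simp, by simp; omega⟩
    · rintro ⟨l, rfl, -, -, h⟩
      simp at h
      omega
  | append_singleton w m ih =>
    -- The maximum mirrors the choice whether a longest subword ends in the new letter `m`; if it
    -- does, the rest has letters less than `m`.
    rw [star_append_singleton, card_starLetter_filter]
    have hlt : ∀ k, k ≤ ((star ∅ w).filter (· < m)).card ↔
        ∃ l, List.Sublist l w ∧ l.Pairwise (· < ·) ∧ (∀ x ∈ l, x < m) ∧ l.length = k := by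
      intro k
      rcases Nat.eq_zero_or_pos m with rfl | hm
      · simp only [not_lt_zero, Finset.filter_false, Finset.card_empty]
        constructor
        · intro h
          exact ⟨[], List.nil_sublist _, List.Pairwise.nil, by simp, by simp; omega⟩
        · rintro ⟨l, -, -, h, h'⟩
          rcases l with _ | ⟨x, l⟩
          · simp at h'; omega
          · exact absurd (h x (by simp)) (by simp)
      · obtain ⟨m, rfl⟩ := Nat.exists_eq_add_of_le' hm
        simp only [Nat.lt_succ_iff]
        exact ih m k
    constructor
    · intro h
      have old : k ≤ ((star ∅ w).filter (· ≤ v)).card → ∃ l, List.Sublist l (w ++ [m]) ∧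
          l.Pairwise (· < ·) ∧ (∀ x ∈ l, x ≤ v) ∧ l.length = k := by
        intro h
        obtain ⟨l, h1, h2⟩ := (ih v k).1 h
        exact ⟨l, h1.trans (List.sublist_append_left _ _), h2⟩
      split_ifs at h with hv
      · exact old h
      · rcases le_max_iff.1 h with h | h
        · exact old h
        · rcases k with _ | k
          · exact ⟨[], List.nil_sublist _, List.Pairwise.nil, by simp, rfl⟩
          · obtain ⟨l, h1, h2, h3, h4⟩ := (hlt k).1 (by omega)
            refine ⟨l ++ [m], h1.append (List.Sublist.refl _), ?_, ?_, by simp [h4]⟩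
            · rw [List.pairwise_append]
              exact ⟨h2, List.pairwise_singleton _ _, by simpa using h3⟩
            · intro x hx
              rcases List.mem_append.1 hx with h5 | h5
              · have := h3 x h5; omega
              · simp at h5; omega
    · rintro ⟨l, h1, h2, h3, rfl⟩
      obtain ⟨l1, l2, rfl, h4, h5⟩ := List.sublist_append_iff.1 h1
      rcases l2 with _ | ⟨x, l2⟩
      · rw [List.append_nil] at *
        have := (ih v _).2 ⟨l1, h4, h2, h3, rfl⟩
        split_ifs
        · exact this
        · exact le_max_of_le_left this
      · obtain rfl : l2 = [] := by
          have := h5.length_le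
          simp at this
          exact this
        obtain rfl : x = m := by simpa using h5
        have hx : x ≤ v := h3 x (by simp)
        rw [if_neg (by omega)]
        refine le_max_of_le_right ?_
        rw [List.pairwise_append] at h2
        have := (hlt _).2 ⟨l1, h4, h2.1, fun y hy => h2.2.2 y hy x (by simp), rfl⟩
        simp
        omega

theorem eq_of_card_filter_le_eq {S S' : Finset ℕ}
    (h : ∀ v, (S.filter (· ≤ v)).card = (S'.filter (· ≤ v)).card) : S = S' := by
  have key : ∀ (S : Finset ℕ) (v : ℕ), v + 1 ∈ S ↔
      (S.filter (· ≤ v)).card < (S.filter (· ≤ v + 1)).card := by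
    intro S v
    have hsub : S.filter (· ≤ v) ⊆ S.filter (· ≤ v + 1) := by
      intro x hx
      simp only [Finset.mem_filter] at hx ⊢
      exact ⟨hx.1, by omega⟩
    constructor
    · intro hv
      refine Finset.card_lt_card (Finset.ssubset_iff_subset_ne.2 ⟨hsub, fun he => ?_⟩)
      have : v + 1 ∈ S.filter (· ≤ v) := by rw [he]; simp [hv]
      simp at this
    · intro hlt
      by_contra hv
      refine hlt.ne (congrArg _ ?_)
      ext x
      simp only [Finset.mem_filter]
      refine and_congr_right fun hx => ?_
      have : x ≠ v + 1 := fun h => hv (h ▸ hx)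
      omega
  have key0 : ∀ S : Finset ℕ, 0 ∈ S ↔ 0 < (S.filter (· ≤ 0)).card := by
    intro S
    rw [Finset.card_pos]
    constructor
    · intro h; exact ⟨0, by simp [h]⟩
    · rintro ⟨x, hx⟩
      simp only [Finset.mem_filter, Nat.le_zero] at hx
      exact hx.2 ▸ hx.1
  ext x
  rcases x with _ | x
  · rw [key0, key0, h]
  · rw [key, key, h, h]

/-! ### Translation of slides of fillings into toggles. -/

/-- The filling `T` consists of the strips from `a` on, with the labels `L`. -/
structure Rep (a : ℕ) (L : List ℕ) (T : Filling) (g : Box → ℕ) : Prop where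
  mem : ∀ b, b ∈ T.boxes ↔ a ≤ g b ∧ g b < a + L.length
  entry : ∀ b ∈ T.boxes, T.entry b = L.getD (g b - a) 0

theorem getD_inj {L : List ℕ} (hL : L.Nodup) {i j : ℕ} (hi : i < L.length) (hj : j < L.length)
    (h : L.getD i 0 = L.getD j 0) : i = j := by
  rw [List.getD_eq_getElem _ _ hi, List.getD_eq_getElem _ _ hj] at h
  exact (hL.getElem_inj_iff).1 h

/-- Splitting off the last switch matches the right fold in `slideStrip`. -/
theorem dn_succ' (a n : ℕ) (g : Box → ℕ) : dn a (n + 1) g = tog a (dn (a + 1) n g) := by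
  induction n generalizing g with
  | zero => rfl
  | succ n ih =>
    rw [dn, ih, dn, show a + (n + 1) = a + 1 + n by omega]

theorem dn_le_iff {a n x : ℕ} {g : Box → ℕ} {b : Box} (hx : a + n ≤ x) :
    dn a n g b ≤ x ↔ g b ≤ x := by
  induction n generalizing g with
  | zero => rfl
  | succ n ih => rw [dn, ih (by omega), tog_le_iff (by omega)]

theorem dn_eq_iff_of_gt {a n x : ℕ} {g : Box → ℕ} {b : Box} (hx : a + n < x) :
    dn a n g b = x ↔ g b = x := by
  have h1 := dn_le_iff (g := g) (b := b) (a := a) (n := n) (x := x) (by omega)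
  have h2 := dn_le_iff (g := g) (b := b) (a := a) (n := n) (x := x - 1) (by omega)
  omega

theorem dn_eq_iff_of_lt {a n x : ℕ} {g : Box → ℕ} {b : Box} (hx : x < a) :
    dn a n g b = x ↔ g b = x := by
  induction n generalizing g with
  | zero => rfl
  | succ n ih => rw [dn, ih, tog_eq_iff (by omega) (by omega)]

section Switch

variable {g : Box → ℕ} {k : ℕ} {D E : Finset Box}

/-- Boxes of one strip are never adjacent in an increasing filling, so isolation in the union only
concerns the other strip. -/
theorem isolated_outer_iff (hg : Incr g) (hD : ∀ b, b ∈ D ↔ g b = k)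
    (hE : ∀ b, b ∈ E ↔ g b = k + 1) {b : Box} (hb : g b = k + 1) :
    Isolated (D ∪ E) b ↔ ∀ c, Adjacent b c → g c ≠ k := by
  constructor
  · intro h c hbc hc
    exact h c (Finset.mem_union_left _ ((hD c).2 hc)) hbc
  · intro h c hc hbc
    rcases Finset.mem_union.1 hc with hc | hc
    · exact h c hbc ((hD c).1 hc)
    · exact hg.ne_of_adjacent hbc (hb.trans ((hE c).1 hc).symm)

theorem isolated_inner_iff (hg : Incr g) (hD : ∀ b, b ∈ D ↔ g b = k)
    (hE : ∀ b, b ∈ E ↔ g b = k + 1) {b : Box} (hb : g b = k) :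
    Isolated (D ∪ E) b ↔ ∀ c, Adjacent b c → g c ≠ k + 1 := by
  constructor
  · intro h c hbc hc
    exact h c (Finset.mem_union_right _ ((hE c).2 hc)) hbc
  · intro h c hc hbc
    rcases Finset.mem_union.1 hc with hc | hc
    · exact hg.ne_of_adjacent hbc (hb.trans ((hD c).1 hc).symm)
    · exact h c hbc ((hE c).1 hc)

theorem mem_switch_fst (hg : Incr g) (hD : ∀ b, b ∈ D ↔ g b = k)
    (hE : ∀ b, b ∈ E ↔ g b = k + 1) (b : Box) : b ∈ (switch D E).1 ↔ tog k g b = k := by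
  rw [tog_eq_inner_iff, switch, Finset.mem_union, Finset.mem_filter, Finset.mem_filter, hD, hE,
    or_comm]
  refine or_congr (and_congr_right fun hb => ?_) (and_congr_right fun hb => ?_)
  · rw [isolated_inner_iff hg hD hE hb]
    push Not
    rfl
  · exact isolated_outer_iff hg hD hE hb

theorem mem_switch_snd (hg : Incr g) (hD : ∀ b, b ∈ D ↔ g b = k)
    (hE : ∀ b, b ∈ E ↔ g b = k + 1) (b : Box) : b ∈ (switch D E).2 ↔ tog k g b = k + 1 := by
  rw [tog_eq_outer_iff, switch, Finset.mem_union, Finset.mem_filter, Finset.mem_filter, hD, hE,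
    or_comm]
  refine or_congr (and_congr_right fun hb => ?_) (and_congr_right fun hb => ?_)
  · rw [isolated_outer_iff hg hD hE hb]
    push Not
    rfl
  · exact isolated_inner_iff hg hD hE hb

end Switch

/-- The filling `T` during the slide of the strip `E`, when `i` strips are still inside of `E`. -/
structure MidRep (a : ℕ) (L : List ℕ) (i : ℕ) (p : Filling × Finset Box) (g : Box → ℕ) :
    Prop where
  mem : ∀ b, b ∈ p.1.boxes ↔ a ≤ g b ∧ g b ≤ a + L.length ∧ g b ≠ a + i
  entry : ∀ b ∈ p.1.boxes, p.1.entry b = L.getD (if a + i < g b then g b - a - 1 else g b - a) 0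
  strip : ∀ b, b ∈ p.2 ↔ g b = a + i

theorem MidRep.step {a i : ℕ} {L : List ℕ} (hL : L.Nodup) (hi : i < L.length)
    {p : Filling × Finset Box} {g : Box → ℕ} (hg : Incr g) (h : MidRep a L (i + 1) p g) :
    MidRep a L i (p.1.switchLabel p.2 (L.getD i 0)) (tog (a + i) g) := by
  have hD : ∀ b, b ∈ (p.1.boxes.filter fun b => p.1.entry b = L.getD i 0) ↔ g b = a + i := by
    intro b
    rw [Finset.mem_filter]
    constructor
    · rintro ⟨hb, he⟩
      have hb' := (h.mem b).1 hb
      rw [h.entry b hb] at he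
      split_ifs at he with hs
      · have := getD_inj hL (by omega) hi he; omega
      · have := getD_inj hL (by omega) hi he; omega
    · intro hb
      have hb' : b ∈ p.1.boxes := (h.mem b).2 (by omega)
      refine ⟨hb', ?_⟩
      rw [h.entry b hb', if_neg (by omega)]
      congr 1
      omega
  have hE : ∀ b, b ∈ p.2 ↔ g b = a + i + 1 := h.strip
  have h1 := mem_switch_fst hg hD hE
  have h2 := mem_switch_snd hg hD hE
  have hmem : ∀ b, g b ≠ a + i → g b ≠ a + i + 1 → tog (a + i) g b = g b := fun b => tog_of_ne
  refine ⟨?_, ?_, h1⟩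
  · intro b
    simp only [Filling.switchLabel, Finset.mem_union, Finset.mem_sdiff, h1, h2, h.mem]
    rcases em (g b = a + i ∨ g b = a + i + 1) with hb | hb
    · rcases tog_mem_iff.2 hb with h' | h' <;> omega
    · push Not at hb
      rw [hmem b hb.1 hb.2]
      omega
  · intro b hb
    simp only [Filling.switchLabel, Finset.mem_union, Finset.mem_sdiff, h1, h2] at hb ⊢
    by_cases h3 : tog (a + i) g b = a + i + 1
    · rw [if_pos h3, if_pos (by omega)]
      congr 1
      omega
    · have h4 : b ∈ p.1.boxes ∧ ¬ tog (a + i) g b = a + i := hb.resolve_right h3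
      have h5 : g b ≠ a + i := fun h' => by
        rcases tog_mem_iff.2 (Or.inl h') with h'' | h''
        · exact h4.2 h''
        · exact h3 h''
      have h6 : g b ≠ a + i + 1 := fun h' => by
        rcases tog_mem_iff.2 (Or.inr h') with h'' | h''
        · exact h4.2 h''
        · exact h3 h''
      rw [if_neg h3, h.entry b h4.1, hmem b h5 h6]
      congr 1
      split_ifs <;> omega

theorem Rep.midRep_foldr {a : ℕ} {L : List ℕ} (hL : L.Nodup) {T : Filling} {E : Finset Box}
    {g : Box → ℕ} (hg : Incr g) (h : Rep a L T g) (hE : ∀ b, b ∈ E ↔ g b = a + L.length)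
    (L2 : List ℕ) : ∀ L1 : List ℕ, L1 ++ L2 = L →
      MidRep a L L1.length (Filling.slideStrip L2 T E) (dn (a + L1.length) L2.length g) := by
  induction L2 with
  | nil =>
    intro L1 h1
    rw [List.append_nil] at h1
    subst h1
    simp only [Filling.slideStrip, List.foldr_nil, List.length_nil, dn]
    refine ⟨?_, ?_, hE⟩
    · intro b
      rw [h.mem]
      omega
    · intro b hb
      have := (h.mem b).1 hb
      rw [h.entry b hb, if_neg (by omega)]
  | cons k L2 ih =>
    intro L1 h1
    have h2 := ih (L1 ++ [k]) (by simp [h1])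
    rw [List.length_append, List.length_singleton] at h2
    have h3 : L.getD L1.length 0 = k := by rw [← h1]; simp
    have h4 := h2.step hL (by rw [← h1]; simp) (hg.apply_dn _ _)
    rw [h3] at h4
    rw [List.length_cons, dn_succ']
    exact h4

theorem Rep.slideStrip {a : ℕ} {L : List ℕ} (hL : L.Nodup) {T : Filling} {E : Finset Box}
    {g : Box → ℕ} (hg : Incr g) (h : Rep a L T g) (hE : ∀ b, b ∈ E ↔ g b = a + L.length) :
    Rep (a + 1) L (Filling.slideStrip L T E).1 (dn a L.length g) := by
  have h1 := h.midRep_foldr hL hg hE L [] rfl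
  refine ⟨?_, ?_⟩
  · intro b
    rw [h1.mem]
    simp only [List.length_nil, Nat.add_zero]
    omega
  · intro b hb
    have h2 := (h1.mem b).1 hb
    simp only [List.length_nil, Nat.add_zero] at h2
    rw [h1.entry b hb]
    simp only [List.length_nil, Nat.add_zero]
    rw [if_pos (by omega)]
    congr 1

theorem switchLabel_of_notMem {T : Filling} {E : Finset Box} {k : ℕ}
    (hk : ∀ b ∈ T.boxes, T.entry b ≠ k) (hE : ∀ b ∈ E, ∀ c ∈ E, ¬ Adjacent b c)
    (hd : Disjoint T.boxes E) : T.switchLabel E k = (T, E) := by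
  have h1 : (T.boxes.filter fun b => T.entry b = k) = ∅ := Finset.filter_eq_empty_iff.2 hk
  have h2 : switch ∅ E = (E, ∅) := by
    simp only [switch, Finset.empty_union, Finset.filter_empty, Finset.union_empty]
    have hiso : ∀ b ∈ E, Isolated E b := fun b hb c hc => hE b hb c hc
    rw [Finset.filter_true_of_mem hiso,
      Finset.filter_eq_empty_iff.2 fun b hb h => h (hiso b hb)]
  simp only [Filling.switchLabel, h1, h2, Finset.union_empty, Finset.sdiff_eq_self_of_disjoint hd,
    Finset.notMem_empty, if_false]

/-- Labels that do not occur have empty strips, and switching with these changes nothing. This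
allows a truncated tableau to keep the label list of the full one, so that their levels agree. -/
theorem Rep.slideStrip_filter {a : ℕ} {L : List ℕ} (hL : L.Nodup) {T : Filling} {E : Finset Box}
    {g : Box → ℕ} (hg : Incr g) (h : Rep a L T g) (hE : ∀ b, b ∈ E ↔ g b = a + L.length) :
    Filling.slideStrip (L.filter (· ∈ T.boxes.image T.entry)) T E = Filling.slideStrip L T E := by
  have key : ∀ L2 L1 : List ℕ, L1 ++ L2 = L →
      Filling.slideStrip (L2.filter (· ∈ T.boxes.image T.entry)) T E =
        Filling.slideStrip L2 T E := by
    intro L2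
    induction L2 with
    | nil => intro _ _; rfl
    | cons k L2 ih =>
      intro L1 h1
      have h2 := ih (L1 ++ [k]) (by simp [h1])
      have hm := h.midRep_foldr hL hg hE L2 (L1 ++ [k]) (by simp [h1])
      rw [List.length_append, List.length_singleton] at hm
      have hlen : L1.length < L.length := by rw [← h1]; simp
      have h3 : L.getD L1.length 0 = k := by rw [← h1]; simp
      by_cases hk : k ∈ T.boxes.image T.entry
      · rw [List.filter_cons_of_pos (by simpa using hk)]
        simp only [Filling.slideStrip, List.foldr_cons] at h2 ⊢
        rw [h2]
      · rw [List.filter_cons_of_neg (by simpa using hk), h2]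
        symm
        have hg' := hg.apply_dn (a + (L1.length + 1)) L2.length
        refine switchLabel_of_notMem ?_ ?_ ?_
        · intro b (hb : b ∈ (Filling.slideStrip L2 T E).1.boxes)
            (he : (Filling.slideStrip L2 T E).1.entry b = k)
          have hb' := (hm.mem b).1 hb
          rw [hm.entry b hb, ← h3] at he
          have h4 : dn (a + (L1.length + 1)) L2.length g b = a + L1.length := by
            split_ifs at he with hs
            · have := getD_inj hL (by omega) hlen he; omega
            · have := getD_inj hL (by omega) hlen he; omega
          have h5 : g b = a + L1.length := by rwa [dn_eq_iff_of_lt (by omega)] at h4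
          have h6 : b ∈ T.boxes := (h.mem b).2 (by omega)
          refine hk (Finset.mem_image.2 ⟨b, h6, ?_⟩)
          rw [h.entry b h6, h5, Nat.add_sub_cancel_left, h3]
        · intro b hb c hc hbc
          have h4 := (hm.strip b).1 hb
          have h5 := (hm.strip c).1 hc
          exact hg'.ne_of_adjacent hbc (h4.trans h5.symm)
        · rw [Finset.disjoint_left]
          intro b hb hb'
          exact ((hm.mem b).1 hb).2.2 ((hm.strip b).1 hb')
  exact key L [] rfl

theorem Rep.image_entry_subset {a : ℕ} {L : List ℕ} {T : Filling} {g : Box → ℕ}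
    (h : Rep a L T g) : T.boxes.image T.entry ⊆ L.toFinset := by
  intro x hx
  obtain ⟨b, hb, rfl⟩ := Finset.mem_image.1 hx
  have h1 := (h.mem b).1 hb
  rw [List.mem_toFinset, h.entry b hb, List.getD_eq_getElem _ _ (by omega)]
  exact List.getElem_mem _

/-- The sorting function `srt` is left open in order to cover increasing and decreasing tableaux at
once. -/
theorem Rep.foldl_slideStrip {L : List ℕ} (hL : L.Nodup) {srt : Finset ℕ → List ℕ}
    (hsrt : ∀ s ⊆ L.toFinset, srt s = L.filter (· ∈ s)) (U : List (Finset Box)) {a : ℕ}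
    {T : Filling} {g : Box → ℕ} (hg : Incr g) (h : Rep a L T g)
    (hU : ∀ s (hs : s < U.length), ∀ b, b ∈ U[s] ↔ g b = a + L.length + s) :
    Rep (a + U.length) L
      (U.foldl (fun T E => (Filling.slideStrip (srt (T.boxes.image T.entry)) T E).1) T)
      (seqE a L.length U.length g) := by
  induction U generalizing a T g with
  | nil => exact h
  | cons E U ih =>
    have h0 : ∀ b, b ∈ E ↔ g b = a + L.length := hU 0 (Nat.succ_pos _)
    rw [List.foldl_cons, hsrt _ h.image_entry_subset, List.length_cons, Nat.add_comm _ 1,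
      seqE_add, ← Nat.add_assoc, show seqE a L.length 1 g = dn a L.length g from rfl,
      h.slideStrip_filter hL hg h0]
    -- The remaining strips keep their labels while the base `a` grows by one, so index `s + 1`
    -- becomes index `s`.
    refine ih (hg.apply_dn _ _) (h.slideStrip hL hg h0) ?_
    intro s hs b
    have h1 := hU (s + 1) (by simpa using hs) b
    rw [List.getElem_cons_succ] at h1
    rw [h1, dn_eq_iff_of_gt (by omega)]
    constructor <;> intro h2 <;> omega

theorem sort_eq_filter (r : ℕ → ℕ → Prop) [DecidableRel r] [IsTrans ℕ r] [Std.Antisymm r]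
    [Std.Total r] {L : List ℕ} (hL : L.Nodup) (hr : L.Pairwise r) (s : Finset ℕ)
    (hs : s ⊆ L.toFinset) : s.sort r = L.filter (· ∈ s) := by
  have h1 : (L.filter (· ∈ s)).toFinset = s := by
    ext x
    simp only [List.mem_toFinset, List.mem_filter, decide_eq_true_eq]
    exact ⟨fun h => h.2, fun h => ⟨List.mem_toFinset.1 (hs h), h⟩⟩
  conv_lhs => rw [← h1]
  exact (List.toFinset_sort r (hL.filter _)).2 (hr.filter _)

/-! ### Increasing subwords of the reading word as chains of boxes. -/

section Word

namespace Filling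

/-- The boxes in the order in which they are read. -/
def readingOrder (T : Filling) : List Box :=
  (List.range T.numCols).flatMap fun j =>
    ((List.range T.numRows).reverse.filter fun i => (i, j) ∈ T.boxes).map fun i => (i, j)

theorem word_eq_map (T : Filling) : T.word = T.readingOrder.map T.entry := by
  rw [word, readingOrder, List.map_flatMap]
  simp only [List.map_map]
  rfl

theorem lt_numRows {T : Filling} {b : Box} (hb : b ∈ T.boxes) : b.1 < T.numRows :=
  Finset.le_sup (f := fun b : Box => b.1 + 1) hb

theorem lt_numCols {T : Filling} {b : Box} (hb : b ∈ T.boxes) : b.2 < T.numCols :=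
  Finset.le_sup (f := fun b : Box => b.2 + 1) hb

theorem mem_readingOrder {T : Filling} {b : Box} : b ∈ T.readingOrder ↔ b ∈ T.boxes := by
  simp only [readingOrder, List.mem_flatMap, List.mem_range, List.mem_map, List.mem_filter,
    List.mem_reverse, decide_eq_true_eq]
  constructor
  · rintro ⟨j, -, i, ⟨-, h⟩, rfl⟩
    exact h
  · intro hb
    exact ⟨b.2, lt_numCols hb, b.1, ⟨lt_numRows hb, hb⟩, rfl⟩

theorem pairwise_readingOrder (T : Filling) :
    T.readingOrder.Pairwise fun b c => b.2 < c.2 ∨ b.2 = c.2 ∧ c.1 < b.1 := by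
  rw [readingOrder, List.pairwise_flatMap]
  constructor
  · intro j _
    rw [List.pairwise_map]
    refine List.Pairwise.filter _ ?_
    rw [List.pairwise_reverse]
    exact List.pairwise_lt_range.imp fun h => Or.inr ⟨rfl, h⟩
  · refine List.pairwise_lt_range.imp fun {j j'} h => ?_
    intro b hb c hc
    simp only [List.mem_map] at hb hc
    obtain ⟨i, -, rfl⟩ := hb
    obtain ⟨i', -, rfl⟩ := hc
    exact Or.inl h

/-- Columns of a decreasing tableau, read from bottom to top, increase. So inside a column the
reading order agrees with the order of the entries, and only the columns need to be compared. -/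
theorem exists_sublist_word_iff {T : Filling} (hT : T.IsDecreasing) (v k : ℕ) :
    (∃ l, List.Sublist l T.word ∧ l.Pairwise (· < ·) ∧ (∀ x ∈ l, x ≤ v) ∧ l.length = k) ↔
      ∃ C : Finset Box, C.card = k ∧ (∀ x ∈ C, x ∈ T.boxes ∧ T.entry x ≤ v) ∧
        ∀ x ∈ C, ∀ y ∈ C, x ≠ y → (T.entry x < T.entry y ∧ x.2 ≤ y.2) ∨
          (T.entry y < T.entry x ∧ y.2 ≤ x.2) := by
  rw [word_eq_map]
  have hord := T.pairwise_readingOrder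
  constructor
  · rintro ⟨l, h1, h2, h3, rfl⟩
    obtain ⟨B, hB, rfl⟩ := List.sublist_map_iff.1 h1
    have hB' := hord.sublist hB
    rw [List.pairwise_map] at h2
    have hnd : B.Nodup := h2.imp fun h h' => by rw [h'] at h; omega
    refine ⟨B.toFinset, by rw [List.toFinset_card_of_nodup hnd, List.length_map], ?_, ?_⟩
    · intro x hx
      rw [List.mem_toFinset] at hx
      exact ⟨mem_readingOrder.1 (hB.subset hx), h3 _ (List.mem_map_of_mem hx)⟩
    · intro x hx y hy hxy
      rw [List.mem_toFinset] at hx hy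
      have hp : B.Pairwise fun x y => (T.entry x < T.entry y ∧ x.2 ≤ y.2) ∨
          (T.entry y < T.entry x ∧ y.2 ≤ x.2) :=
        (h2.and hB').imp fun h => Or.inl ⟨h.1, by omega⟩
      have : Std.Symm fun x y => (T.entry x < T.entry y ∧ x.2 ≤ y.2) ∨
          (T.entry y < T.entry x ∧ y.2 ≤ x.2) := ⟨fun _ _ h => h.symm⟩
      exact hp.forall hx hy hxy
  · rintro ⟨C, rfl, h1, h2⟩
    have hnd : T.readingOrder.Nodup := hord.imp fun h h' => by rw [h'] at h; omega
    refine ⟨(T.readingOrder.filter (· ∈ C)).map T.entry, List.filter_sublist.map _, ?_, ?_, ?_⟩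
    · rw [List.pairwise_map]
      refine List.Pairwise.imp_of_mem ?_ (hord.filter _)
      intro x y hx hy hxy
      simp only [List.mem_filter, decide_eq_true_eq] at hx hy
      rcases h2 x hx.2 y hy.2 (by rintro rfl; omega) with h3 | h3
      · exact h3.1
      · obtain ⟨x1, x2⟩ := x
        obtain ⟨y1, y2⟩ := y
        simp only at hxy h3
        obtain rfl : x2 = y2 := by omega
        exact hT.2.2 _ _ _ (h1 _ hy.2).1 (h1 _ hx.2).1 (by omega)
    · intro x hx
      simp only [List.mem_map, List.mem_filter, decide_eq_true_eq] at hx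
      obtain ⟨b, hb, rfl⟩ := hx
      exact (h1 b hb.2).2
    · rw [List.length_map, ← List.toFinset_card_of_nodup (hnd.filter _)]
      congr 1
      ext b
      simp only [List.mem_toFinset, List.mem_filter, decide_eq_true_eq, mem_readingOrder]
      exact ⟨fun h => h.2, fun h => ⟨(h1 b h).1, h⟩⟩

end Filling

end Word

/-! ### Partition shapes and the initial labelling of the quadrant. -/

theorem mem_iff_lt_card {s : Finset ℕ} (h : ∀ x y, x ≤ y → y ∈ s → x ∈ s) (x : ℕ) :
    x ∈ s ↔ x < s.card := by
  constructor
  · intro hx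
    have h1 : Finset.range (x + 1) ⊆ s := fun y hy =>
      h y x (Nat.lt_succ_iff.1 (Finset.mem_range.1 hy)) hx
    have h2 := Finset.card_le_card h1
    rw [Finset.card_range] at h2
    omega
  · intro hx
    by_contra hx'
    have h1 : s ⊆ Finset.range x := fun y hy => by
      rw [Finset.mem_range]
      by_contra hxy
      exact hx' (h x y (by omega) hy)
    have h2 := Finset.card_le_card h1
    rw [Finset.card_range] at h2
    omega

theorem idxOf_lt_idxOf {α : Type*} [BEq α] [LawfulBEq α] {R : α → α → Prop} {l : List α}
    (h : l.Pairwise R) (hR : ∀ a b, R a b → ¬ R b a) {a b : α} (ha : a ∈ l) (hb : b ∈ l)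
    (hab : R a b) : l.idxOf a < l.idxOf b := by
  have ha' := List.idxOf_lt_length_iff.2 ha
  have hb' := List.idxOf_lt_length_iff.2 hb
  rcases Nat.lt_trichotomy (l.idxOf a) (l.idxOf b) with h1 | h1 | h1
  · exact h1
  · have h2 : a = b := by
      rw [← List.getElem_idxOf ha', ← List.getElem_idxOf hb']
      congr 1
    subst h2
    exact absurd hab (hR _ _ hab)
  · have h2 := List.pairwise_iff_getElem.1 h _ _ hb' ha' h1
    rw [List.getElem_idxOf, List.getElem_idxOf] at h2
    exact absurd hab (hR _ _ h2)

namespace Filling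

/-- The boxes form a Young diagram. -/
def IsStraight (T : Filling) : Prop :=
  ∀ i j i' j', i ≤ i' → j ≤ j' → (i', j') ∈ T.boxes → (i, j) ∈ T.boxes

/-- Number of boxes in column `j`. -/
def colLen (T : Filling) (j : ℕ) : ℕ := (T.boxes.filter fun b => b.2 = j).card

section Shape

variable {T : Filling}

theorem IsStraight.mem_iff_lt_rowLen (h : T.IsStraight) {i j : ℕ} :
    (i, j) ∈ T.boxes ↔ j < T.rowLen i := by
  have h1 : ∀ j, j ∈ (T.boxes.filter fun b => b.1 = i).image Prod.snd ↔ (i, j) ∈ T.boxes := by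
    intro j
    simp only [Finset.mem_image, Finset.mem_filter, Prod.exists]
    constructor
    · rintro ⟨a, b, ⟨h2, rfl⟩, rfl⟩
      exact h2
    · exact fun h2 => ⟨i, j, ⟨h2, rfl⟩, rfl⟩
  have key : ∀ s : Finset ℕ, (∀ j, j ∈ s ↔ (i, j) ∈ T.boxes) → ((i, j) ∈ T.boxes ↔ j < s.card) :=
    fun s hs => (hs j).symm.trans <|
      mem_iff_lt_card (fun x y hxy hy => (hs x).2 (h i x i y le_rfl hxy ((hs y).1 hy))) j
  have h2 := key _ h1
  rw [Finset.card_image_of_injOn] at h2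
  · exact h2
  · rintro ⟨a, b⟩ hx ⟨c, d⟩ hy hxy
    simp only [Finset.coe_filter, Set.mem_ofPred_eq] at hx hy hxy
    rw [hx.2, hy.2, hxy]

theorem IsStraight.mem_iff_lt_colLen (h : T.IsStraight) {i j : ℕ} :
    (i, j) ∈ T.boxes ↔ i < T.colLen j := by
  have h1 : ∀ i, i ∈ (T.boxes.filter fun b => b.2 = j).image Prod.fst ↔ (i, j) ∈ T.boxes := by
    intro i
    simp only [Finset.mem_image, Finset.mem_filter, Prod.exists]
    constructor
    · rintro ⟨a, b, ⟨h2, rfl⟩, rfl⟩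
      exact h2
    · exact fun h2 => ⟨i, j, ⟨h2, rfl⟩, rfl⟩
  have key : ∀ s : Finset ℕ, (∀ i, i ∈ s ↔ (i, j) ∈ T.boxes) → ((i, j) ∈ T.boxes ↔ i < s.card) :=
    fun s hs => (hs i).symm.trans <|
      mem_iff_lt_card (fun x y hxy hy => (hs x).2 (h x j y j hxy le_rfl ((hs y).1 hy))) i
  have h2 := key _ h1
  rw [Finset.card_image_of_injOn] at h2
  · exact h2
  · rintro ⟨a, b⟩ hx ⟨c, d⟩ hy hxy
    simp only [Finset.coe_filter, Set.mem_ofPred_eq] at hx hy hxy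
    rw [hx.2, hy.2, hxy]

theorem IsStraight.lt_numRows_iff (h : T.IsStraight) {i : ℕ} :
    i < T.numRows ↔ (i, 0) ∈ T.boxes := by
  constructor
  · intro hi
    obtain ⟨b, hb, hib⟩ := (Finset.lt_sup_iff (f := fun b : Box => b.1 + 1)).1 hi
    exact h i 0 b.1 b.2 (by omega) (by omega) hb
  · exact fun hi => lt_numRows hi

theorem IsStraight.lt_numCols_iff (h : T.IsStraight) {j : ℕ} :
    j < T.numCols ↔ (0, j) ∈ T.boxes := by
  constructor
  · intro hj
    obtain ⟨b, hb, hjb⟩ := (Finset.lt_sup_iff (f := fun b : Box => b.2 + 1)).1 hj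
    exact h 0 j b.1 b.2 (by omega) (by omega) hb
  · exact fun hj => lt_numCols hj

end Shape

/-- The entries, in decreasing order. -/
def labels (T : Filling) : List ℕ := (T.boxes.image T.entry).sort (· ≥ ·)

/-- The boxes outside of `T` in the order of `crOrder`, each given by its round and its row. -/
def crPairs (T : Filling) : List (ℕ × ℕ) :=
  (List.range T.numCols).flatMap fun t =>
    ((List.range T.numRows).filter fun i => T.rowLen i + t < T.numCols).map fun i => (t, i)

theorem crOrder_eq_map (T : Filling) :
    T.crOrder = T.crPairs.map fun p => {(p.2, T.rowLen p.2 + p.1)} := by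
  rw [crOrder, crPairs, List.map_flatMap]
  simp only [List.map_map]
  rfl

theorem mem_crPairs {T : Filling} {p : ℕ × ℕ} :
    p ∈ T.crPairs ↔ p.2 < T.numRows ∧ T.rowLen p.2 + p.1 < T.numCols := by
  simp only [crPairs, List.mem_flatMap, List.mem_range, List.mem_map, List.mem_filter,
    decide_eq_true_eq]
  constructor
  · rintro ⟨t, -, i, h, rfl⟩
    exact h
  · exact fun h => ⟨p.1, by omega, p.2, h, rfl⟩

theorem pairwise_crPairs (T : Filling) :
    T.crPairs.Pairwise fun p q => p.1 < q.1 ∨ p.1 = q.1 ∧ p.2 < q.2 := by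
  rw [crPairs, List.pairwise_flatMap]
  constructor
  · intro t _
    rw [List.pairwise_map]
    exact (List.pairwise_lt_range.filter _).imp fun h => Or.inr ⟨rfl, h⟩
  · refine List.pairwise_lt_range.imp fun {t t'} h => ?_
    intro p hp q hq
    simp only [List.mem_map] at hp hq
    obtain ⟨i, -, rfl⟩ := hp
    obtain ⟨i', -, rfl⟩ := hq
    exact Or.inl h

theorem mem_labels {T : Filling} {x : ℕ} : x ∈ T.labels ↔ ∃ b ∈ T.boxes, T.entry b = x := by
  rw [labels, Finset.mem_sort, Finset.mem_image]

theorem nodup_labels (T : Filling) : T.labels.Nodup := Finset.sort_nodup _ _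

theorem pairwise_labels (T : Filling) : T.labels.Pairwise (· > ·) := by
  have h : T.labels.Pairwise (· ≥ ·) := Finset.pairwise_sort _ _
  exact (h.and T.nodup_labels).imp fun h => lt_of_le_of_ne h.1 (Ne.symm h.2)

/-- The round of the box with number `x` of `crOrder`. -/
def crRound (T : Filling) (x : ℕ) : ℕ := (T.crPairs.getD x (0, 0)).1

/-- The row of the box with number `x` of `crOrder`. -/
def crRow (T : Filling) (x : ℕ) : ℕ := (T.crPairs.getD x (0, 0)).2

theorem crPair_eq {T : Filling} {x : ℕ} (hx : x < T.crPairs.length) :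
    T.crPairs[x] = (T.crRound x, T.crRow x) := by
  rw [crRound, crRow, List.getD_eq_getElem _ _ hx]

/-- The strips of `T` from the inside to the outside, then the boxes of `crOrder`, then everything
outside of the rectangle. -/
def startFilling (T : Filling) : Box → ℕ := fun b =>
  if b ∈ T.boxes then T.labels.idxOf (T.entry b)
  else if b.1 < T.numRows ∧ b.2 < T.numCols then
    T.labels.length + T.crPairs.idxOf (b.2 - T.rowLen b.1, b.1)
  else T.labels.length + T.crPairs.length + b.1 + b.2

end Filling

/-- A filling `g` of the quadrant with `K` strips in the Young diagram `lam`, and after that the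
`M` boxes of the complement of `lam` in the rectangle with `ℓ` rows and `n` columns. -/
structure StartModel (ℓ n K M : ℕ) (lam : ℕ → ℕ) (t r : ℕ → ℕ) (g : Box → ℕ) : Prop where
  incr : Incr g
  order : LatticeOrder M ℓ t r
  anti : ∀ i i', i ≤ i' → lam i' ≤ lam i
  inner : ∀ i j, g (i, j) < K ↔ j < lam i
  box : ∀ x < M, ∀ i j, g (i, j) = K + x ↔ i = r x ∧ j = lam i + t x
  rect : ∀ i j, g (i, j) < K + M ↔ i < ℓ ∧ j < n
  attained : Attained (K + M) g

namespace Filling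

variable {T : Filling}

theorem IsDecreasing.idxOf_lt_row (hT : T.IsDecreasing) {i j j' : ℕ} (h : (i, j) ∈ T.boxes)
    (h' : (i, j') ∈ T.boxes) (hj : j < j') :
    T.labels.idxOf (T.entry (i, j)) < T.labels.idxOf (T.entry (i, j')) :=
  idxOf_lt_idxOf T.pairwise_labels (fun _ _ h => by omega) (mem_labels.2 ⟨_, h, rfl⟩)
    (mem_labels.2 ⟨_, h', rfl⟩) (hT.2.1 _ _ _ h h' hj)

theorem IsDecreasing.idxOf_lt_col (hT : T.IsDecreasing) {i i' j : ℕ} (h : (i, j) ∈ T.boxes)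
    (h' : (i', j) ∈ T.boxes) (hj : i < i') :
    T.labels.idxOf (T.entry (i, j)) < T.labels.idxOf (T.entry (i', j)) :=
  idxOf_lt_idxOf T.pairwise_labels (fun _ _ h => by omega) (mem_labels.2 ⟨_, h, rfl⟩)
    (mem_labels.2 ⟨_, h', rfl⟩) (hT.2.2 _ _ _ h h' hj)

theorem startFilling_of_mem {b : Box} (h : b ∈ T.boxes) :
    T.startFilling b = T.labels.idxOf (T.entry b) := by
  rw [startFilling, if_pos h]

theorem idxOf_entry_lt {b : Box} (h : b ∈ T.boxes) :
    T.labels.idxOf (T.entry b) < T.labels.length :=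
  List.idxOf_lt_length_iff.2 (mem_labels.2 ⟨b, h, rfl⟩)

theorem startFilling_of_mem_rect {i j : ℕ} (h : (i, j) ∉ T.boxes) (hi : i < T.numRows)
    (hj : j < T.numCols) :
    T.startFilling (i, j) = T.labels.length + T.crPairs.idxOf (j - T.rowLen i, i) := by
  rw [startFilling, if_neg h, if_pos ⟨hi, hj⟩]

theorem startFilling_of_notMem_rect {i j : ℕ} (h : ¬ (i < T.numRows ∧ j < T.numCols)) :
    T.startFilling (i, j) = T.labels.length + T.crPairs.length + i + j := by
  rw [startFilling, if_neg fun h' => h ⟨lt_numRows h', lt_numCols h'⟩, if_neg h]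

theorem IsStraight.idxOf_pair_lt (hs : T.IsStraight) {i j : ℕ} (h : (i, j) ∉ T.boxes)
    (hi : i < T.numRows) (hj : j < T.numCols) :
    T.crPairs.idxOf (j - T.rowLen i, i) < T.crPairs.length := by
  rw [hs.mem_iff_lt_rowLen] at h
  exact List.idxOf_lt_length_iff.2 (mem_crPairs.2 ⟨hi, by simp only; omega⟩)

theorem IsStraight.rowLen_anti (hs : T.IsStraight) (i i' : ℕ) (h : i ≤ i') :
    T.rowLen i' ≤ T.rowLen i := by
  by_contra hc
  have h1 := hs i (T.rowLen i) i' (T.rowLen i) h le_rfl (hs.mem_iff_lt_rowLen.2 (by omega))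
  rw [hs.mem_iff_lt_rowLen] at h1
  omega

theorem incr_startFilling (hs : T.IsStraight) (hT : T.IsDecreasing) : Incr T.startFilling := by
  have hlex : ∀ p q : ℕ × ℕ, p ∈ T.crPairs → q ∈ T.crPairs →
      (p.1 < q.1 ∨ p.1 = q.1 ∧ p.2 < q.2) → T.crPairs.idxOf p < T.crPairs.idxOf q :=
    fun p q hp hq h => idxOf_lt_idxOf T.pairwise_crPairs (fun _ _ h => by omega) hp hq h
  have key : ∀ i j i' j', (i' = i ∧ j' = j + 1 ∨ i' = i + 1 ∧ j' = j) →
      T.startFilling (i, j) < T.startFilling (i', j') := by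
    intro i j i' j' hadj
    by_cases h' : i' < T.numRows ∧ j' < T.numCols
    · by_cases hb' : (i', j') ∈ T.boxes
      · have hb : (i, j) ∈ T.boxes := hs i j i' j' (by omega) (by omega) hb'
        rw [startFilling_of_mem hb, startFilling_of_mem hb']
        rcases hadj with ⟨rfl, rfl⟩ | ⟨rfl, rfl⟩
        · exact hT.idxOf_lt_row hb hb' (by omega)
        · exact hT.idxOf_lt_col hb hb' (by omega)
      · rw [startFilling_of_mem_rect hb' h'.1 h'.2]
        by_cases hb : (i, j) ∈ T.boxes
        · rw [startFilling_of_mem hb]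
          have := idxOf_entry_lt hb
          omega
        · rw [startFilling_of_mem_rect hb (by omega) (by omega)]
          have h1 := hb
          have h2 := hb'
          rw [hs.mem_iff_lt_rowLen] at h1 h2
          have h3 : T.rowLen i' ≤ T.rowLen i := hs.rowLen_anti _ _ (by omega)
          -- A step to the right raises the round; a step down raises the row and, as row lengths
          -- weakly decrease, does not lower the round.
          have h4 := hlex (j - T.rowLen i, i) (j' - T.rowLen i', i')
            (mem_crPairs.2 ⟨by simp only; omega, by simp only; omega⟩)
            (mem_crPairs.2 ⟨by simp only; omega, by simp only; omega⟩)
            (by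
              simp only
              rcases hadj with ⟨rfl, rfl⟩ | ⟨rfl, rfl⟩ <;> omega)
          omega
    · rw [startFilling_of_notMem_rect h']
      by_cases h : i < T.numRows ∧ j < T.numCols
      · by_cases hb : (i, j) ∈ T.boxes
        · rw [startFilling_of_mem hb]
          have := idxOf_entry_lt hb
          omega
        · rw [startFilling_of_mem_rect hb h.1 h.2]
          have := hs.idxOf_pair_lt hb h.1 h.2
          omega
      · rw [startFilling_of_notMem_rect h]
        omega
  exact fun i j => ⟨key _ _ _ _ (Or.inl ⟨rfl, rfl⟩), key _ _ _ _ (Or.inr ⟨rfl, rfl⟩)⟩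

theorem exists_crRound_crRow {p : ℕ × ℕ} (hp : p ∈ T.crPairs) :
    ∃ x < T.crPairs.length, T.crRound x = p.1 ∧ T.crRow x = p.2 := by
  obtain ⟨x, hx, rfl⟩ := List.mem_iff_getElem.1 hp
  refine ⟨x, hx, ?_, ?_⟩ <;> rw [crPair_eq hx]

theorem crRow_spec {x : ℕ} (hx : x < T.crPairs.length) :
    T.crRow x < T.numRows ∧ T.rowLen (T.crRow x) + T.crRound x < T.numCols := by
  have h : T.crPairs[x] ∈ T.crPairs := List.getElem_mem hx
  rw [crPair_eq hx] at h
  exact mem_crPairs.1 h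

theorem IsStraight.latticeOrder (hs : T.IsStraight) :
    LatticeOrder T.crPairs.length T.numRows T.crRound T.crRow := by
  refine ⟨?_, fun x hx => (crRow_spec hx).1, ?_, ?_⟩
  · intro x y hxy hy
    have h := List.pairwise_iff_getElem.1 T.pairwise_crPairs x y (by omega) hy hxy
    rwa [crPair_eq, crPair_eq] at h
  · intro y hy s hys
    have h := crRow_spec hy
    exact exists_crRound_crRow (p := (s, T.crRow y))
      (mem_crPairs.2 ⟨h.1, by simp only; omega⟩)
  · intro x hx i hi hi'
    have h := crRow_spec hx
    have h' := hs.rowLen_anti _ _ hi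
    exact exists_crRound_crRow (p := (T.crRound x, i))
      (mem_crPairs.2 ⟨hi', by simp only; omega⟩)

theorem IsStraight.inner_iff (hs : T.IsStraight) (i j : ℕ) :
    T.startFilling (i, j) < T.labels.length ↔ j < T.rowLen i := by
  rw [← hs.mem_iff_lt_rowLen]
  constructor
  · intro h
    by_contra hb
    rw [startFilling, if_neg hb] at h
    split_ifs at h <;> omega
  · intro hb
    rw [startFilling_of_mem hb]
    exact idxOf_entry_lt hb

theorem IsStraight.rect_iff (hs : T.IsStraight) (i j : ℕ) :
    T.startFilling (i, j) < T.labels.length + T.crPairs.length ↔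
      i < T.numRows ∧ j < T.numCols := by
  constructor
  · intro h
    by_contra hb
    rw [startFilling_of_notMem_rect hb] at h
    omega
  · intro h
    by_cases hb : (i, j) ∈ T.boxes
    · rw [startFilling_of_mem hb]
      have := idxOf_entry_lt hb
      omega
    · rw [startFilling_of_mem_rect hb h.1 h.2]
      have := hs.idxOf_pair_lt hb h.1 h.2
      omega

theorem IsStraight.startFilling_eq_iff (hs : T.IsStraight) (x : ℕ) (hx : x < T.crPairs.length)
    (i j : ℕ) : T.startFilling (i, j) = T.labels.length + x ↔
      i = T.crRow x ∧ j = T.rowLen i + T.crRound x := by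
  have hsp := crRow_spec hx
  constructor
  · intro h
    have h1 := (hs.rect_iff i j).1 (by omega)
    have hb : (i, j) ∉ T.boxes := fun hb => by
      have := (hs.inner_iff i j).2 (hs.mem_iff_lt_rowLen.1 hb)
      omega
    have h2 := hs.idxOf_pair_lt hb h1.1 h1.2
    rw [startFilling_of_mem_rect hb h1.1 h1.2] at h
    have h3 := List.getElem_idxOf h2
    obtain rfl : T.crPairs.idxOf (j - T.rowLen i, i) = x := by omega
    rw [crPair_eq hx, Prod.mk.injEq] at h3
    rw [hs.mem_iff_lt_rowLen] at hb
    omega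
  · rintro ⟨rfl, rfl⟩
    rw [startFilling_of_mem_rect (fun hb => by rw [hs.mem_iff_lt_rowLen] at hb; omega) hsp.1 hsp.2,
      Nat.add_sub_cancel_left, ← crPair_eq hx]
    congr 1
    have hnd : T.crPairs.Nodup := T.pairwise_crPairs.imp fun h h' => by rw [h'] at h; omega
    exact hnd.idxOf_getElem _ _

theorem startModel (hs : T.IsStraight) (hT : T.IsDecreasing) :
    StartModel T.numRows T.numCols T.labels.length T.crPairs.length T.rowLen T.crRound T.crRow
      T.startFilling := by
  refine ⟨incr_startFilling hs hT, hs.latticeOrder, hs.rowLen_anti, hs.inner_iff,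
    hs.startFilling_eq_iff, hs.rect_iff, ?_⟩
  intro k hk
  by_cases h : k < T.labels.length
  · obtain ⟨b, hb, hbk⟩ := mem_labels.1 (List.getElem_mem h)
    refine ⟨b, ?_⟩
    rw [startFilling_of_mem hb, hbk]
    exact T.nodup_labels.idxOf_getElem _ _
  · obtain ⟨x, rfl⟩ := Nat.exists_eq_add_of_le (not_lt.1 h)
    exact ⟨(_, _), (hs.startFilling_eq_iff x (by omega) _ _).2 ⟨rfl, rfl⟩⟩

theorem rep_startFilling (hs : T.IsStraight) : Rep 0 T.labels T T.startFilling := by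
  refine ⟨fun b => ?_, fun b hb => ?_⟩
  · have := hs.inner_iff b.1 b.2
    rw [← hs.mem_iff_lt_rowLen] at this
    rw [← this]
    simp
  · rw [startFilling_of_mem hb, Nat.sub_zero, List.getD_eq_getElem _ _ (idxOf_entry_lt hb),
      List.getElem_idxOf]

theorem rep_antiRectDec (hs : T.IsStraight) (hT : T.IsDecreasing) :
    Rep T.crPairs.length T.labels T.antiRectDec
      (seqE 0 T.labels.length T.crPairs.length T.startFilling) := by
  have h := (rep_startFilling hs).foldl_slideStrip T.nodup_labels
    (srt := fun s => s.sort (· ≥ ·))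
    (fun s hs' => sort_eq_filter _ T.nodup_labels (T.pairwise_labels.imp fun h => le_of_lt h) s hs')
    T.crOrder (incr_startFilling hs hT) (by
      intro x hx b
      have hx' : x < T.crPairs.length := by simpa [crOrder_eq_map] using hx
      simp only [crOrder_eq_map, List.getElem_map, Finset.mem_singleton, crPair_eq hx', Nat.zero_add]
      rw [hs.startFilling_eq_iff x hx' b.1 b.2, Prod.ext_iff]
      constructor
      · rintro ⟨h1, h2⟩
        simp only at h1 h2
        exact ⟨h1, by rw [h1, h2]⟩
      · rintro ⟨h1, h2⟩
        exact ⟨h1, by rw [h2, h1]⟩)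
  have hlen : T.crOrder.length = T.crPairs.length := by simp [crOrder_eq_map]
  rw [hlen, Nat.zero_add] at h
  exact h

end Filling

/-! ### Stages and rounds of the anti-rectification. -/

namespace StartModel

variable {ℓ n K M : ℕ} {lam t r : ℕ → ℕ} {g : Box → ℕ}

theorem spec (h : StartModel ℓ n K M lam t r g) {x : ℕ} (hx : x < M) :
    r x < ℓ ∧ lam (r x) + t x < n :=
  (h.rect _ _).1 (((h.box x hx _ _).2 ⟨rfl, rfl⟩).trans_lt (by omega))

theorem exists_label (h : StartModel ℓ n K M lam t r g) {s i : ℕ} (hi : i < ℓ)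
    (hs : lam i + s < n) : ∃ x < M, t x = s ∧ r x = i := by
  have h1 := (h.rect i (lam i + s)).2 ⟨hi, hs⟩
  have h2 : ¬ g (i, lam i + s) < K := fun h2 => by rw [h.inner] at h2; omega
  obtain ⟨x, hx⟩ := Nat.exists_eq_add_of_le (not_lt.1 h2)
  have h3 := (h.box x (by omega) _ _).1 hx
  exact ⟨x, by omega, by omega, h3.1.symm⟩

/-- Down a round the row lengths weakly decrease, so its boxes move weakly left; partners in
consecutive rounds are horizontal neighbours. -/
theorem lattice (h : StartModel ℓ n K M lam t r g) : Lattice M t r K g := by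
  refine ⟨?_, ?_⟩
  · intro x y hxy hy ht i j i' j' hi hj
    rw [h.box x (by omega)] at hi
    rw [h.box y hy] at hj
    have h1 := h.order.lex x y hxy hy
    have h2 := h.anti i i' (by omega)
    omega
  · intro x y hx hy ht hr i j i' j' hi hj
    rw [h.box x hx] at hi
    rw [h.box y hy] at hj
    obtain rfl : i = i' := by omega
    omega

theorem incr_seqE (h : StartModel ℓ n K M lam t r g) (m : ℕ) : Incr (seqE 0 K m g) :=
  h.incr.apply_seqE _ _ _

theorem attained_seqE (h : StartModel ℓ n K M lam t r g) {m : ℕ} (hm : m ≤ M) :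
    Attained (K + M) (seqE 0 K m g) :=
  h.attained.apply_seqE (by omega)

theorem seqE_lt_iff (h : StartModel ℓ n K M lam t r g) {m : ℕ} (hm : m ≤ M) (i j : ℕ) :
    seqE 0 K m g (i, j) < K + M ↔ i < ℓ ∧ j < n := by
  rw [← h.rect, seqE_eq_seqD]
  rcases Nat.eq_zero_or_pos (K + M) with h0 | h0
  · omega
  · have := seqD_le_iff (g := g) (a := 0) (n := K) (m := m) (b := (i, j)) (x := K + M - 1)
      (by omega)
    omega

/-- The strips outside of `T` end up as the single boxes of the rotated complement. -/
theorem final_eq_iff (h : StartModel ℓ n K M lam t r g) {c : ℕ → ℕ}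
    (hc : ∀ i j, j < lam i ↔ i < c j) {x : ℕ} (hx : x < M) (i j : ℕ) :
    seqE 0 K M g (i, j) = x ↔ j = t x ∧ i + c (n - 1 - t x) = r x := by
  have h1 : Lattice M t r 0 (seqE 0 K M g) := by
    rw [seqE_eq_seqD]
    exact Lattice.apply_seqD h.order h.incr (by rw [Nat.zero_add]; exact h.attained)
      (by rw [Nat.zero_add]; exact h.lattice)
  -- Round `s` contains the rows `i` with `lam i ≤ n - 1 - s`, that is, those from `c (n - 1 - s)`
  -- on.
  refine h1.final_position h.order (h.incr_seqE M)
    (fun k hk => h.attained_seqE le_rfl k (by omega)) (fun s => c (n - 1 - s)) ?_ ?_ x hx i j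
  · intro y hy
    have h2 := h.spec hy
    have h3 := hc (r y) (n - 1 - t y)
    omega
  · intro y hy i' hi' hi''
    have h2 := h.spec hy
    have h3 := hc i' (n - 1 - t y)
    exact h.exists_label (by omega) (by omega)

theorem final_lt_iff (h : StartModel ℓ n K M lam t r g) {c : ℕ → ℕ}
    (hc : ∀ i j, j < lam i ↔ i < c j) (i j : ℕ) :
    seqE 0 K M g (i, j) < M ↔ j < n ∧ i + c (n - 1 - j) < ℓ := by
  constructor
  · intro hx
    obtain ⟨x, hx'⟩ : ∃ x, seqE 0 K M g (i, j) = x := ⟨_, rfl⟩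
    rw [hx'] at hx
    obtain ⟨rfl, h1⟩ := (h.final_eq_iff hc hx i j).1 hx'
    have h2 := h.spec hx
    omega
  · rintro ⟨hj, hi⟩
    have h1 := hc (i + c (n - 1 - j)) (n - 1 - j)
    obtain ⟨x, hx, rfl, hr⟩ := h.exists_label (s := j) hi (by omega)
    rw [(h.final_eq_iff hc hx i (t x)).2 ⟨rfl, hr.symm⟩]
    exact hx

end StartModel

/-- Number of strips `x < M` with `t x < q`. -/
def roundStart (M : ℕ) (t : ℕ → ℕ) (q : ℕ) : ℕ := ((Finset.range M).filter fun x => t x < q).card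

theorem roundStart_le (M : ℕ) (t : ℕ → ℕ) (q : ℕ) : roundStart M t q ≤ M :=
  (Finset.card_filter_le _ _).trans (Finset.card_range M).le

theorem roundStart_zero (M : ℕ) (t : ℕ → ℕ) : roundStart M t 0 = 0 := by simp [roundStart]

theorem roundStart_le_succ (M : ℕ) (t : ℕ → ℕ) (q : ℕ) : roundStart M t q ≤ roundStart M t (q + 1) :=
  Finset.card_le_card (Finset.monotone_filter_right _ fun _ _ h => Nat.lt_succ_of_lt h)

theorem LatticeOrder.lt_roundStart_iff {M ℓ : ℕ} {t r : ℕ → ℕ} (ho : LatticeOrder M ℓ t r) {q x : ℕ}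
    (hx : x < M) : x < roundStart M t q ↔ t x < q := by
  rw [roundStart, ← mem_iff_lt_card, Finset.mem_filter, Finset.mem_range]
  · exact ⟨fun h => h.2, fun h => ⟨hx, h⟩⟩
  · intro x y hxy hy
    rw [Finset.mem_filter, Finset.mem_range] at hy ⊢
    rcases Nat.eq_or_lt_of_le hxy with rfl | h
    · exact hy
    · have := ho.lex x y h hy.1
      exact ⟨by omega, by omega⟩

namespace StartModel

variable {ℓ n K M : ℕ} {lam t r : ℕ → ℕ} {g : Box → ℕ}

theorem lt_roundStart_iff (h : StartModel ℓ n K M lam t r g) (q i j : ℕ) :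
    g (i, j) < K + roundStart M t q ↔ i < ℓ ∧ j < n ∧ (j < lam i ∨ j < lam i + q) := by
  have hB := roundStart_le M t q
  constructor
  · intro h1
    have h2 := (h.rect i j).1 (by omega)
    refine ⟨h2.1, h2.2, ?_⟩
    by_contra hc
    have h3 : ¬ g (i, j) < K := fun h3 => by rw [h.inner] at h3; omega
    obtain ⟨x, hx⟩ := Nat.exists_eq_add_of_le (not_lt.1 h3)
    have h4 := (h.box x (by omega) _ _).1 hx
    have h5 := (h.order.lt_roundStart_iff (q := q) (x := x) (by omega)).1 (by omega)
    omega
  · rintro ⟨h1, h2, h3⟩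
    have h4 := (h.rect i j).2 ⟨h1, h2⟩
    by_contra hc
    obtain ⟨x, hx⟩ := Nat.exists_eq_add_of_le (show K ≤ g (i, j) by omega)
    have h5 := (h.box x (by omega) _ _).1 hx
    have h6 := (h.order.lt_roundStart_iff (q := q) (x := x) (by omega)).2 (by omega)
    omega

/-- The largest chains of the columns from `j` on keep their size, while the rounds go by. -/
theorem exists_pureChain_iff (h : StartModel ℓ n K M lam t r g) {lo j k : ℕ} (hlo : lo ≤ K) (q : ℕ) :
    q + j < n → ((∃ C : Finset Box, C.card = k ∧ PureChain g lo K j C) ↔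
      ∃ C : Finset Box, C.card = k ∧ PureChain (seqE 0 K (roundStart M t q) g)
        (lo + roundStart M t q) (K + roundStart M t q) (j + q) C) := by
  induction q with
  | zero =>
    intro _
    rw [roundStart_zero]
    rfl
  | succ q ih =>
    intro hq
    rw [ih (by omega)]
    have hB := roundStart_le_succ M t q
    have hB' := roundStart_le M t (q + 1)
    obtain ⟨m, hm⟩ := Nat.exists_eq_add_of_le hB
    -- The boxes of the coming round have not been touched by earlier slides, so their geometry is
    -- that of the start.
    have hge : ∀ x, ∀ b, seqE 0 K (roundStart M t q) g b = roundStart M t q + K + x ↔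
        g b = K + (roundStart M t q + x) := by
      intro x b
      rw [seqE_eq_seqD]
      constructor
      · intro h1
        have h2 := (seqD_ge_iff (a := 0) (n := K) (m := roundStart M t q) (g := g) (b := b)).1
          (by omega)
        rw [seqD_of_ge h2] at h1
        omega
      · intro h1
        rw [seqD_of_ge (by omega)]
        omega
    have hlt : ∀ x, ∀ b, seqE 0 K (roundStart M t q) g b < K + roundStart M t q + x ↔
        g b < K + roundStart M t q + x := by
      intro x b
      rcases Nat.eq_zero_or_pos (K + roundStart M t q + x) with h0 | h0
      · omega
      · rw [seqE_eq_seqD]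
        have := seqD_le_iff (g := g) (a := 0) (n := K) (m := roundStart M t q) (b := b)
          (x := K + roundStart M t q + x - 1) (by omega)
        omega
    rw [hm, seqE_add, Nat.zero_add, ← Nat.add_assoc, ← Nat.add_assoc, ← Nat.add_assoc,
      Nat.add_comm K (roundStart M t q)]
    refine exists_pureChain_seqE_iff (h.incr_seqE _) ?_ ?_ (by omega) (by omega) ?_
    · intro x y hxy hy i i' j j' hi hj
      rw [hge] at hi hj
      have h1 : t (roundStart M t q + x) = t (roundStart M t q + y) := by
        have h2 := h.order.lt_roundStart_iff (q := q) (x := roundStart M t q + x) (by omega)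
        have h3 := h.order.lt_roundStart_iff (q := q) (x := roundStart M t q + y) (by omega)
        have h4 := h.order.lt_roundStart_iff (q := q + 1) (x := roundStart M t q + x) (by omega)
        have h5 := h.order.lt_roundStart_iff (q := q + 1) (x := roundStart M t q + y) (by omega)
        omega
      exact h.lattice.below _ _ (by omega) (by omega) h1 _ _ _ _ hi hj
    · intro k hk
      exact h.attained_seqE (by omega) k (by omega)
    -- Round `q` adds one box to every row that is not yet full, and column `j + q + 1` is still
    -- inside the rectangle; hence right neighbours are covered after this round.
    · intro i hi
      have h1 := (hlt 0 (i, j + q)).1 (by omega)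
      have h2 := (h.lt_roundStart_iff q _ _).1 h1
      have h3 := (h.lt_roundStart_iff (q + 1) i (j + q + 1)).2 ⟨h2.1, by omega, by omega⟩
      have h4 := (hlt m (i, j + q + 1)).2 (by omega)
      omega

end StartModel

/-! ### The right keys and the shape of `T.sharp`. -/

theorem getD_lt_getD {L : List ℕ} (hL : L.Pairwise (· > ·)) {i j : ℕ} (h : i < j)
    (hj : j < L.length) : L.getD j 0 < L.getD i 0 := by
  rw [List.getD_eq_getElem _ _ hj, List.getD_eq_getElem _ _ (h.trans hj)]
  exact List.pairwise_iff_getElem.1 hL i j (h.trans hj) hj h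

theorem exists_getD_le_iff {L : List ℕ} (hL : L.Pairwise (· > ·)) (v : ℕ) :
    ∃ lo ≤ L.length, ∀ i < L.length, L.getD i 0 ≤ v ↔ lo ≤ i := by
  refine ⟨((Finset.range L.length).filter fun i => v < L.getD i 0).card,
    (Finset.card_filter_le _ _).trans (Finset.card_range _).le, fun i hi => ?_⟩
  rw [← not_lt, ← not_lt, ← mem_iff_lt_card, Finset.mem_filter, Finset.mem_range]
  · exact not_congr ⟨fun h => ⟨hi, h⟩, fun h => h.2⟩
  · intro x y hxy hy
    rw [Finset.mem_filter, Finset.mem_range] at hy ⊢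
    rcases Nat.eq_or_lt_of_le hxy with rfl | h
    · exact hy
    · have := getD_lt_getD hL h hy.1
      exact ⟨by omega, by omega⟩

theorem Rep.mem_column {a : ℕ} {L : List ℕ} {T : Filling} {g : Box → ℕ} (h : Rep a L T g)
    {c v : ℕ} : v ∈ T.column c ↔
      ∃ i, a ≤ g (i, c) ∧ g (i, c) < a + L.length ∧ L.getD (g (i, c) - a) 0 = v := by
  simp only [Filling.column, Finset.mem_image, Finset.mem_filter]
  constructor
  · rintro ⟨⟨i, j⟩, ⟨hb, rfl⟩, rfl⟩
    have h1 := (h.mem _).1 hb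
    exact ⟨i, h1.1, h1.2, (h.entry _ hb).symm⟩
  · rintro ⟨i, h1, h2, rfl⟩
    have hb := (h.mem (i, c)).2 ⟨h1, h2⟩
    exact ⟨_, ⟨hb, rfl⟩, h.entry _ hb⟩

namespace Filling

variable {T : Filling}

theorem mem_dropCols {n i j : ℕ} : (i, j) ∈ (T.dropCols n).boxes ↔ (i, j + n) ∈ T.boxes := by
  simp only [dropCols, Finset.mem_image, Finset.mem_filter, Prod.exists, Prod.mk.injEq]
  constructor
  · rintro ⟨a, b, ⟨h, hn⟩, rfl, rfl⟩
    rwa [Nat.sub_add_cancel hn]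
  · exact fun h => ⟨i, j + n, ⟨h, by omega⟩, rfl, by omega⟩

theorem IsStraight.dropCols (hs : T.IsStraight) (n : ℕ) : (T.dropCols n).IsStraight := by
  intro i j i' j' hi hj h
  rw [mem_dropCols] at h ⊢
  exact hs _ _ _ _ hi (by omega) h

theorem IsDecreasing.dropCols (hT : T.IsDecreasing) (n : ℕ) : (T.dropCols n).IsDecreasing := by
  refine ⟨?_, ?_, ?_⟩
  · rintro ⟨i, j⟩ h
    exact hT.1 _ (mem_dropCols.1 h)
  · intro i j j' h h' hj
    exact hT.2.1 _ _ _ (mem_dropCols.1 h) (mem_dropCols.1 h') (by omega)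
  · intro i i' j h h' hi
    exact hT.2.2 _ _ _ (mem_dropCols.1 h) (mem_dropCols.1 h') hi

theorem dropCols_zero (T : Filling) : T.dropCols 0 = T := by
  have h : (T.dropCols 0).boxes = T.boxes := by
    ext ⟨i, j⟩
    exact mem_dropCols
  exact congrArg (fun s => Filling.mk s T.entry) h

/-- The filling of the quadrant after the first `s` boxes of `crOrder`. -/
noncomputable def stage (T : Filling) (s : ℕ) : Box → ℕ := seqE 0 T.labels.length s T.startFilling

/-- Number of boxes in the first `q` rounds of `crOrder`. -/
def roundEnd (T : Filling) (q : ℕ) : ℕ := roundStart T.crPairs.length T.crRound q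

/-- The entries in the last column of the rectangle after `q` rounds. -/
noncomputable def roundColumn (T : Filling) (q : ℕ) : Finset ℕ :=
  ((Finset.range T.numRows).filter fun i => T.roundEnd q ≤ T.stage (T.roundEnd q) (i, T.numCols - 1) ∧
    T.stage (T.roundEnd q) (i, T.numCols - 1) < T.roundEnd q + T.labels.length).image fun i =>
      T.labels.getD (T.stage (T.roundEnd q) (i, T.numCols - 1) - T.roundEnd q) 0

theorem lt_numRows_of_stage_lt (hs : T.IsStraight) (hT : T.IsDecreasing) {q i j : ℕ}
    (h : T.stage (T.roundEnd q) (i, j) < T.roundEnd q + T.labels.length) :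
    i < T.numRows ∧ j < T.numCols := by
  have hB : T.roundEnd q ≤ T.crPairs.length := roundStart_le _ _ _
  refine ((startModel hs hT).seqE_lt_iff hB i j).1 ?_
  rw [stage] at h
  omega

theorem mem_roundColumn (hs : T.IsStraight) (hT : T.IsDecreasing) {q v : ℕ} :
    v ∈ T.roundColumn q ↔ ∃ i, T.roundEnd q ≤ T.stage (T.roundEnd q) (i, T.numCols - 1) ∧
      T.stage (T.roundEnd q) (i, T.numCols - 1) < T.roundEnd q + T.labels.length ∧
      T.labels.getD (T.stage (T.roundEnd q) (i, T.numCols - 1) - T.roundEnd q) 0 = v := by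
  simp only [roundColumn, Finset.mem_image, Finset.mem_filter, Finset.mem_range]
  constructor
  · rintro ⟨i, ⟨-, h1, h2⟩, h3⟩
    exact ⟨i, h1, h2, h3⟩
  · rintro ⟨i, h1, h2, h3⟩
    exact ⟨i, ⟨(lt_numRows_of_stage_lt hs hT h2).1, h1, h2⟩, h3⟩

/-- Larger entries lie further inside, so the order is reversed and the bound `v` on entries becomes
the lower bound `lo` on levels. -/
theorem exists_chain_dropCols_iff (hs : T.IsStraight) {lo v j k : ℕ}
    (hlo : ∀ i < T.labels.length, T.labels.getD i 0 ≤ v ↔ lo ≤ i) :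
    (∃ C : Finset Box, C.card = k ∧
      (∀ x ∈ C, x ∈ (T.dropCols j).boxes ∧ (T.dropCols j).entry x ≤ v) ∧
        ∀ x ∈ C, ∀ y ∈ C, x ≠ y →
          ((T.dropCols j).entry x < (T.dropCols j).entry y ∧ x.2 ≤ y.2) ∨
          ((T.dropCols j).entry y < (T.dropCols j).entry x ∧ y.2 ≤ x.2)) ↔
      ∃ C : Finset Box, C.card = k ∧ PureChain T.startFilling lo T.labels.length j C := by
  have hrep := rep_startFilling hs
  have hmem : ∀ b : Box, b ∈ T.boxes ↔ T.startFilling b < T.labels.length := fun b => by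
    simpa using hrep.mem b
  have hent : ∀ b ∈ T.boxes, T.entry b = T.labels.getD (T.startFilling b) 0 := hrep.entry
  have hlt : ∀ b ∈ T.boxes, ∀ c ∈ T.boxes,
      T.entry b < T.entry c ↔ T.startFilling c < T.startFilling b := by
    intro b hb c hc
    rw [hent b hb, hent c hc]
    rcases Nat.lt_trichotomy (T.startFilling b) (T.startFilling c) with h | h | h
    · have := getD_lt_getD T.pairwise_labels h ((hmem c).1 hc)
      omega
    · rw [h]
      omega
    · have := getD_lt_getD T.pairwise_labels h ((hmem b).1 hb)
      omega
  have hle : ∀ b ∈ T.boxes, T.entry b ≤ v ↔ lo ≤ T.startFilling b := fun b hb => by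
    rw [hent b hb, hlo _ ((hmem b).1 hb)]
  constructor
  · rintro ⟨C, rfl, h1, h2⟩
    have hbox : ∀ x ∈ C, (x.1, x.2 + j) ∈ T.boxes := fun x hx => mem_dropCols.1 (h1 x hx).1
    refine ⟨C.image fun b => (b.1, b.2 + j), Finset.card_image_of_injective _ ?_, ?_, ?_⟩
    · rintro ⟨a, b⟩ ⟨c, d⟩ h
      simp only [Prod.mk.injEq] at h ⊢
      omega
    · intro x hx
      obtain ⟨b, hb, rfl⟩ := Finset.mem_image.1 hx
      exact ⟨(hle _ (hbox b hb)).1 (h1 b hb).2, (hmem _).1 (hbox b hb), Nat.le_add_left _ _⟩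
    · intro x hx y hy hxy
      obtain ⟨b, hb, rfl⟩ := Finset.mem_image.1 hx
      obtain ⟨c, hc, rfl⟩ := Finset.mem_image.1 hy
      rw [← hlt _ (hbox b hb) _ (hbox c hc), ← hlt _ (hbox c hc) _ (hbox b hb)]
      rcases h2 b hb c hc (by rintro rfl; exact hxy rfl) with h3 | h3
      · exact Or.inr ⟨h3.1, by simpa using h3.2⟩
      · exact Or.inl ⟨h3.1, by simpa using h3.2⟩
  · rintro ⟨C, rfl, h1, h2⟩
    have hbox : ∀ x ∈ C, x ∈ T.boxes := fun x hx => (hmem x).2 (h1 x hx).2.1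
    have hsub : ∀ x ∈ C, (x.1, x.2 - j + j) = x := fun x hx => by
      rw [Nat.sub_add_cancel (h1 x hx).2.2]
    have hent' : ∀ x ∈ C, (T.dropCols j).entry (x.1, x.2 - j) = T.entry x := fun x hx =>
      congrArg T.entry (hsub x hx)
    refine ⟨C.image fun b => (b.1, b.2 - j), Finset.card_image_of_injOn ?_, ?_, ?_⟩
    · intro x hx y hy h
      simp only [Prod.mk.injEq] at h
      rw [← hsub x hx, ← hsub y hy, h.1, h.2]
    · intro x hx
      obtain ⟨b, hb, rfl⟩ := Finset.mem_image.1 hx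
      rw [mem_dropCols, hent' b hb, hsub b hb]
      exact ⟨hbox b hb, (hle b (hbox b hb)).2 (h1 b hb).1⟩
    · intro x hx y hy hxy
      obtain ⟨b, hb, rfl⟩ := Finset.mem_image.1 hx
      obtain ⟨c, hc, rfl⟩ := Finset.mem_image.1 hy
      rw [hent' b hb, hent' c hc, hlt _ (hbox b hb) _ (hbox c hc), hlt _ (hbox c hc) _ (hbox b hb)]
      rcases h2 b hb c hc (by rintro rfl; exact hxy rfl) with h3 | h3
      · exact Or.inr ⟨h3.1, Nat.sub_le_sub_right h3.2 j⟩
      · exact Or.inl ⟨h3.1, Nat.sub_le_sub_right h3.2 j⟩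

theorem exists_pureChain_last_iff (hs : T.IsStraight) (hT : T.IsDecreasing) {lo q k : ℕ} :
    (∃ C : Finset Box, C.card = k ∧ PureChain (T.stage (T.roundEnd q)) (lo + T.roundEnd q)
      (T.labels.length + T.roundEnd q) (T.numCols - 1) C) ↔
      k ≤ ((Finset.range T.numRows).filter fun i =>
        lo + T.roundEnd q ≤ T.stage (T.roundEnd q) (i, T.numCols - 1) ∧
        T.stage (T.roundEnd q) (i, T.numCols - 1) < T.labels.length + T.roundEnd q).card := by
  have hinj : Function.Injective fun i : ℕ => (i, T.numCols - 1) := fun i i' h => by simpa using h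
  constructor
  · rintro ⟨C, rfl, h1, h2⟩
    rw [← Finset.card_image_of_injective _ hinj]
    refine Finset.card_le_card fun x hx => ?_
    obtain ⟨h3, h4, h5⟩ := h1 x hx
    have h6 := lt_numRows_of_stage_lt hs hT (q := q) (i := x.1) (j := x.2) (by
      simpa [Nat.add_comm] using h4)
    obtain ⟨i, j⟩ := x
    obtain rfl : T.numCols - 1 = j := by simp only at h5 h6; omega
    exact Finset.mem_image.2 ⟨i, Finset.mem_filter.2 ⟨Finset.mem_range.2 h6.1, h3, h4⟩, rfl⟩
  · intro hk
    obtain ⟨S, hS, rfl⟩ := Finset.exists_subset_card_eq hk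
    refine ⟨S.image fun i => (i, T.numCols - 1), Finset.card_image_of_injective _ hinj, ?_, ?_⟩
    · intro x hx
      obtain ⟨i, hi, rfl⟩ := Finset.mem_image.1 hx
      have h1 := (Finset.mem_filter.1 (hS hi)).2
      exact ⟨h1.1, h1.2, le_rfl⟩
    · intro x hx y hy hxy
      obtain ⟨i, hi, rfl⟩ := Finset.mem_image.1 hx
      obtain ⟨i', hi', rfl⟩ := Finset.mem_image.1 hy
      have hg := (startModel hs hT).incr_seqE (T.roundEnd q)
      rcases Nat.lt_trichotomy i i' with h | rfl | h
      · exact Or.inl ⟨hg.col_lt _ h, le_rfl⟩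
      · exact absurd rfl hxy
      · exact Or.inr ⟨hg.col_lt _ h, le_rfl⟩

/-- Both sets have the same number of elements at most `v`, for every `v`: on the left this counts a
longest chain from column `j` on, which `q` rounds push into the last column, and there a chain is
any set of boxes. -/
theorem star_word_dropCols (hs : T.IsStraight) (hT : T.IsDecreasing) {j : ℕ} (hj : j < T.numCols) :
    star ∅ (T.dropCols j).word = T.roundColumn (T.numCols - 1 - j) := by
  refine eq_of_card_filter_le_eq fun v => ?_
  obtain ⟨lo, hloK, hlo⟩ := exists_getD_le_iff T.pairwise_labels v
  generalize hq : T.numCols - 1 - j = q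
  have hcard : ((T.roundColumn q).filter (· ≤ v)).card =
      ((Finset.range T.numRows).filter fun i =>
        lo + T.roundEnd q ≤ T.stage (T.roundEnd q) (i, T.numCols - 1) ∧
        T.stage (T.roundEnd q) (i, T.numCols - 1) < T.labels.length + T.roundEnd q).card := by
    have himage : (T.roundColumn q).filter (· ≤ v) = ((Finset.range T.numRows).filter fun i =>
        lo + T.roundEnd q ≤ T.stage (T.roundEnd q) (i, T.numCols - 1) ∧
        T.stage (T.roundEnd q) (i, T.numCols - 1) < T.labels.length + T.roundEnd q).image fun i =>
          T.labels.getD (T.stage (T.roundEnd q) (i, T.numCols - 1) - T.roundEnd q) 0 := by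
      ext x
      simp only [Finset.mem_filter, mem_roundColumn hs hT, Finset.mem_image, Finset.mem_range]
      constructor
      · rintro ⟨⟨i, h1, h2, rfl⟩, h3⟩
        rw [hlo _ (by omega)] at h3
        exact ⟨i, ⟨(lt_numRows_of_stage_lt hs hT h2).1, by omega, by omega⟩, rfl⟩
      · rintro ⟨i, ⟨-, h1, h2⟩, rfl⟩
        rw [hlo _ (by omega)]
        exact ⟨⟨i, by omega, by omega, rfl⟩, by omega⟩
    rw [himage]
    refine Finset.card_image_of_injOn ?_
    intro i hi i' hi' h
    simp only [Finset.coe_filter, Set.mem_ofPred_eq] at hi hi' h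
    have h1 := getD_inj T.nodup_labels (by omega) (by omega) h
    exact ((startModel hs hT).incr_seqE (T.roundEnd q)).col_inj
      (show T.stage (T.roundEnd q) (i, T.numCols - 1) = T.stage (T.roundEnd q) (i', T.numCols - 1)
        by omega)
  rw [hcard]
  refine eq_of_forall_le_iff fun k => ?_
  rw [le_card_star_iff, exists_sublist_word_iff (hT.dropCols j), exists_chain_dropCols_iff hs hlo,
    (startModel hs hT).exists_pureChain_iff hloK q (by omega), ← exists_pureChain_last_iff hs hT,
    show j + q = T.numCols - 1 by omega]
  rfl

theorem rep_antiRectDec_stage (hs : T.IsStraight) (hT : T.IsDecreasing) :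
    Rep T.crPairs.length T.labels T.antiRectDec (T.stage T.crPairs.length) :=
  rep_antiRectDec hs hT

/-- Every row of the rectangle meets `T`, so no row has more than `numCols - 1` free boxes. -/
theorem roundEnd_last (hs : T.IsStraight) : T.roundEnd (T.numCols - 1) = T.crPairs.length := by
  refine le_antisymm (roundStart_le _ _ _) (not_lt.1 fun h => ?_)
  have h1 := crRow_spec h
  have h2 := hs.latticeOrder.lt_roundStart_iff (q := T.numCols - 1) h
  have h3 := hs.mem_iff_lt_rowLen.1 (hs.lt_numRows_iff.1 h1.1)
  exact absurd (h2.2 (by omega)) (lt_irrefl _)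

theorem column_antiRectDec (hs : T.IsStraight) (hT : T.IsDecreasing) (h : 0 < T.numCols) :
    T.antiRectDec.column (T.numCols - 1) = star ∅ T.word := by
  have h1 := star_word_dropCols hs hT h
  rw [dropCols_zero] at h1
  rw [h1]
  ext v
  rw [(rep_antiRectDec_stage hs hT).mem_column, mem_roundColumn hs hT, Nat.sub_zero,
    roundEnd_last hs]

theorem rightKey_eq_rightKeyStar (hs : T.IsStraight) (hT : T.IsDecreasing) :
    T.rightKey = T.rightKeyStar := by
  refine List.map_congr_left fun j hj => column_antiRectDec (hs.dropCols j) (hT.dropCols j) ?_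
  rw [List.mem_range, hs.lt_numCols_iff] at hj
  rw [(hs.dropCols j).lt_numCols_iff, mem_dropCols, Nat.zero_add]
  exact hj

theorem rowLen_colLen (hs : T.IsStraight) (i j : ℕ) : j < T.rowLen i ↔ i < T.colLen j := by
  rw [← hs.mem_iff_lt_rowLen, hs.mem_iff_lt_colLen]

theorem mem_antiRectDec (hs : T.IsStraight) (hT : T.IsDecreasing) {i j : ℕ} :
    (i, j) ∈ T.antiRectDec.boxes ↔
      i < T.numRows ∧ j < T.numCols ∧ (T.numRows - 1 - i, T.numCols - 1 - j) ∈ T.boxes := by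
  rw [(rep_antiRectDec_stage hs hT).mem, hs.mem_iff_lt_colLen]
  have h1 := (startModel hs hT).final_lt_iff (rowLen_colLen hs) i j
  have h2 := (startModel hs hT).seqE_lt_iff le_rfl i j
  have h3 : T.colLen (T.numCols - 1 - j) ≤ T.numRows := by
    by_contra hc
    exact lt_irrefl _ (lt_numRows (hs.mem_iff_lt_colLen.2 (not_le.1 hc)))
  rw [stage]
  omega

theorem mem_sharp (hs : T.IsStraight) (hT : T.IsDecreasing) {i j : ℕ} :
    (i, j) ∈ T.sharp.boxes ↔ (i, j) ∈ T.boxes := by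
  simp only [sharp, rotate, Finset.mem_image, Prod.exists, Prod.mk.injEq]
  constructor
  · rintro ⟨a, b, h, rfl, rfl⟩
    exact ((mem_antiRectDec hs hT).1 h).2.2
  · intro h
    have h1 : i < T.numRows := lt_numRows h
    have h2 : j < T.numCols := lt_numCols h
    refine ⟨T.numRows - 1 - i, T.numCols - 1 - j,
      (mem_antiRectDec hs hT).2 ⟨by omega, by omega, ?_⟩, by omega, by omega⟩
    rwa [show T.numRows - 1 - (T.numRows - 1 - i) = i by omega,
      show T.numCols - 1 - (T.numCols - 1 - j) = j by omega]

theorem sharp_boxes (hs : T.IsStraight) (hT : T.IsDecreasing) : T.sharp.boxes = T.boxes :=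
  Finset.ext fun _ => mem_sharp hs hT

/-- The strips of `T.sharp` in terms of the last stage. -/
theorem sharp_entry (hs : T.IsStraight) (hT : T.IsDecreasing) {i j : ℕ} (h : (i, j) ∈ T.boxes) :
    T.crPairs.length ≤ T.stage T.crPairs.length (T.numRows - 1 - i, T.numCols - 1 - j) ∧
    T.stage T.crPairs.length (T.numRows - 1 - i, T.numCols - 1 - j) <
      T.crPairs.length + T.labels.length ∧
    T.sharp.entry (i, j) = T.labels.getD
      (T.stage T.crPairs.length (T.numRows - 1 - i, T.numCols - 1 - j) - T.crPairs.length) 0 := by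
  have h1 : i < T.numRows := lt_numRows h
  have h2 : j < T.numCols := lt_numCols h
  have h3 : (T.numRows - 1 - i, T.numCols - 1 - j) ∈ T.antiRectDec.boxes := by
    refine (mem_antiRectDec hs hT).2 ⟨by omega, by omega, ?_⟩
    rwa [show T.numRows - 1 - (T.numRows - 1 - i) = i by omega,
      show T.numCols - 1 - (T.numCols - 1 - j) = j by omega]
  have h4 := ((rep_antiRectDec_stage hs hT).mem _).1 h3
  exact ⟨h4.1, h4.2, (rep_antiRectDec_stage hs hT).entry _ h3⟩

theorem isIncreasing_sharp (hs : T.IsStraight) (hT : T.IsDecreasing) : T.sharp.IsIncreasing := by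
  have hg := (startModel hs hT).incr_seqE T.crPairs.length
  refine ⟨?_, ?_, ?_⟩
  · rintro ⟨i, j⟩ h
    rw [mem_sharp hs hT] at h
    obtain ⟨h1, h2, h3⟩ := sharp_entry hs hT h
    rw [h3, List.getD_eq_getElem _ _ (by omega)]
    obtain ⟨b, hb, hbe⟩ := mem_labels.1 (List.getElem_mem (l := T.labels) (n :=
      T.stage T.crPairs.length (T.numRows - 1 - i, T.numCols - 1 - j) - T.crPairs.length) (by omega))
    rw [← hbe]
    exact hT.1 b hb
  · intro i j j' h h' hj
    rw [mem_sharp hs hT] at h h'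
    obtain ⟨h1, h2, h3⟩ := sharp_entry hs hT h
    obtain ⟨h4, h5, h6⟩ := sharp_entry hs hT h'
    rw [h3, h6]
    have h7 : j' < T.numCols := lt_numCols h'
    have h8 := hg.row_lt (T.numRows - 1 - i) (show T.numCols - 1 - j' < T.numCols - 1 - j by omega)
    rw [stage] at h1 h2 h4 h5 ⊢
    exact getD_lt_getD T.pairwise_labels (by omega) (by omega)
  · intro i i' j h h' hj
    rw [mem_sharp hs hT] at h h'
    obtain ⟨h1, h2, h3⟩ := sharp_entry hs hT h
    obtain ⟨h4, h5, h6⟩ := sharp_entry hs hT h'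
    rw [h3, h6]
    have h7 : i' < T.numRows := lt_numRows h'
    have h8 := hg.col_lt (T.numCols - 1 - j) (show T.numRows - 1 - i' < T.numRows - 1 - i by omega)
    rw [stage] at h1 h2 h4 h5 ⊢
    exact getD_lt_getD T.pairwise_labels (by omega) (by omega)

end Filling

/-! ### Rotation and reversal of slides. -/

/-- Inside the rectangle with `ℓ` rows and `j + 1` columns, `h` is the rotated complement of the
last `j + 1` columns of `g` in the rectangle with `ℓ` rows and `n` columns. -/
structure Mirror (ℓ n j N : ℕ) (g h : Box → ℕ) : Prop where
  eq : ∀ i x, i < ℓ → x ≤ j → h (i, x) + g (ℓ - 1 - i, n - 1 - x) + 1 = N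
  outer_right : ∀ i x, ¬ (i < ℓ ∧ x ≤ j) → N ≤ h (i, x)
  outer_left : ∀ i x, ¬ (i < ℓ ∧ x < n) → N ≤ g (i, x)

section Mirror

variable {ℓ n j N : ℕ} {g h : Box → ℕ}

theorem adjacent_rotate {ℓ n i x i' x' : ℕ} (hi : i < ℓ) (hi' : i' < ℓ) (hx : x < n) (hx' : x' < n)
    (h : Adjacent (i, x) (i', x')) :
    Adjacent (ℓ - 1 - i, n - 1 - x) (ℓ - 1 - i', n - 1 - x') := by
  simp only [Adjacent] at h ⊢
  omega

/-- Rotation preserves adjacency. Truncation could only lose neighbours left of column `n - 1 - j`,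
which `hcol` excludes. -/
theorem Mirror.exists_adjacent_iff (hm : Mirror ℓ n j N g h) (hj : j < n) {i x u v : ℕ}
    (hi : i < ℓ) (hx : x ≤ j) (huv : u + v + 1 = N)
    (hcol : ∀ c, Adjacent (ℓ - 1 - i, n - 1 - x) c → g c = u → n - 1 - j ≤ c.2) :
    (∃ c, Adjacent (i, x) c ∧ h c = v) ↔
      ∃ c, Adjacent (ℓ - 1 - i, n - 1 - x) c ∧ g c = u := by
  constructor
  · rintro ⟨⟨a, b⟩, hab, hv⟩
    have h1 : a < ℓ ∧ b ≤ j := by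
      by_contra hc
      have := hm.outer_right a b hc
      omega
    have h2 := hm.eq a b h1.1 h1.2
    exact ⟨_, adjacent_rotate hi h1.1 (by omega) (by omega) hab, by omega⟩
  · rintro ⟨⟨a, b⟩, hab, hu⟩
    have h1 : a < ℓ ∧ b < n := by
      by_contra hc
      have := hm.outer_left a b hc
      omega
    have h2 := hcol _ hab hu
    simp only at h2
    have h3 := hm.eq (ℓ - 1 - a) (n - 1 - b) (by omega) (by omega)
    rw [show ℓ - 1 - (ℓ - 1 - a) = a by omega, show n - 1 - (n - 1 - b) = b by omega] at h3
    have h4 := adjacent_rotate (ℓ := ℓ) (n := n) (by omega) h1.1 (by omega) h1.2 hab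
    rw [show ℓ - 1 - (ℓ - 1 - i) = i by omega, show n - 1 - (n - 1 - x) = x by omega] at h4
    exact ⟨_, h4, by omega⟩

theorem Mirror.apply_tog (hm : Mirror ℓ n j N g h) (hg : Incr g) (hj : j < n) {k k' : ℕ}
    (hk : k + k' + 2 = N) (hcol : ∀ b, g b = k → n - 1 - j ≤ b.2) :
    Mirror ℓ n j N (tog k g) (tog k' h) := by
  refine ⟨?_, ?_, ?_⟩
  · intro i x hi hx
    have h0 := hm.eq i x hi hx
    by_cases h1 : g (ℓ - 1 - i, n - 1 - x) = k
    · have h2 : h (i, x) = k' + 1 := by omega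
      -- Neighbours of strip `k` in strip `k + 1` are to the right or below, hence inside the kept
      -- columns. Neighbours in strip `k` itself need the assumption `hcol`.
      have h3 := hm.exists_adjacent_iff hj (u := k + 1) (v := k') hi hx (by omega) (by
        intro c hc hck
        rcases hg.adjacent_outer hc (by omega) with rfl | rfl <;> simp only <;> omega)
      by_cases h4 : ∃ c, Adjacent (ℓ - 1 - i, n - 1 - x) c ∧ g c = k + 1
      · obtain ⟨c', hc', hck'⟩ := h3.2 h4
        obtain ⟨c, hc, hck⟩ := h4
        rw [tog_inner_keep h1 hc hck, tog_outer_keep h2 hc' hck']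
        omega
      · have h5 : ∀ c, Adjacent (i, x) c → h c ≠ k' := fun c hc hck => h4 (h3.1 ⟨c, hc, hck⟩)
        push Not at h4
        rw [tog_inner_move h1 h4, tog_outer_move h2 h5]
        omega
    · by_cases h1' : g (ℓ - 1 - i, n - 1 - x) = k + 1
      · have h2 : h (i, x) = k' := by omega
        have h3 := hm.exists_adjacent_iff hj (u := k) (v := k' + 1) hi hx (by omega)
          (fun c _ hck => hcol c hck)
        by_cases h4 : ∃ c, Adjacent (ℓ - 1 - i, n - 1 - x) c ∧ g c = k
        · obtain ⟨c', hc', hck'⟩ := h3.2 h4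
          obtain ⟨c, hc, hck⟩ := h4
          rw [tog_outer_keep h1' hc hck, tog_inner_keep h2 hc' hck']
          omega
        · have h5 : ∀ c, Adjacent (i, x) c → h c ≠ k' + 1 := fun c hc hck => h4 (h3.1 ⟨c, hc, hck⟩)
          push Not at h4
          rw [tog_outer_move h1' h4, tog_inner_move h2 h5]
          omega
      · rw [tog_of_ne h1 h1', tog_of_ne (by omega) (by omega)]
        exact h0
  · intro i x hix
    have := hm.outer_right i x hix
    rw [tog_gt (by omega)]
    exact this
  · intro i x hix
    have := hm.outer_left i x hix
    rw [tog_gt (by omega)]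
    exact this

/-- A strip moving outwards takes over boxes only from its left or upper neighbours, so its boxes
never go to the left. -/
theorem Incr.column_up (hg : Incr g) {a c : ℕ} (hcol : ∀ b, g b = a → c ≤ b.2) (m : ℕ) :
    ∀ b, up a m g b = a + m → c ≤ b.2 := by
  induction m with
  | zero => exact hcol
  | succ m ih =>
    rintro ⟨i, x⟩ hb
    rcases (hg.apply_up a m).tog_outer_cases hb with ⟨-, ⟨x', rfl, hx'⟩ | ⟨i', rfl, hi'⟩⟩ | ⟨h1, -⟩
    · exact (ih _ hx').trans (Nat.le_succ _)
    · exact (ih (i', x) hi' : c ≤ x)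
    · exact ih _ h1

theorem Mirror.apply_up (hm : Mirror ℓ n j N g h) (hg : Incr g) (hj : j < n) {a : ℕ}
    (hcol : ∀ b, g b = a → n - 1 - j ≤ b.2) (m : ℕ) :
    ∀ a', a + m + a' + 1 = N → Mirror ℓ n j N (up a m g) (dn a' m h) := by
  induction m with
  | zero => exact fun _ _ => hm
  | succ m ih =>
    intro a' ha'
    rw [dn_succ']
    exact (ih (a' + 1) (by omega)).apply_tog (hg.apply_up a m) hj (by omega) (hg.column_up hcol m)

theorem seqE_eq_iff_of_lt {a n m x : ℕ} {g : Box → ℕ} {b : Box} (hx : x < a) :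
    seqE a n m g b = x ↔ g b = x := by
  induction m with
  | zero => rfl
  | succ m ih => rw [seqE, dn_eq_iff_of_lt (by omega), ih]

end Mirror

theorem eq_range'_of_mem_iff {l : List ℕ} (hl : l.Pairwise (· < ·)) {a m : ℕ}
    (h : ∀ x, x ∈ l ↔ a ≤ x ∧ x < a + m) : l = List.range' a m := by
  have h1 : (List.range' a m).Pairwise (· < ·) := List.pairwise_lt_range'
  refine hl.eq_of_mem_iff h1 fun x => ?_
  rw [h, List.mem_range'_1]

/-! ### The left key of `T.sharp`. -/

namespace Filling

variable {T : Filling}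

theorem mem_takeCols {c i x : ℕ} : (i, x) ∈ (T.takeCols c).boxes ↔ (i, x) ∈ T.boxes ∧ x < c := by
  simp only [takeCols, Finset.mem_filter]

theorem IsStraight.takeCols (hs : T.IsStraight) (c : ℕ) : (T.takeCols c).IsStraight := by
  intro i j i' j' hi hj h
  rw [mem_takeCols] at h ⊢
  exact ⟨hs _ _ _ _ hi hj h.1, by omega⟩

/-- The boxes outside of `T` in the order of `cssOrder`. -/
def cssBoxes (T : Filling) : List Box :=
  (List.range T.numCols).flatMap fun j =>
    ((List.range T.numRows).filter fun i => (i, j) ∉ T.boxes).map fun i => (i, j)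

theorem cssOrder_eq_map (T : Filling) : T.cssOrder = T.cssBoxes.map fun b => {b} := by
  rw [cssOrder, cssBoxes, List.map_flatMap]
  simp only [List.map_map]
  rfl

theorem mem_cssBoxes {i j : ℕ} :
    (i, j) ∈ T.cssBoxes ↔ i < T.numRows ∧ j < T.numCols ∧ (i, j) ∉ T.boxes := by
  simp only [cssBoxes, List.mem_flatMap, List.mem_range, List.mem_map, List.mem_filter,
    decide_eq_true_eq, Prod.mk.injEq]
  constructor
  · rintro ⟨b, hb, a, ⟨ha, h⟩, rfl, rfl⟩
    exact ⟨ha, hb, h⟩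
  · exact fun h => ⟨j, h.2.1, i, ⟨h.1, h.2.2⟩, rfl, rfl⟩

theorem pairwise_cssBoxes (T : Filling) :
    T.cssBoxes.Pairwise fun b c => b.2 < c.2 ∨ b.2 = c.2 ∧ b.1 < c.1 := by
  rw [cssBoxes, List.pairwise_flatMap]
  constructor
  · intro t _
    rw [List.pairwise_map]
    exact (List.pairwise_lt_range.filter _).imp fun h => Or.inr ⟨rfl, h⟩
  · refine List.pairwise_lt_range.imp fun {t t'} h => ?_
    intro p hp q hq
    simp only [List.mem_map] at hp hq
    obtain ⟨i, -, rfl⟩ := hp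
    obtain ⟨i', -, rfl⟩ := hq
    exact Or.inl h

/-- The strips of the first `j + 1` columns of `T.sharp`, then the boxes of `cssOrder`, then
everything outside of the rectangle. -/
noncomputable def mirrorFilling (T : Filling) (j : ℕ) : Box → ℕ := fun b =>
  if b.1 < T.numRows ∧ b.2 ≤ j then T.crPairs.length + T.labels.length - 1 -
    T.stage T.crPairs.length (T.numRows - 1 - b.1, T.numCols - 1 - b.2)
  else T.crPairs.length + T.labels.length + b.1 + b.2

theorem stage_rotate (hs : T.IsStraight) (hT : T.IsDecreasing) {i x : ℕ} (hi : i < T.numRows)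
    (hx : x < T.numCols) :
    T.stage T.crPairs.length (T.numRows - 1 - i, T.numCols - 1 - x) <
      T.crPairs.length + T.labels.length ∧
    ((i, x) ∈ T.boxes ↔ T.crPairs.length ≤
      T.stage T.crPairs.length (T.numRows - 1 - i, T.numCols - 1 - x)) := by
  have h1 := ((startModel hs hT).seqE_lt_iff le_rfl (T.numRows - 1 - i) (T.numCols - 1 - x)).2
    ⟨by omega, by omega⟩
  rw [Nat.add_comm] at h1
  refine ⟨h1, fun h => (sharp_entry hs hT h).1, fun h => ?_⟩
  have h2 := (mem_antiRectDec hs hT).1 (((rep_antiRectDec_stage hs hT).mem _).2 ⟨h, h1⟩)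
  have h3 := h2.2.2
  rwa [show T.numRows - 1 - (T.numRows - 1 - i) = i by omega,
    show T.numCols - 1 - (T.numCols - 1 - x) = x by omega] at h3

theorem mirror_mirrorFilling (hs : T.IsStraight) (hT : T.IsDecreasing) {j : ℕ}
    (hj : j < T.numCols) :
    Mirror T.numRows T.numCols j (T.crPairs.length + T.labels.length)
      (T.stage T.crPairs.length) (T.mirrorFilling j) := by
  refine ⟨?_, ?_, ?_⟩
  · intro i x hi hx
    have h1 := (stage_rotate hs hT hi (hx.trans_lt hj)).1
    rw [mirrorFilling, if_pos ⟨hi, hx⟩]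
    simp only
    omega
  · intro i x h
    rw [mirrorFilling, if_neg h]
    omega
  · intro i x h
    rw [← (startModel hs hT).seqE_lt_iff le_rfl] at h
    rw [stage]
    omega

theorem incr_mirrorFilling (hs : T.IsStraight) (hT : T.IsDecreasing) {j : ℕ}
    (hj : j < T.numCols) : Incr (T.mirrorFilling j) := by
  have hm := mirror_mirrorFilling hs hT hj
  have hg := (startModel hs hT).incr_seqE T.crPairs.length
  have key : ∀ i x i' x', (i' = i ∧ x' = x + 1 ∨ i' = i + 1 ∧ x' = x) →
      T.mirrorFilling j (i, x) < T.mirrorFilling j (i', x') := by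
    intro i x i' x' hadj
    by_cases h' : i' < T.numRows ∧ x' ≤ j
    · have h1 := hm.eq i x (by omega) (by omega)
      have h2 := hm.eq i' x' h'.1 h'.2
      have h3 : T.stage T.crPairs.length (T.numRows - 1 - i', T.numCols - 1 - x') <
          T.stage T.crPairs.length (T.numRows - 1 - i, T.numCols - 1 - x) := by
        rcases hadj with ⟨rfl, rfl⟩ | ⟨rfl, rfl⟩
        · exact hg.row_lt _ (by omega)
        · exact hg.col_lt _ (by omega)
      omega
    · by_cases h : i < T.numRows ∧ x ≤ j
      · have h1 := hm.eq i x h.1 h.2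
        have h2 := hm.outer_right i' x' h'
        omega
      · rw [mirrorFilling, if_neg h, mirrorFilling, if_neg h']
        simp only
        omega
  exact fun i x => ⟨key _ _ _ _ (Or.inl ⟨rfl, rfl⟩), key _ _ _ _ (Or.inr ⟨rfl, rfl⟩)⟩

/-- Reversing the process in the last `j + 1` columns. -/
theorem mirror_stage (hs : T.IsStraight) (hT : T.IsDecreasing) {j : ℕ} (hj : j < T.numCols)
    (s : ℕ) : s + T.roundEnd (T.numCols - 1 - j) ≤ T.crPairs.length →
    Mirror T.numRows T.numCols j (T.crPairs.length + T.labels.length)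
      (T.stage (T.crPairs.length - s)) (seqE 0 T.labels.length s (T.mirrorFilling j)) := by
  induction s with
  | zero => exact fun _ => mirror_mirrorFilling hs hT hj
  | succ s ih =>
    intro hle
    have hmod := startModel hs hT
    have h1 := ih (by omega)
    obtain ⟨p, hp⟩ : ∃ p, T.crPairs.length = p + 1 + s :=
      ⟨T.crPairs.length - (s + 1), by omega⟩
    rw [show T.crPairs.length - s = p + 1 by omega] at h1
    rw [show T.crPairs.length - (s + 1) = p by omega]
    have h2 : T.stage (p + 1) = dn p T.labels.length (T.stage p) := by
      rw [stage, seqE, Nat.zero_add]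
      rfl
    have h3 : up p T.labels.length (T.stage (p + 1)) = T.stage p := by
      rw [h2]
      exact up_dn (hmod.incr_seqE p) _ _
    rw [seqE, Nat.zero_add, ← h3]
    refine h1.apply_up (hmod.incr_seqE (p + 1)) hj ?_ _ s (by omega)
    rintro ⟨i, x⟩ hb
    -- Slides after stage `p + 1` do not touch level `p`, so its box is already in its final place.
    -- Its round is at least `numCols - 1 - j`, and in the final position the round is the column.
    have h4 : seqE 0 T.labels.length T.crPairs.length T.startFilling (i, x) = p := by
      rw [hp, seqE_add, seqE_eq_iff_of_lt (by omega)]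
      exact hb
    rw [hmod.final_eq_iff (rowLen_colLen hs) (by omega)] at h4
    have h5 := hs.latticeOrder.lt_roundStart_iff (q := T.numCols - 1 - j) (x := p) (by omega)
    have h6 : T.roundEnd (T.numCols - 1 - j) ≤ p := by omega
    rw [roundEnd] at h6
    simp only
    omega

theorem IsStraight.numRows_takeCols (hs : T.IsStraight) (j : ℕ) :
    (T.takeCols (j + 1)).numRows = T.numRows := by
  refine eq_of_forall_lt_iff fun i => ?_
  rw [(hs.takeCols _).lt_numRows_iff, hs.lt_numRows_iff, mem_takeCols]
  simp

theorem IsStraight.numCols_takeCols (hs : T.IsStraight) {j : ℕ} (hj : j < T.numCols) :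
    (T.takeCols (j + 1)).numCols = j + 1 := by
  refine eq_of_forall_lt_iff fun x => ?_
  rw [(hs.takeCols _).lt_numCols_iff, mem_takeCols, ← hs.lt_numCols_iff]
  omega

/-- Complementing the levels reverses the list of labels; some of them may be absent from the
truncated tableau. -/
theorem rep_mirrorFilling (hs : T.IsStraight) (hT : T.IsDecreasing) {j : ℕ} (hj : j < T.numCols) :
    Rep 0 T.labels.reverse (T.sharp.takeCols (j + 1)) (T.mirrorFilling j) := by
  have hm := mirror_mirrorFilling hs hT hj
  have hmem : ∀ i x, (i, x) ∈ (T.sharp.takeCols (j + 1)).boxes ↔ (i, x) ∈ T.boxes ∧ x < j + 1 :=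
    fun i x => by rw [mem_takeCols, mem_sharp hs hT]
  refine ⟨?_, ?_⟩
  · rintro ⟨i, x⟩
    rw [hmem, List.length_reverse]
    constructor
    · rintro ⟨h, hx⟩
      have h1 := sharp_entry hs hT h
      have h2 := hm.eq i x (lt_numRows h) (by omega)
      omega
    · rintro ⟨-, h⟩
      have h1 : i < T.numRows ∧ x ≤ j := by
        by_contra hc
        have := hm.outer_right i x hc
        omega
      have h2 := hm.eq i x h1.1 h1.2
      exact ⟨(stage_rotate hs hT h1.1 (by omega)).2.2 (by omega), by omega⟩
  · rintro ⟨i, x⟩ h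
    rw [hmem] at h
    have h1 := sharp_entry hs hT h.1
    have h2 := hm.eq i x (lt_numRows h.1) (by omega)
    refine h1.2.2.trans ?_
    rw [List.getD_eq_getElem _ _ (by omega), List.getD_eq_getElem _ _ (by
      rw [List.length_reverse]; omega), List.getElem_reverse]
    congr 1
    omega

theorem IsStraight.sharp (hs : T.IsStraight) (hT : T.IsDecreasing) : T.sharp.IsStraight := by
  intro i j i' j' hi hj h
  rw [mem_sharp hs hT] at h ⊢
  exact hs i j i' j' hi hj h

theorem numRows_sharp (hs : T.IsStraight) (hT : T.IsDecreasing) : T.sharp.numRows = T.numRows := by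
  rw [numRows, sharp_boxes hs hT, numRows]

theorem numCols_sharp (hs : T.IsStraight) (hT : T.IsDecreasing) : T.sharp.numCols = T.numCols := by
  rw [numCols, sharp_boxes hs hT, numCols]

theorem mem_cssBoxes_sharp (hs : T.IsStraight) (hT : T.IsDecreasing) {j : ℕ} (hj : j < T.numCols)
    {i x : ℕ} : (i, x) ∈ (T.sharp.takeCols (j + 1)).cssBoxes ↔
      i < T.numRows ∧ x ≤ j ∧
        T.stage T.crPairs.length (T.numRows - 1 - i, T.numCols - 1 - x) < T.crPairs.length := by
  have hS := hs.sharp hT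
  rw [mem_cssBoxes, hS.numRows_takeCols, hS.numCols_takeCols (by rwa [numCols_sharp hs hT]),
    numRows_sharp hs hT, mem_takeCols, mem_sharp hs hT]
  constructor
  · rintro ⟨h1, h2, h3⟩
    have h4 := (stage_rotate hs hT (x := x) h1 (by omega)).2
    refine ⟨h1, by omega, not_le.1 fun h5 => h3 ⟨h4.2 h5, h2⟩⟩
  · rintro ⟨h1, h2, h3⟩
    have h4 := (stage_rotate hs hT (x := x) h1 (by omega)).2
    refine ⟨h1, by omega, fun h5 => ?_⟩
    have := h4.1 h5.1
    omega

/-- After rotation, reading columns from left to right and from top to bottom meets the final boxes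
of `crOrder` in reverse order. The first `j + 1` columns contain exactly those of the rounds from
`numCols - 1 - j` on. So `cssOrder` undoes the last rounds one box at a time. -/
theorem map_cssBoxes_sharp (hs : T.IsStraight) (hT : T.IsDecreasing) {j : ℕ} (hj : j < T.numCols) :
    (T.sharp.takeCols (j + 1)).cssBoxes.map (T.mirrorFilling j) =
      List.range' T.labels.length (T.crPairs.length - T.roundEnd (T.numCols - 1 - j)) := by
  have hm := mirror_mirrorFilling hs hT hj
  have hmod := startModel hs hT
  have hpos : ∀ i x, (i, x) ∈ (T.sharp.takeCols (j + 1)).cssBoxes →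
      ∃ y < T.crPairs.length, T.mirrorFilling j (i, x) + y + 1 =
        T.crPairs.length + T.labels.length ∧ i < T.numRows ∧ x ≤ j ∧
        T.numCols - 1 - x = T.crRound y ∧ T.numRows - 1 - i + T.colLen x = T.crRow y := by
    intro i x h
    rw [mem_cssBoxes_sharp hs hT hj] at h
    have h1 := (hmod.final_eq_iff (rowLen_colLen hs) h.2.2 _ _).1 rfl
    refine ⟨_, h.2.2, hm.eq i x h.1 h.2.1, h.1, h.2.1, h1.1, ?_⟩
    have h2 := h1.2
    rw [← h1.1, show T.numCols - 1 - (T.numCols - 1 - x) = x by omega] at h2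
    exact h2
  refine eq_range'_of_mem_iff ?_ ?_
  · rw [List.pairwise_map]
    refine List.Pairwise.imp_of_mem ?_ (pairwise_cssBoxes _)
    rintro ⟨i, x⟩ ⟨i', x'⟩ hb hc hlt
    obtain ⟨y, hy, h1, h2, h3, h4, h5⟩ := hpos _ _ hb
    obtain ⟨y', hy', h1', h2', h3', h4', h5'⟩ := hpos _ _ hc
    simp only at hlt
    have h6 : y' < y := by
      rcases hlt with h6 | ⟨rfl, h6⟩
      · exact hs.latticeOrder.lt_of_t_lt hy' (by omega)
      · exact hs.latticeOrder.lt_of_r_lt hy' (by omega) (by omega)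
    omega
  · intro z
    rw [List.mem_map]
    constructor
    · rintro ⟨⟨i, x⟩, hb, rfl⟩
      obtain ⟨y, hy, h1, h2, h3, h4, h5⟩ := hpos _ _ hb
      have h6 := hs.latticeOrder.lt_roundStart_iff (q := T.numCols - 1 - j) hy
      rw [← roundEnd] at h6
      omega
    · rintro ⟨h1, h2⟩
      obtain ⟨y, hy⟩ : ∃ y, z + y + 1 = T.crPairs.length + T.labels.length :=
        ⟨T.crPairs.length + T.labels.length - 1 - z, by omega⟩
      have h6 := hs.latticeOrder.lt_roundStart_iff (q := T.numCols - 1 - j) (x := y) (by omega)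
      rw [← roundEnd] at h6
      obtain ⟨⟨i, x⟩, hb⟩ := hmod.attained_seqE le_rfl y (by omega)
      have h3 := (hmod.seqE_lt_iff le_rfl i x).1 (by omega)
      have h4 := (hmod.final_eq_iff (rowLen_colLen hs) (by omega) _ _).1 hb
      have h5 := hm.eq (T.numRows - 1 - i) (T.numCols - 1 - x) (by omega) (by omega)
      have h7 : (T.numRows - 1 - i, T.numCols - 1 - x) ∈ (T.sharp.takeCols (j + 1)).cssBoxes := by
        rw [mem_cssBoxes_sharp hs hT hj, show T.numRows - 1 - (T.numRows - 1 - i) = i by omega,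
          show T.numCols - 1 - (T.numCols - 1 - x) = x by omega, stage, hb]
        omega
      rw [show T.numRows - 1 - (T.numRows - 1 - i) = i by omega,
        show T.numCols - 1 - (T.numCols - 1 - x) = x by omega, stage, hb] at h5
      exact ⟨_, h7, by omega⟩

theorem rep_antiRectInc_sharp (hs : T.IsStraight) (hT : T.IsDecreasing) {j : ℕ}
    (hj : j < T.numCols) :
    Rep (T.crPairs.length - T.roundEnd (T.numCols - 1 - j)) T.labels.reverse
      (T.sharp.takeCols (j + 1)).antiRectInc (seqE 0 T.labels.length
        (T.crPairs.length - T.roundEnd (T.numCols - 1 - j)) (T.mirrorFilling j)) := by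
  have hnd : T.labels.reverse.Nodup := List.nodup_reverse.2 T.nodup_labels
  have hpw : T.labels.reverse.Pairwise (· ≤ ·) :=
    List.pairwise_reverse.2 (T.pairwise_labels.imp fun h => le_of_lt h)
  have hmap := map_cssBoxes_sharp hs hT hj
  have hlen := congrArg List.length hmap
  rw [List.length_map, List.length_range'] at hlen
  have hget : ∀ s (h : s < (T.sharp.takeCols (j + 1)).cssBoxes.length),
      T.mirrorFilling j (T.sharp.takeCols (j + 1)).cssBoxes[s] = T.labels.length + s := by
    intro s h
    have h1 : ((T.sharp.takeCols (j + 1)).cssBoxes.map (T.mirrorFilling j))[s]'(by simpa) =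
        (List.range' T.labels.length
          (T.crPairs.length - T.roundEnd (T.numCols - 1 - j)))[s]'(by simpa [← hlen]) := by
      simp only [hmap]
    rw [List.getElem_map, List.getElem_range'_1] at h1
    exact h1
  have h := (rep_mirrorFilling hs hT hj).foldl_slideStrip hnd (srt := fun s => s.sort (· ≤ ·))
    (fun s hs' => sort_eq_filter _ hnd hpw s hs') (T.sharp.takeCols (j + 1)).cssOrder
    (incr_mirrorFilling hs hT hj) (by
      intro s h b
      have h' : s < (T.sharp.takeCols (j + 1)).cssBoxes.length := by
        simpa [cssOrder_eq_map] using h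
      simp only [cssOrder_eq_map, List.getElem_map, Finset.mem_singleton, Nat.zero_add,
        List.length_reverse]
      constructor
      · rintro rfl
        exact hget s h'
      · intro hb
        have hm := mirror_mirrorFilling hs hT hj
        obtain ⟨i, x⟩ := b
        have h1 : i < T.numRows ∧ x ≤ j := by
          by_contra hc
          have := hm.outer_right i x hc
          omega
        have h2 := hm.eq i x h1.1 h1.2
        obtain ⟨s', h3, h4⟩ := List.mem_iff_getElem.1
          ((mem_cssBoxes_sharp hs hT hj).2 ⟨h1.1, h1.2, by omega⟩)
        have h5 := hget s' h3
        rw [h4] at h5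
        obtain rfl : s' = s := by omega
        exact h4.symm)
  rw [cssOrder_eq_map, List.length_map, hlen, Nat.zero_add, List.length_reverse,
    ← cssOrder_eq_map] at h
  exact h

/-- Undoing these rounds leads back to the stage at `roundEnd (numCols - 1 - j)`, and rotation
exchanges first and last column. -/
theorem column_antiRectInc_sharp (hs : T.IsStraight) (hT : T.IsDecreasing) {j : ℕ}
    (hj : j < T.numCols) :
    (T.sharp.takeCols (j + 1)).antiRectInc.column 0 = T.roundColumn (T.numCols - 1 - j) := by
  have hB : T.roundEnd (T.numCols - 1 - j) ≤ T.crPairs.length := roundStart_le _ _ _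
  have hm := mirror_stage hs hT hj (T.crPairs.length - T.roundEnd (T.numCols - 1 - j)) (by omega)
  rw [show T.crPairs.length - (T.crPairs.length - T.roundEnd (T.numCols - 1 - j)) =
    T.roundEnd (T.numCols - 1 - j) by omega] at hm
  ext v
  rw [(rep_antiRectInc_sharp hs hT hj).mem_column, mem_roundColumn hs hT, List.length_reverse]
  have hget : ∀ p q, p + q + 1 = T.labels.length →
      T.labels.reverse.getD p 0 = T.labels.getD q 0 := by
    intro p q hpq
    rw [List.getD_eq_getElem _ _ (by rw [List.length_reverse]; omega),
      List.getD_eq_getElem _ _ (by omega), List.getElem_reverse]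
    congr 1
    omega
  constructor
  · rintro ⟨i, h1, h2, h3⟩
    have h4 : i < T.numRows ∧ 0 ≤ j := by
      by_contra hc
      have := hm.outer_right i 0 hc
      omega
    have h5 := hm.eq i 0 h4.1 h4.2
    rw [Nat.sub_zero] at h5
    refine ⟨T.numRows - 1 - i, by omega, by omega, ?_⟩
    rw [← h3]
    exact (hget _ _ (by omega)).symm
  · rintro ⟨i, h1, h2, h3⟩
    have h4 := lt_numRows_of_stage_lt hs hT h2
    have h5 := hm.eq (T.numRows - 1 - i) 0 (by omega) (by omega)
    rw [Nat.sub_zero, show T.numRows - 1 - (T.numRows - 1 - i) = i by omega] at h5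
    refine ⟨T.numRows - 1 - i, by omega, by omega, ?_⟩
    rw [← h3]
    exact hget _ _ (by omega)

theorem rightKeyStar_eq_leftKey_sharp (hs : T.IsStraight) (hT : T.IsDecreasing) :
    T.rightKeyStar = T.sharp.leftKey := by
  rw [rightKeyStar, leftKey, numCols_sharp hs hT]
  refine List.map_congr_left fun j hj => ?_
  rw [List.mem_range] at hj
  rw [star_word_dropCols hs hT hj, column_antiRectInc_sharp hs hT hj]

end Filling

end KTableau

theorem mainTheorem11 (shape : YoungDiagram) (T : KTableau.Filling)
    (hshape : T.boxes = shape.cells) (hT : T.IsDecreasing) :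
    (T.sharp.boxes = shape.cells ∧ T.sharp.IsIncreasing) ∧
      T.rightKey = T.sharp.leftKey ∧ T.rightKeyStar = T.sharp.leftKey := by
  have hs : T.IsStraight := by
    intro i j i' j' hi hj h
    rw [hshape, YoungDiagram.mem_cells] at h ⊢
    exact shape.up_left_mem hi hj h
  have hkey := KTableau.Filling.rightKeyStar_eq_leftKey_sharp hs hT
  exact ⟨⟨(KTableau.Filling.sharp_boxes hs hT).trans hshape,
    KTableau.Filling.isIncreasing_sharp hs hT⟩,
    (KTableau.Filling.rightKey_eq_rightKeyStar hs hT).trans hkey, hkey⟩
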